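/- Let $p$ be a prime, $F$ a finite extension of $\mathbb{Q}_p$ with ring of integers $\mathcal{O}$, uniformizer $\varpi$ and residue field $\mathbb{F}_q$ of order $q$. Let $\ell\neq p$ be a prime and let $k$ be an algebraically closed field of characteristic $\ell$; fix a square root $q^{1/2}\in k$ of $q$. Let $G=GL_n(F)$, $K=GL_n(\mathcal{O})$, and let $I\subset K$ be the Iwahori subgroup of matrices that are upper triangular modulo $\varpi$. Assume that $\ell$ is quasi-banal: either $\ell\nmid \#GL_n(\mathbb{F}_q)$, or $\ell>n$ and $q\equiv 1 \pmod \ell$. For an open compact subgroup $H$ of $G$ let $k[G/H]$ be the space of finitely supported functions on $G/H$ with $G$ acting by left translation. The Hecke algebra $k[H\backslash G/H]$ is the space of $H$-invariants in $k[G/H]$, with convolution $(f*g)(x)=\sum_{y\in G/H}f(y)g(y^{-1}x)$. It acts on $V^H$ by $f*v=\sum_{y\in G/H}f(y)\,yv$ for every representation $V$ of $G$ over $k$, and on $k[G/H]$ on the right by convolution. Put $\mathcal{H}=\mathcal{H}(G,I)_k=k[I\backslash G/I]$ and $\mathcal{Z}_k=k[K\backslash G/K]$. Let $\mathcal{H}_{W,k}=k[I\backslash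 K/I]\subset\mathcal{H}$, and let $\mathbf{1}$ be the one-dimensional left $\mathcal{H}_{W,k}$-module on which $[IwI]$ acts by $[IwI:I]$. (1) There is an isomorphism of $\mathcal{H}$-modules $k[G/K]^I\cong \mathcal{H}\otimes_{\mathcal{H}_{W,k}}\mathbf{1}$. (2) Let $\Lambda=\mathbb{Z}^n$ and $\varpi^\mu=\mathrm{diag}(\varpi^{\mu_1},\dots,\varpi^{\mu_n})$, and put $\langle 2\rho,\mu\rangle=\sum_{i<j}(\mu_i-\mu_j)$. There is an injective homomorphism of $k$-algebras $\theta:k[\Lambda]\to\mathcal{H}$ (the Bernstein embedding), determined by $\theta(\mu)=q^{-\langle 2\rho,\mu\rangle/2}[I\varpi^\mu I]$ for $\mu_1\ge\cdots\ge\mu_n$. Let $\mathcal{A}_k$ be its image. There is an injective homomorphism of $k$-algebras $S:\mathcal{Z}_k\to k[\Lambda]$ (the Satake embedding), given by $S(z)(\mu)=q^{-\langle 2\rho,\mu\rangle/2}\int_U z(\varpi^\mu u)\,du$. Here $U$ is the group of unipotent upper triangular matrices and $U\cap K$ has measure $1$. Through $\theta\circ S$ regard $\mathcal{Z}_k$ as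 a subalgebra of $\mathcal{A}_k$. The map $a\mapsto a\otimes 1$ is an isomorphism of $k$-vector spaces $\mathcal{A}_k\cong\mathcal{H}\otimes_{\mathcal{H}_{W,k}}\mathbf{1}$; let $\mathcal{H}$ act on $\mathcal{A}_k$ through it. Let $\lambda:\mathcal{Z}_k\to k$ be any homomorphism of $k$-algebras and let $\mathcal{M}_{\lambda,k}=k[G/K]\otimes_{\mathcal{Z}_k,\lambda}k$. Then $\mathcal{A}_k\otimes_{\mathcal{Z}_k,\lambda}k$ has dimension $n!$ over $k$, and there is a $k$-linear isomorphism $\mathcal{A}_k\otimes_{\mathcal{Z}_k,\lambda}k\cong\mathcal{M}_{\lambda,k}^I$ that is $\mathcal{H}$-linear, where $h\in\mathcal{H}$ acts on the source by $h(a\otimes c)=(h\cdot a)\otimes c$. -/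

import Mathlib

open scoped TensorProduct

noncomputable section

namespace UnramifiedModule

/-! ### Fixed vectors and Hecke algebras of a group relative to a subgroup -/

section Hecke

variable {k G V : Type*} [CommRing k] [Group G] [AddCommGroup V] [Module k V]

/-- `V^H`: the vectors of a representation fixed by a subgroup `H`. -/
abbrev fixedVectors (ρ : Representation k G V) (H : Subgroup G) : Submodule k V :=
  Representation.invariants (ρ.comp H.subtype)

theorem mem_fixedVectors {ρ : Representation k G V} {H : Subgroup G} {v : V} :
    v ∈ fixedVectors ρ H ↔ ∀ h ∈ H, ρ h v = v :=
  ⟨fun hv h hh => hv ⟨h, hh⟩, fun hv h => hv h h.2⟩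

variable (k) in
/-- `k[G/H]`: finitely supported functions on `G/H`, with `G` acting by left translation. -/
def cosetRep (H : Subgroup G) : Representation k G ((G ⧸ H) →₀ k) where
  toFun g := Finsupp.lmapDomain k k (fun x => g • x)
  map_one' := by ext; simp
  map_mul' a b := by ext; simp [mul_smul]

@[simp] theorem cosetRep_single (H : Subgroup G) (g : G) (x : G ⧸ H) (c : k) :
    cosetRep k H g (Finsupp.single x c) = Finsupp.single (g • x) c := by
  simp [cosetRep]

/-- For `v ∈ V^H`, the map `k[G/H] → V`, `f ↦ ∑_{g ∈ G/H} f(g) g v`. -/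
def orbitMap (ρ : Representation k G V) {H : Subgroup G} (v : fixedVectors ρ H) :
    ((G ⧸ H) →₀ k) →ₗ[k] V :=
  Finsupp.linearCombination k fun x : G ⧸ H =>
    Quotient.liftOn' x (fun g => ρ g v) fun a b hab => by
      have h := mem_fixedVectors.1 v.2 _ (QuotientGroup.leftRel_apply.1 hab)
      calc ρ a v = ρ a (ρ (a⁻¹ * b) v) := by rw [h]
        _ = ρ b v := by rw [← Module.End.mul_apply, ← map_mul, mul_inv_cancel_left]

@[simp] theorem orbitMap_single (ρ : Representation k G V) {H : Subgroup G}
    (v : fixedVectors ρ H) (g : G) (c : k) :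
    orbitMap ρ v (Finsupp.single (g : G ⧸ H) c) = c • ρ g v := by
  simp [orbitMap, Finsupp.linearCombination_single]

theorem orbitMap_equivariant (ρ : Representation k G V) {H : Subgroup G}
    (v : fixedVectors ρ H) (g : G) (f : (G ⧸ H) →₀ k) :
    orbitMap ρ v (cosetRep k H g f) = ρ g (orbitMap ρ v f) := by
  induction f using Finsupp.induction_linear with
  | zero => simp
  | add f₁ f₂ h₁ h₂ => simp only [map_add, h₁, h₂]
  | single x c =>
    induction x using QuotientGroup.induction_on with
    | H a =>
      rw [cosetRep_single, orbitMap_single]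
      change orbitMap ρ v (Finsupp.single ((g * a : G) : G ⧸ H) c) = _
      rw [orbitMap_single, map_smul, map_mul, Module.End.mul_apply]

variable (k) in
/-- The Hecke algebra `k[H\G/H]`: the left `H`-invariant finitely supported functions on `G/H`. -/
abbrev HeckeAlgebra (H : Subgroup G) : Type _ := fixedVectors (cosetRep k H) H

namespace HeckeAlgebra

variable {H : Subgroup G}

/-- The action `f * v = ∑_{g ∈ G/H} f(g) g v` of the Hecke algebra on `V^H`. -/
def act (ρ : Representation k G V) (f : HeckeAlgebra k H) (v : fixedVectors ρ H) :
    fixedVectors ρ H :=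
  ⟨orbitMap ρ v f, mem_fixedVectors.2 fun h hh => by
    rw [← orbitMap_equivariant, mem_fixedVectors.1 f.2 h hh]⟩

@[simp] theorem coe_act (ρ : Representation k G V) (f : HeckeAlgebra k H)
    (v : fixedVectors ρ H) : (act ρ f v : V) = orbitMap ρ v f := rfl

/-- Convolution: `(f * g)(x) = ∑_{y ∈ G/H} f(y) g(y⁻¹ x)`. -/
instance : Mul (HeckeAlgebra k H) := ⟨fun f g => act (cosetRep k H) f g⟩

instance : One (HeckeAlgebra k H) :=
  ⟨⟨Finsupp.single ((1 : G) : G ⧸ H) 1, mem_fixedVectors.2 fun h hh => by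
    rw [cosetRep_single]
    congr 1
    change ((h * 1 : G) : G ⧸ H) = _
    rw [QuotientGroup.eq]
    simpa using hh⟩⟩

theorem coe_mul (f g : HeckeAlgebra k H) :
    ((f * g : HeckeAlgebra k H) : (G ⧸ H) →₀ k) = orbitMap (cosetRep k H) g f := rfl

theorem coe_one :
    ((1 : HeckeAlgebra k H) : (G ⧸ H) →₀ k) = Finsupp.single ((1 : G) : G ⧸ H) 1 := rfl

theorem orbitMap_act (ρ : Representation k G V) (g : HeckeAlgebra k H) (v : fixedVectors ρ H)
    (f : (G ⧸ H) →₀ k) :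
    orbitMap ρ (act ρ g v) f = orbitMap ρ v (orbitMap (cosetRep k H) g f) := by
  induction f using Finsupp.induction_linear with
  | zero => simp
  | add f₁ f₂ h₁ h₂ => simp only [map_add, h₁, h₂]
  | single x c =>
    induction x using QuotientGroup.induction_on with
    | H a =>
      rw [orbitMap_single, orbitMap_single, map_smul, orbitMap_equivariant, coe_act]

theorem orbitMap_one (f : (G ⧸ H) →₀ k) :
    orbitMap (cosetRep k H) (1 : HeckeAlgebra k H) f = f := by
  induction f using Finsupp.induction_linear with
  | zero => simp
  | add f₁ f₂ h₁ h₂ => rw [map_add, h₁, h₂]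
  | single x c =>
    induction x using QuotientGroup.induction_on with
    | H a =>
      rw [orbitMap_single, coe_one, cosetRep_single]
      change c • Finsupp.single ((a * 1 : G) : G ⧸ H) (1 : k) = _
      simp

theorem orbitMap_add (ρ : Representation k G V) (v w : fixedVectors ρ H) (f : (G ⧸ H) →₀ k) :
    orbitMap ρ (v + w) f = orbitMap ρ v f + orbitMap ρ w f := by
  induction f using Finsupp.induction_linear with
  | zero => simp only [map_zero, add_zero]
  | add f₁ f₂ h₁ h₂ => rw [map_add, map_add, map_add, h₁, h₂]; abel
  | single x c =>
    induction x using QuotientGroup.induction_on with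
    | H a => simp

theorem orbitMap_smul (ρ : Representation k G V) (c : k) (v : fixedVectors ρ H)
    (f : (G ⧸ H) →₀ k) : orbitMap ρ (c • v) f = c • orbitMap ρ v f := by
  induction f using Finsupp.induction_linear with
  | zero => simp
  | add f₁ f₂ h₁ h₂ => rw [map_add, map_add, h₁, h₂, smul_add]
  | single x d =>
    induction x using QuotientGroup.induction_on with
    | H a => rw [orbitMap_single, orbitMap_single, Submodule.coe_smul, map_smul, smul_comm]

theorem orbitMap_zero (ρ : Representation k G V) (f : (G ⧸ H) →₀ k) :
    orbitMap ρ (0 : fixedVectors ρ H) f = 0 := by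
  have := orbitMap_smul ρ 0 (0 : fixedVectors ρ H) f
  rwa [zero_smul, zero_smul] at this

instance : Ring (HeckeAlgebra k H) :=
  { (inferInstance : AddCommGroup (HeckeAlgebra k H)),
    (inferInstance : Mul (HeckeAlgebra k H)),
    (inferInstance : One (HeckeAlgebra k H)) with
    left_distrib := fun f g h => Subtype.ext (orbitMap_add (cosetRep k H) g h f)
    right_distrib := fun f g h => Subtype.ext (map_add (orbitMap (cosetRep k H) h) _ _)
    zero_mul := fun f => Subtype.ext (map_zero (orbitMap (cosetRep k H) f))
    mul_zero := fun _ => Subtype.ext (orbitMap_zero (cosetRep k H) _)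
    mul_assoc := fun f g h => Subtype.ext (orbitMap_act (cosetRep k H) g h f).symm
    one_mul := fun f => Subtype.ext (by
      rw [coe_mul, coe_one, orbitMap_single, map_one, one_smul]
      rfl)
    mul_one := fun f => Subtype.ext (orbitMap_one _) }

instance : Algebra k (HeckeAlgebra k H) :=
  Algebra.ofModule
    (fun c f g => Subtype.ext (map_smul (orbitMap (cosetRep k H) g) c _))
    (fun c f g => Subtype.ext (orbitMap_smul (cosetRep k H) c g f))

/-- `V^H` is a module over the Hecke algebra `k[H\G/H]`. -/
instance (ρ : Representation k G V) : Module (HeckeAlgebra k H) (fixedVectors ρ H) where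
  smul := act ρ
  one_smul v := Subtype.ext (by
    change orbitMap ρ v (Finsupp.single ((1 : G) : G ⧸ H) 1) = _
    simp)
  mul_smul f g v := Subtype.ext (orbitMap_act ρ g v f).symm
  smul_zero _ := Subtype.ext (orbitMap_zero ρ _)
  smul_add f v w := Subtype.ext (orbitMap_add ρ v w f)
  add_smul f g v := Subtype.ext (map_add (orbitMap ρ v) _ _)
  zero_smul v := Subtype.ext (map_zero (orbitMap ρ v))

variable (k H) in
/-- The characteristic function `[HgH]` (the double coset `HgH` is a finite union of left
cosets of `H` whenever `H` is a compact open subgroup). -/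
def doubleCoset (g : G) : HeckeAlgebra k H :=
  ⟨∑ᶠ x ∈ MulAction.orbit H (g : G ⧸ H), Finsupp.single x 1, mem_fixedVectors.2 fun h hh => by
    by_cases hfin : (MulAction.orbit H (g : G ⧸ H)).Finite
    · have hmap := AddMonoidHom.map_finsum_mem
        (fun x : G ⧸ H => (Finsupp.single x 1 : (G ⧸ H) →₀ k))
        (cosetRep k H h).toAddMonoidHom hfin
      refine hmap.trans ?_
      refine finsum_mem_eq_of_bijOn (fun x => h • x) ⟨?_, ?_, ?_⟩
        fun _ _ => cosetRep_single _ _ _ _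
      · intro x hx
        obtain ⟨a, rfl⟩ := hx
        exact ⟨⟨h, hh⟩ * a, mul_smul _ _ _⟩
      · exact (MulAction.injective h).injOn
      · intro x hx
        refine ⟨h⁻¹ • x, ?_, smul_inv_smul h x⟩
        obtain ⟨a, rfl⟩ := hx
        exact ⟨⟨h, hh⟩⁻¹ * a, mul_smul _ _ _⟩
    · by_cases h01 : (1 : k) = 0
      · have : Subsingleton k := subsingleton_of_zero_eq_one h01.symm
        exact Subsingleton.elim _ _
      · rw [finsum_mem_eq_zero_of_infinite, map_zero]
        refine Set.Infinite.mono (fun x hx => ⟨hx, ?_⟩) hfin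
        simpa using h01⟩

variable (k H) in
/-- The subalgebra `k[H\LH/H]` of functions supported on the image of the subgroup `L` in `G/H`. -/
def supportedOn (L : Subgroup G) : Subalgebra k (HeckeAlgebra k H) where
  carrier := {f | (f : (G ⧸ H) →₀ k) ∈
    Finsupp.supported k k ((QuotientGroup.mk : G → G ⧸ H) '' (L : Set G))}
  add_mem' hf hg := (Finsupp.supported k k
    ((QuotientGroup.mk : G → G ⧸ H) '' (L : Set G))).add_mem hf hg
  mul_mem' {f g} hf hg := by
    change orbitMap (cosetRep k H) g f ∈ Finsupp.supported k k _
    refine Submodule.sum_mem _ fun x hx => Submodule.smul_mem _ _ ?_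
    obtain ⟨a, ha, rfl⟩ := (Finsupp.mem_supported k _).1 hf hx
    change cosetRep k H a g ∈ Finsupp.supported k k _
    rw [Finsupp.mem_supported]
    classical
    refine (Finset.coe_subset.2 Finsupp.mapDomain_support).trans ?_
    rw [Finset.coe_image]
    rintro _ ⟨y, hy, rfl⟩
    obtain ⟨b, hb, rfl⟩ := (Finsupp.mem_supported k _).1 hg hy
    exact ⟨a * b, L.mul_mem ha hb, rfl⟩
  algebraMap_mem' c := by
    rw [Algebra.algebraMap_eq_smul_one]
    exact Submodule.smul_mem (Finsupp.supported k k _) c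
      (Finsupp.single_mem_supported k _ ⟨1, L.one_mem, rfl⟩)

variable (k H) in
/-- The trivial character `f ↦ ∑_{g ∈ G/H} f(g)`, i.e. `[HgH] ↦ [HgH : H]`. -/
def trivialChar : HeckeAlgebra k H →ₐ[k] k :=
  AlgHom.ofLinearMap
    ((Finsupp.linearCombination k fun _ : G ⧸ H => (1 : k)) ∘ₗ Submodule.subtype _)
    (by
      rw [LinearMap.comp_apply, Submodule.subtype_apply, coe_one]
      simp)
    (fun f g => by
      simp only [LinearMap.comp_apply, Submodule.subtype_apply, coe_mul]
      have hinv : ∀ (a : G) (u : (G ⧸ H) →₀ k),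
          Finsupp.linearCombination k (fun _ : G ⧸ H => (1 : k)) (cosetRep k H a u) =
            Finsupp.linearCombination k (fun _ : G ⧸ H => (1 : k)) u := fun a u => by
        change Finsupp.linearCombination k _ (Finsupp.mapDomain _ u) = _
        rw [Finsupp.linearCombination_mapDomain]
        rfl
      generalize (f : (G ⧸ H) →₀ k) = u
      induction u using Finsupp.induction_linear with
      | zero => simp
      | add f₁ f₂ h₁ h₂ => simp only [map_add, h₁, h₂, add_mul]
      | single x c =>
        induction x using QuotientGroup.induction_on with
        | H a =>
          rw [orbitMap_single, map_smul, hinv]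
          simp)

variable (k H) in
/-- The right action of `k[H\G/H]` on `k[G/H]` by convolution,
`(v * z)(x) = ∑_{y ∈ G/H} v(y) z(y⁻¹ x)`. -/
def rightConv : (HeckeAlgebra k H)ᵐᵒᵖ →ₐ[k] Module.End k ((G ⧸ H) →₀ k) :=
  AlgHom.ofLinearMap
    { toFun := fun z => orbitMap (cosetRep k H) z.unop
      map_add' := fun z w => LinearMap.ext fun f => orbitMap_add _ z.unop w.unop f
      map_smul' := fun c z => LinearMap.ext fun f => orbitMap_smul _ c z.unop f }
    (LinearMap.ext fun f => orbitMap_one f)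
    (fun z w => LinearMap.ext fun f => orbitMap_act (cosetRep k H) w.unop z.unop f)

end HeckeAlgebra

end Hecke

/-! ### Tensor product of a right module with a one-dimensional left module -/

section TensorChar

variable {k B V : Type*} [CommRing k] [Ring B] [Algebra k B] [AddCommGroup V] [Module k V]

/-- The relations `(v · b) ⊗ c = v ⊗ χ(b) c`, where `r` is the right action of `B` on `V`. -/
def charRelations (r : Bᵐᵒᵖ →ₐ[k] Module.End k V) (χ : B →ₐ[k] k) : Submodule k (V ⊗[k] k) :=
  Submodule.span k
    {x | ∃ (b : B) (v : V) (c : k), x = r (MulOpposite.op b) v ⊗ₜ[k] c - v ⊗ₜ[k] (χ b * c)}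

/-- `V ⊗_{B,χ} k`: the tensor product over `B` of the right `B`-module `V` (with right action
`r`) and the left `B`-module `k` on which `B` acts through the character `χ`. -/
abbrev TensorChar (r : Bᵐᵒᵖ →ₐ[k] Module.End k V) (χ : B →ₐ[k] k) : Type _ :=
  (V ⊗[k] k) ⧸ charRelations r χ

theorem charRelations_le_comap (r : Bᵐᵒᵖ →ₐ[k] Module.End k V) (χ : B →ₐ[k] k)
    (T : Module.End k V) (hT : ∀ b v, T (r b v) = r b (T v)) :
    charRelations r χ ≤ (charRelations r χ).comap (T.rTensor k) := by
  refine Submodule.span_le.2 ?_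
  rintro _ ⟨b, v, c, rfl⟩
  refine Submodule.subset_span ⟨b, T v, c, ?_⟩
  simp [hT]

variable {A : Type*} [Ring A] [Algebra k A]

/-- The right action `a · b = a f(b)` of `B` on `A` through an algebra homomorphism `f`. -/
def rightMul (f : B →ₐ[k] A) : Bᵐᵒᵖ →ₐ[k] Module.End k A :=
  AlgHom.ofLinearMap
    { toFun := fun b => LinearMap.mulRight k (f b.unop)
      map_add' := fun b c => LinearMap.ext fun a => by simp [mul_add]
      map_smul' := fun c b => LinearMap.ext fun a => by simp }
    (LinearMap.ext fun a => by simp)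
    (fun b c => LinearMap.ext fun a => by simp [mul_assoc])

/-- The left `A`-module `A ⊗_{B,χ} k`, where `B` acts on `A` by right multiplication through
`f : B → A`, and on `k` through the character `χ`. -/
def InducedModule (f : B →ₐ[k] A) (χ : B →ₐ[k] k) : Type _ := TensorChar (rightMul f) χ

namespace InducedModule

variable (f : B →ₐ[k] A) (χ : B →ₐ[k] k)

instance : AddCommGroup (InducedModule f χ) :=
  inferInstanceAs (AddCommGroup (TensorChar (rightMul f) χ))

instance : Module k (InducedModule f χ) :=
  inferInstanceAs (Module k (TensorChar (rightMul f) χ))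

/-- The pure tensor `a ⊗ c` in `A ⊗_{B,χ} k`. -/
def tmul (a : A) (c : k) : InducedModule f χ :=
  (charRelations (rightMul f) χ).mkQ (a ⊗ₜ[k] c)

/-- Left multiplication by `a` on `A ⊗_{B,χ} k`. -/
def leftMul (a : A) : Module.End k (InducedModule f χ) :=
  (charRelations (rightMul f) χ).mapQ _ ((LinearMap.mulLeft k a).rTensor k)
    (charRelations_le_comap _ _ _ fun b v => by simp [rightMul, mul_assoc])

theorem leftMul_mkQ (a : A) (x : A ⊗[k] k) :
    leftMul f χ a ((charRelations (rightMul f) χ).mkQ x) =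
      (charRelations (rightMul f) χ).mkQ ((LinearMap.mulLeft k a).rTensor k x) := rfl

/-- `a • (a' ⊗ c) = a a' ⊗ c`. -/
instance : Module A (InducedModule f χ) where
  smul a x := leftMul f χ a x
  one_smul x := by
    obtain ⟨y, rfl⟩ := Submodule.mkQ_surjective _ x
    change leftMul f χ 1 _ = _
    rw [leftMul_mkQ, LinearMap.mulLeft_one, LinearMap.rTensor_id, LinearMap.id_apply]
  mul_smul a b x := by
    obtain ⟨y, rfl⟩ := Submodule.mkQ_surjective _ x
    change leftMul f χ (a * b) _ = leftMul f χ a (leftMul f χ b _)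
    rw [leftMul_mkQ, leftMul_mkQ, leftMul_mkQ, LinearMap.mulLeft_mul, LinearMap.rTensor_comp,
      LinearMap.comp_apply]
  smul_zero a := map_zero (leftMul f χ a)
  smul_add a x y := map_add (leftMul f χ a) x y
  add_smul a b x := by
    obtain ⟨y, rfl⟩ := Submodule.mkQ_surjective _ x
    change leftMul f χ (a + b) _ = leftMul f χ a _ + leftMul f χ b _
    have h : LinearMap.mulLeft k (a + b) = LinearMap.mulLeft k a + LinearMap.mulLeft k b :=
      LinearMap.ext fun z => by simp [add_mul]
    rw [leftMul_mkQ, leftMul_mkQ, leftMul_mkQ, h, LinearMap.rTensor_add, LinearMap.add_apply,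
      map_add]
    rfl
  zero_smul x := by
    obtain ⟨y, rfl⟩ := Submodule.mkQ_surjective _ x
    change leftMul f χ 0 _ = _
    have h : LinearMap.mulLeft k (0 : A) = 0 := LinearMap.ext fun z => by simp
    rw [leftMul_mkQ, h, LinearMap.rTensor_zero, LinearMap.zero_apply, map_zero]
    rfl

theorem smul_tmul (a b : A) (c : k) : a • tmul f χ b c = tmul f χ (a * b) c := rfl

end InducedModule

/-- For a character `χ` of `k[H\G/H]`, the representation of `G` on
`M_χ = k[G/H] ⊗_{k[H\G/H], χ} k`, where `k[H\G/H]` acts on `k[G/H]` on the right by convolution. -/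
def universalModule {G : Type*} [Group G] (H : Subgroup G) (χ : HeckeAlgebra k H →ₐ[k] k) :
    Representation k G (TensorChar (HeckeAlgebra.rightConv k H) χ) where
  toFun g := (charRelations _ χ).mapQ _ ((cosetRep k H g).rTensor k)
    (charRelations_le_comap _ _ _ fun b v =>
      (orbitMap_equivariant (cosetRep k H) b.unop g v).symm)
  map_one' := by
    ext x
    simp
  map_mul' a b := by
    ext x
    simp

end TensorChar

/-! ### Subgroups of `GL_n` -/

section GeneralLinear

open Matrix

variable (n : ℕ)

/-- The Borel subgroup of upper triangular matrices in `GL_n(R)`. -/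
def borel (R : Type*) [CommRing R] : Subgroup (GL (Fin n) R) where
  carrier := {g | (g : Matrix (Fin n) (Fin n) R).BlockTriangular id}
  mul_mem' {a b} ha hb := by
    change ((a * b : GL (Fin n) R) : Matrix (Fin n) (Fin n) R).BlockTriangular id
    rw [Units.val_mul]
    exact BlockTriangular.mul ha hb
  one_mem' := by
    change ((1 : GL (Fin n) R) : Matrix (Fin n) (Fin n) R).BlockTriangular id
    rw [Units.val_one]
    exact blockTriangular_one
  inv_mem' {a} ha := by
    change ((a⁻¹ : GL (Fin n) R) : Matrix (Fin n) (Fin n) R).BlockTriangular id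
    let _ := a.invertible
    rw [coe_units_inv]
    exact blockTriangular_inv_of_blockTriangular ha

/-- The unipotent upper triangular matrices in `GL_n(R)`. -/
def unipotentUpper (R : Type*) [CommRing R] : Set (GL (Fin n) R) :=
  {u | u ∈ borel n R ∧ ∀ i, (u : Matrix (Fin n) (Fin n) R) i i = 1}

variable {O : Type*} (F : Type*) [CommRing O] [Field F] [Algebra O F]

variable (O) in
/-- The image `K` of `GL_n(O)` in `GL_n(F)`. -/
def maxCompact : Subgroup (GL (Fin n) F) :=
  (GeneralLinearGroup.map (n := Fin n) (algebraMap O F)).range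

/-- The Iwahori subgroup: the matrices in `GL_n(O)` that are upper triangular modulo `ϖ`. -/
def iwahori (ϖ : O) : Subgroup (GL (Fin n) F) :=
  ((borel n (O ⧸ Ideal.span {ϖ})).comap
    (GeneralLinearGroup.map (n := Fin n) (Ideal.Quotient.mk (Ideal.span {ϖ})))).map
      (GeneralLinearGroup.map (n := Fin n) (algebraMap O F))

variable {n F}

/-- The diagonal matrix `t^μ = diag(t^{μ_1}, …, t^{μ_n})`. -/
def diagPow (t : Fˣ) (μ : Fin n → ℤ) : GL (Fin n) F where
  val := diagonal fun i => ((t ^ μ i : Fˣ) : F)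
  inv := diagonal fun i => ((t ^ (-μ i) : Fˣ) : F)
  val_inv := by
    rw [diagonal_mul_diagonal, ← diagonal_one]
    congr 1
    ext i
    rw [← Units.val_mul]
    simp
  inv_val := by
    rw [diagonal_mul_diagonal, ← diagonal_one]
    congr 1
    ext i
    rw [← Units.val_mul]
    simp

/-- `⟨2ρ, μ⟩ = ∑_{i < j} (μ_i - μ_j)`. For dominant `μ` this is the length `l(ϖ^μ)`, so that
`[I ϖ^μ I : I] = q ^ l(ϖ^μ)`, and for all `μ` the modulus character of the upper triangular
Borel subgroup is `δ_B(ϖ^μ) = q ^ (-⟨2ρ, μ⟩)`. -/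
def twoRho (μ : Fin n → ℤ) : ℤ := ∑ i, ∑ j ∈ Finset.Ioi i, (μ i - μ j)

/-- `∫_U z(t u) du` for `z ∈ k[G/K]`, where `U` is the group of unipotent upper triangular
matrices and `U ∩ K` has measure one: the sum of `z` over the cosets `t u K`, `u ∈ U`. -/
def unipotentIntegral {k : Type*} [CommRing k] {K : Subgroup (GL (Fin n) F)}
    (z : (GL (Fin n) F ⧸ K) →₀ k) (t : GL (Fin n) F) : k :=
  ∑ᶠ x ∈ {x : GL (Fin n) F ⧸ K | ∃ u ∈ unipotentUpper n F, x = ((t * u : GL (Fin n) F) : _ ⧸ K)},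
    z x

/-- `ℓ` is quasi-banal for `GL_n` and a local field with residue field `κ` of order `q`: either
`ℓ` is banal, i.e. `ℓ ∤ #GL_n(κ)`, or `ℓ > n` and `q ≡ 1 mod ℓ`. -/
def IsQuasiBanal (ℓ n : ℕ) (κ : Type*) [CommRing κ] : Prop :=
  ¬ ℓ ∣ Nat.card (GL (Fin n) κ) ∨ (n < ℓ ∧ Nat.card κ ≡ 1 [MOD ℓ])

end GeneralLinear

/-- A uniformizer, as a nonzero element of the field `F`. -/
def uniformizerUnit {R F : Type*} [CommRing R] [Field F] [Algebra R F] {O : Subalgebra R F}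
    {ϖ : O} (hϖ : Irreducible ϖ) : Fˣ :=
  Units.mk0 (ϖ : F) fun h => hϖ.ne_zero (Subtype.ext h)

/-! ### The Iwahori-Hecke algebra and the spherical Hecke algebra -/

section IwahoriHecke

variable (k : Type*) [CommRing k] (n : ℕ)
variable {O : Type*} (F : Type*) [CommRing O] [Field F] [Algebra O F] (ϖ : O)

variable (O) in
/-- The spherical Hecke algebra `Z_k = k[K\G/K]`. -/
abbrev SphericalHecke : Type _ := HeckeAlgebra k (maxCompact n O F)

/-- The Iwahori-Hecke algebra `H(G,I)_k = k[I\G/I]`. -/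
abbrev IwahoriHecke : Type _ := HeckeAlgebra k (iwahori n F ϖ)

/-- The subalgebra `H_{W,k} = k[I\K/I]` of `H(G,I)_k`. -/
def finiteHecke : Subalgebra k (IwahoriHecke k n F ϖ) :=
  HeckeAlgebra.supportedOn k (iwahori n F ϖ) (maxCompact n O F)

/-- The trivial character `[IwI] ↦ [IwI : I]` of `H_{W,k}`. -/
def finiteTrivial : finiteHecke k n F ϖ →ₐ[k] k :=
  (HeckeAlgebra.trivialChar k (iwahori n F ϖ)).comp (finiteHecke k n F ϖ).val

/-- The left `H(G,I)_k`-module `H(G,I)_k ⊗_{H_{W,k}} 1`. -/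
abbrev InducedTrivial : Type _ :=
  InducedModule (finiteHecke k n F ϖ).val (finiteTrivial k n F ϖ)

end IwahoriHecke

section Bernstein

variable {k : Type*} [Field k] {n : ℕ}
variable {O : Type*} {F : Type*} [CommRing O] [Field F] [Algebra O F] {ϖ : O}

/-- `θ : k[Λ] → H(G,I)_k` is the Bernstein embedding: the algebra homomorphism with
`θ(ϖ^μ) = q^{-l(ϖ^μ)/2} [I ϖ^μ I]` for dominant `μ` (`μ_1 ≥ ⋯ ≥ μ_n`). These conditions determine
`θ`, since every weight is a difference of dominant ones. Here `Λ = ℤⁿ`, `t` is the uniformizer as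
an element of `F` and `s` is the chosen square root of `q` in `k`. -/
def IsBernsteinEmbedding (t : Fˣ) (s : k)
    (θ : AddMonoidAlgebra k (Fin n → ℤ) →ₐ[k] IwahoriHecke k n F ϖ) : Prop :=
  Function.Injective θ ∧ ∀ μ : Fin n → ℤ, Antitone μ →
    θ (AddMonoidAlgebra.single μ 1) =
      s ^ (-twoRho μ) • HeckeAlgebra.doubleCoset k (iwahori n F ϖ) (diagPow t μ)

/-- `S : k[K\G/K] → k[Λ]` is the Satake embedding: the algebra homomorphism given by
`S(z)(ϖ^μ) = δ_B(ϖ^μ)^{1/2} ∫_U z(ϖ^μ u) du`. -/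
def IsSatakeEmbedding (t : Fˣ) (s : k)
    (S : SphericalHecke k n O F →ₐ[k] AddMonoidAlgebra k (Fin n → ℤ)) : Prop :=
  Function.Injective S ∧ ∀ (z : SphericalHecke k n O F) (μ : Fin n → ℤ),
    (S z).coeff μ =
      s ^ (-twoRho μ) * unipotentIntegral (z : (_ ⧸ maxCompact n O F) →₀ k) (diagPow t μ)

end Bernstein

end UnramifiedModule

end

open UnramifiedModule

open scoped TensorProduct

noncomputable section

set_option linter.unusedSectionVars false

namespace UnramifiedModule

/-! ### Double cosets and coset averages for an abstract pair of groups. -/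

section AbstractHecke

variable {k G V W : Type*} [CommRing k] [Group G] [AddCommGroup V] [Module k V]
  [AddCommGroup W] [Module k W]

/-! Everything is compared with `k[G/K]^I`, which contains the characteristic function `1_K`. Since
`H_W` acts on `1_K` through the trivial character, `h ⊗ 1 ↦ h 1_K` maps `H ⊗_{H_W} 1` to `k[G/K]^I`.
It is bijective because `[K : I]` is nonzero in `k` (`inducedToFixed_bijective`,
`index_borel_ne_zero`). This is one of the two uses of quasi-banality.

The Bernstein homomorphism exists because `[I t^μ I]` is multiplicative on dominant `μ` and
invertible (`heckeMonomial_dominant_add`, `isUnit_heckeMonomial`).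

The core is that `x ↦ θ(x) 1_K` is an isomorphism `k[Λ] ≅ k[G/K]^I` (`bernsteinMap_bijective`). A
left inverse is explicit: the normalised integrals over the horocycles `t^μ U` recover the
coefficients of `x`. Surjectivity is a contraction argument in the style of Jacquet. Let `ν` be a
large multiple of a strictly dominant weight. By the Iwasawa decomposition, averaging `t^ν f` over
`N(O)` yields a combination of vectors `[I t^μ I] 1_K` with `μ` dominant, for any `f` in `k[G/K]`.
If `f` is `I`-invariant, the same average is a nonzero multiple of `[I t^ν I] f`, and this operator
is invertible.

The averages involve only `N(O)`, whose finite congruence quotients have order a power of `q`.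
Taking `I`-invariants need not be exact, since `ℓ` may divide `q - 1`, but the contraction replaces
exactness. Applied to `k[G/K] ⊗_{Z,λ} k`, it shows that `I`-invariants lift
(`toUniversalFixed_surjective`) and that relations between them come from relations in `k[Λ]`
(`mem_satakeRelations_of_toUniversalFixed_eq_zero`). So `A ⊗_{Z,λ} k ≅ M_λ^I`.

The Satake homomorphism is the inverse of the core isomorphism restricted to `k[K\G/K]`. Right
convolution commutes with the action of `H`, hence becomes multiplication in `k[Λ]`. By the
Bernstein relation (`swap_mul_eq`), `T_s` acts on `θ(x) 1_K` by `q` exactly when `s x = x`. If `q +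
1` is nonzero in `k`, which for `n ≥ 2` is the other use of quasi-banality, this means invariance
under `s`. So the Satake image is the ring of symmetric Laurent polynomials (`range_satake`). Over
it `k[Λ]` is free of rank `n!`, by adjoining the variables one at a time
(`exists_isFreeBasis_symmetric`), which gives the dimension. -/

theorem map_orbitMap {ρ : Representation k G V} {σ : Representation k G W} {H : Subgroup G}
    (T : V →ₗ[k] W) (hT : ∀ g v, T (ρ g v) = σ g (T v)) (v : fixedVectors ρ H)
    (w : fixedVectors σ H) (hw : (w : W) = T v) (f : (G ⧸ H) →₀ k) :
    T (orbitMap ρ v f) = orbitMap σ w f := by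
  induction f using Finsupp.induction_linear with
  | zero => simp
  | add f₁ f₂ h₁ h₂ => simp only [map_add, h₁, h₂]
  | single x c =>
    induction x using QuotientGroup.induction_on with
    | H a => rw [orbitMap_single, orbitMap_single, map_smul, hT, hw]

theorem smul_mk_coset {H : Subgroup G} (a b : G) : a • (b : G ⧸ H) = ((a * b : G) : G ⧸ H) := rfl

theorem mem_orbit_coset_iff {H K : Subgroup G} {g : G} {x : G ⧸ K} :
    x ∈ MulAction.orbit H (g : G ⧸ K) ↔ ∃ i ∈ H, ((i * g : G) : G ⧸ K) = x :=
  ⟨fun ⟨i, hi⟩ => ⟨i, i.2, hi⟩, fun ⟨i, hi, h⟩ => ⟨⟨i, hi⟩, h⟩⟩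

namespace HeckeAlgebra

variable {H : Subgroup G}

theorem coe_smul (ρ : Representation k G V) (f : HeckeAlgebra k H) (v : fixedVectors ρ H) :
    ((f • v : fixedVectors ρ H) : V) = orbitMap ρ v f := rfl

theorem coe_doubleCoset {g : G} (hg : (MulAction.orbit H (g : G ⧸ H)).Finite) :
    (doubleCoset k H g : (G ⧸ H) →₀ k) = ∑ x ∈ hg.toFinset, Finsupp.single x 1 :=
  finsum_mem_eq_finite_toFinset_sum _ hg

theorem coe_doubleCoset_smul (ρ : Representation k G V) (v : fixedVectors ρ H) {g : G}
    (hg : (MulAction.orbit H (g : G ⧸ H)).Finite) :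
    ((doubleCoset k H g • v : fixedVectors ρ H) : V) =
      ∑ x ∈ hg.toFinset, orbitMap ρ v (Finsupp.single x 1) := by
  rw [coe_smul, coe_doubleCoset hg, map_sum]

theorem doubleCoset_one : doubleCoset k H 1 = 1 := by
  have h : MulAction.orbit H ((1 : G) : G ⧸ H) = {((1 : G) : G ⧸ H)} := by
    ext x
    rw [mem_orbit_coset_iff]
    constructor
    · rintro ⟨i, hi, rfl⟩
      rw [Set.mem_singleton_iff, QuotientGroup.eq]
      simpa using hi
    · rintro rfl
      exact ⟨1, H.one_mem, by simp⟩
  apply Subtype.ext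
  change ∑ᶠ x ∈ _, _ = _
  rw [h, finsum_mem_singleton, coe_one]

/-- `[HgH] * [HhH] = [HghH]` when `H = (H ∩ g⁻¹Hg)(H ∩ hHh⁻¹)` and `H ∩ ghH(gh)⁻¹ ⊆ gHg⁻¹`. -/
theorem doubleCoset_mul {g h : G} (hg : (MulAction.orbit H (g : G ⧸ H)).Finite)
    (hh : (MulAction.orbit H (h : G ⧸ H)).Finite)
    (hgh : (MulAction.orbit H ((g * h : G) : G ⧸ H)).Finite)
    (hfac : ∀ x ∈ H, ∃ y ∈ H, ∃ z ∈ H, x = y * z ∧ g * y * g⁻¹ ∈ H ∧ h⁻¹ * z * h ∈ H)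
    (hconv : ∀ x ∈ H, (g * h)⁻¹ * x * (g * h) ∈ H → g⁻¹ * x * g ∈ H) :
    doubleCoset k H g * doubleCoset k H h = doubleCoset k H (g * h) := by
  classical
  apply Subtype.ext
  rw [coe_mul, coe_doubleCoset hg, coe_doubleCoset hgh, map_sum]
  have hex : ∀ x : G ⧸ H, ∃ i : G, x ∈ MulAction.orbit H ((g * h : G) : G ⧸ H) →
      i ∈ H ∧ ((i * (g * h) : G) : G ⧸ H) = x := fun x => by
    by_cases hx : x ∈ MulAction.orbit H ((g * h : G) : G ⧸ H)
    · obtain ⟨i, hi, rfl⟩ := mem_orbit_coset_iff.1 hx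
      exact ⟨i, fun _ => ⟨hi, rfl⟩⟩
    · exact ⟨1, fun h => absurd h hx⟩
  choose r hr using hex
  -- `hconv` makes the projection `HghH/H → HgH/H`, `i g h H ↦ i g H`, independent of the chosen
  -- representatives.
  have key : ∀ i ∈ H, ((r ((i * (g * h) : G) : G ⧸ H) * g : G) : G ⧸ H) = ((i * g : G) : G ⧸ H) :=
    fun i hi => by
      obtain ⟨hr1, hr2⟩ := hr ((i * (g * h) : G) : G ⧸ H) (mem_orbit_coset_iff.2 ⟨i, hi, rfl⟩)
      rw [QuotientGroup.eq] at hr2 ⊢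
      generalize r ((i * (g * h) : G) : G ⧸ H) = j at *
      have := hconv (j⁻¹ * i) (H.mul_mem (H.inv_mem hr1) hi) (by convert hr2 using 1; group)
      convert this using 1; group
  -- The cosets in `HghH/H` are grouped by this projection. The fibre over `i g H` is the translate
  -- by `i g` of `HhH/H`, where `hfac` shows that the translate stays inside `HghH/H`.
  rw [← Finset.sum_fiberwise_of_maps_to (s := hgh.toFinset) (t := hg.toFinset)
    (g := fun x => ((r x * g : G) : G ⧸ H))]
  · refine Finset.sum_congr rfl fun x hx => ?_
    obtain ⟨i, hi, rfl⟩ := mem_orbit_coset_iff.1 (hg.mem_toFinset.1 hx)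
    rw [orbitMap_single, one_smul, coe_doubleCoset hh, map_sum]
    refine Finset.sum_bij (fun y _ => (i * g) • y) ?_ ?_ ?_ ?_
    · intro y hy
      obtain ⟨j, hj, rfl⟩ := mem_orbit_coset_iff.1 (hh.mem_toFinset.1 hy)
      obtain ⟨y', hy', z, hz, rfl, h1, h2⟩ := hfac j hj
      have e : (i * g) • ((y' * z * h : G) : G ⧸ H) =
          (((i * (g * y' * g⁻¹)) * (g * h) : G) : G ⧸ H) := by
        rw [smul_mk_coset, QuotientGroup.eq]
        have : (i * g * (y' * z * h))⁻¹ * (i * (g * y' * g⁻¹) * (g * h)) = (h⁻¹ * z * h)⁻¹ := by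
          group
        rw [this]
        exact H.inv_mem h2
      rw [e, Finset.mem_filter, Set.Finite.mem_toFinset]
      refine ⟨mem_orbit_coset_iff.2 ⟨_, H.mul_mem hi h1, rfl⟩, ?_⟩
      rw [key _ (H.mul_mem hi h1), QuotientGroup.eq]
      have : (i * (g * y' * g⁻¹) * g)⁻¹ * (i * g) = y'⁻¹ := by group
      rw [this]
      exact H.inv_mem hy'
    · intro a _ b _ hab
      exact MulAction.injective _ hab
    · intro x hx
      rw [Finset.mem_filter, Set.Finite.mem_toFinset] at hx
      obtain ⟨hx1, hx2⟩ := hx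
      obtain ⟨j, hj, rfl⟩ := mem_orbit_coset_iff.1 hx1
      rw [key j hj, QuotientGroup.eq] at hx2
      refine ⟨((((i * g)⁻¹ * j * g) * h : G) : G ⧸ H), hh.mem_toFinset.2
        (mem_orbit_coset_iff.2 ⟨_, ?_, rfl⟩), ?_⟩
      · convert H.inv_mem hx2 using 1; group
      · rw [smul_mk_coset]; congr 1; group
    · intro y _
      rw [cosetRep_single]
  · intro x hx
    obtain ⟨j, hj, rfl⟩ := mem_orbit_coset_iff.1 (hgh.mem_toFinset.1 hx)
    rw [Set.Finite.mem_toFinset, key j hj]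
    exact mem_orbit_coset_iff.2 ⟨j, hj, rfl⟩

end HeckeAlgebra

/-! ### Averaging over the cosets of a subgroup of finite index -/

/-- The fibres of `N/S → N/T` all have `[T : S]` elements, and `F` is constant on each of them. -/
theorem finsum_out_eq_card_nsmul {N : Type*} [Group N] {S T : Subgroup N} [Finite (N ⧸ S)]
    (hST : S ≤ T) (F : N → V) (hF : ∀ n, ∀ t ∈ T, F (n * t) = F n) :
    ∑ᶠ q : N ⧸ S, F q.out = S.relIndex T • ∑ᶠ q : N ⧸ T, F q.out := by
  have hfT : Finite (N ⧸ T) :=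
    Finite.of_surjective (Subgroup.quotientMapOfLE hST) fun x => by
      induction x using QuotientGroup.induction_on with
      | H a => exact ⟨(a : N ⧸ S), rfl⟩
  have hfin : Finite (T ⧸ S.subgroupOf T) :=
    Finite.of_injective (fun y => (Subgroup.quotientEquivProdOfLE hST).symm (((1 : N) : N ⧸ T), y))
      fun a b hab => (Prod.ext_iff.1 ((Subgroup.quotientEquivProdOfLE hST).symm.injective hab)).2
  have := Fintype.ofFinite (N ⧸ S)
  have := Fintype.ofFinite (N ⧸ T)
  have := Fintype.ofFinite (T ⧸ S.subgroupOf T)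
  rw [finsum_eq_sum_of_fintype, finsum_eq_sum_of_fintype]
  have h1 : ∀ n : N, F (n : N ⧸ T).out = F n := fun n => by
    obtain ⟨t, ht⟩ := QuotientGroup.mk_out_eq_mul T n
    rw [ht, hF _ _ t.2]
  have h2 : ∀ q : N ⧸ S, F q.out = F (Subgroup.quotientMapOfLE hST q).out := fun q => by
    conv_rhs => rw [← QuotientGroup.out_eq' q]
    exact (h1 _).symm
  rw [← Equiv.sum_comp (Subgroup.quotientEquivProdOfLE hST).symm, Fintype.sum_prod_type]
  rw [Finset.smul_sum]
  refine Finset.sum_congr rfl fun q _ => ?_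
  have h3 : ∀ y : T ⧸ S.subgroupOf T, F ((Subgroup.quotientEquivProdOfLE hST).symm (q, y)).out =
      F q.out := fun y => by
    rw [h2]
    congr 2
    have := congrArg Prod.fst ((Subgroup.quotientEquivProdOfLE hST).apply_symm_apply (q, y))
    refine Eq.trans ?_ this
    generalize (Subgroup.quotientEquivProdOfLE hST).symm (q, y) = z
    induction z using QuotientGroup.induction_on with
    | H a => rfl
  rw [Finset.sum_congr rfl fun y _ => h3 y, Finset.sum_const, Finset.card_univ,
    ← Nat.card_eq_fintype_card]
  rfl

/-- The sum of the operators `ρ(n)` over representatives `n` of `N/S`. -/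
def cosetSum (ρ : Representation k G V) {N : Subgroup G} (S : Subgroup N) : Module.End k V :=
  ∑ᶠ q : N ⧸ S, ρ (q.out : G)

theorem cosetSum_apply (ρ : Representation k G V) {N : Subgroup G} (S : Subgroup N)
    [Finite (N ⧸ S)] (v : V) : cosetSum ρ S v = ∑ᶠ q : N ⧸ S, ρ (q.out : G) v := by
  have := Fintype.ofFinite (N ⧸ S)
  rw [cosetSum, finsum_eq_sum_of_fintype, finsum_eq_sum_of_fintype, LinearMap.sum_apply]

theorem map_cosetSum {ρ : Representation k G V} {σ : Representation k G W}
    (T : V →ₗ[k] W) (hT : ∀ g v, T (ρ g v) = σ g (T v)) {N : Subgroup G} (S : Subgroup N)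
    [Finite (N ⧸ S)] (v : V) : T (cosetSum ρ S v) = cosetSum σ S (T v) := by
  have := Fintype.ofFinite (N ⧸ S)
  rw [cosetSum_apply, cosetSum_apply, finsum_eq_sum_of_fintype, finsum_eq_sum_of_fintype, map_sum]
  exact Finset.sum_congr rfl fun q _ => hT _ _

/-- As `S` is normal, right multiplication by `u` permutes `N/S`. This is how an average over `N(O)`
absorbs an integral unipotent factor. -/
theorem cosetSum_translate (ρ : Representation k G V) {N : Subgroup G} (S : Subgroup N) [S.Normal]
    [Finite (N ⧸ S)] (u : N) (v : V) (hv : ∀ n ∈ S, ρ (n : G) v = v) :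
    cosetSum ρ S (ρ (u : G) v) = cosetSum ρ S v := by
  have := Fintype.ofFinite (N ⧸ S)
  have h1 : ∀ n : N, ρ (((n : N ⧸ S).out : N) : G) v = ρ (n : G) v := fun n => by
    obtain ⟨t, ht⟩ := QuotientGroup.mk_out_eq_mul S n
    rw [ht, Subgroup.coe_mul, map_mul, Module.End.mul_apply, hv _ t.2]
  rw [cosetSum_apply, cosetSum_apply, finsum_eq_sum_of_fintype, finsum_eq_sum_of_fintype,
    ← Equiv.sum_comp (Equiv.mulRight (u : N ⧸ S)) fun q => ρ (q.out : G) v]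
  refine Finset.sum_congr rfl fun q _ => ?_
  rw [← Module.End.mul_apply, ← map_mul, ← Subgroup.coe_mul, ← h1]
  congr 4
  rw [QuotientGroup.mk_mul, QuotientGroup.out_eq']
  rfl

/-- If `N ≤ H` acts transitively on `HgH/H`, then `∑_{n ∈ N/S} n g v` is a multiple of `[HgH] v`. -/
theorem cosetSum_eq_doubleCoset_smul (ρ : Representation k G V) {H N : Subgroup G} (g : G)
    (S T : Subgroup N) [Finite (N ⧸ S)] (hST : S ≤ T)
    (hT : ∀ n : N, n ∈ T ↔ g⁻¹ * n * g ∈ H) (hNH : N ≤ H)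
    (htr : ∀ h ∈ H, ∃ n ∈ N, (n * g)⁻¹ * (h * g) ∈ H) (v : fixedVectors ρ H) :
    (MulAction.orbit H (g : G ⧸ H)).Finite ∧
    cosetSum ρ S (ρ g v) =
      S.relIndex T • ((HeckeAlgebra.doubleCoset k H g • v : fixedVectors ρ H) : V) := by
  have horb : MulAction.orbit N (g : G ⧸ H) = MulAction.orbit H (g : G ⧸ H) := by
    ext x
    rw [mem_orbit_coset_iff, mem_orbit_coset_iff]
    constructor
    · rintro ⟨i, hi, rfl⟩
      exact ⟨i, hNH hi, rfl⟩
    · rintro ⟨i, hi, rfl⟩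
      obtain ⟨n, hn, h⟩ := htr i hi
      exact ⟨n, hn, QuotientGroup.eq.2 h⟩
  have hstab : MulAction.stabilizer N (g : G ⧸ H) = T := by
    ext n
    rw [MulAction.mem_stabilizer_iff, hT]
    change ((n * g : G) : G ⧸ H) = _ ↔ _
    rw [eq_comm, QuotientGroup.eq, mul_assoc]
  have hfT : Finite (N ⧸ T) :=
    Finite.of_surjective (Subgroup.quotientMapOfLE hST) fun x => by
      induction x using QuotientGroup.induction_on with
      | H a => exact ⟨(a : N ⧸ S), rfl⟩
  have hfin : (MulAction.orbit H (g : G ⧸ H)).Finite := by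
    rw [← horb]
    have e := (MulAction.orbitEquivQuotientStabilizer N (g : G ⧸ H)).trans
      (Subgroup.quotientEquivOfEq hstab)
    exact Set.finite_coe_iff.1 (Finite.of_equiv _ e.symm)
  refine ⟨hfin, ?_⟩
  have hF : ∀ n : N, ∀ t ∈ T, ρ ((n * t : N) : G) (ρ g v) = ρ (n : G) (ρ g v) := fun n t ht => by
    have h := mem_fixedVectors.1 v.2 _ ((hT t).1 ht)
    rw [Subgroup.coe_mul, map_mul, Module.End.mul_apply]
    congr 1
    conv_rhs => rw [← h]
    rw [← Module.End.mul_apply, ← Module.End.mul_apply, ← map_mul, ← map_mul]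
    congr 2
    group
  have := Fintype.ofFinite (N ⧸ T)
  rw [cosetSum_apply, finsum_out_eq_card_nsmul hST (fun n => ρ (n : G) (ρ g v)) hF,
    HeckeAlgebra.coe_doubleCoset_smul ρ v hfin, finsum_eq_sum_of_fintype]
  congr 1
  refine Finset.sum_bij (fun q _ => ((q.out * g : G) : G ⧸ H)) ?_ ?_ ?_ ?_
  · intro q _
    rw [Set.Finite.mem_toFinset]
    exact mem_orbit_coset_iff.2 ⟨_, hNH q.out.2, rfl⟩
  · intro a _ b _ hab
    rw [QuotientGroup.eq] at hab
    rw [← QuotientGroup.out_eq' a, ← QuotientGroup.out_eq' b, QuotientGroup.eq, hT]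
    convert hab using 1
    push_cast
    group
  · intro x hx
    rw [Set.Finite.mem_toFinset, ← horb] at hx
    obtain ⟨n, hn, rfl⟩ := mem_orbit_coset_iff.1 hx
    refine ⟨((⟨n, hn⟩ : N) : N ⧸ T), Finset.mem_univ _, ?_⟩
    obtain ⟨t, ht⟩ := QuotientGroup.mk_out_eq_mul T (⟨n, hn⟩ : N)
    rw [ht, eq_comm, QuotientGroup.eq]
    convert (hT t).1 t.2 using 1
    push_cast
    group
  · intro q _
    rw [orbitMap_single, one_smul, map_mul, Module.End.mul_apply]

end AbstractHecke

instance {k G V : Type*} [CommRing k] [Group G] [AddCommGroup V] [Module k V] {H : Subgroup G}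
    (ρ : Representation k G V) : IsScalarTower k (HeckeAlgebra k H) (fixedVectors ρ H) :=
  ⟨fun c f v => Subtype.ext (map_smul (orbitMap ρ v) c (f : (G ⧸ H) →₀ k))⟩

instance {k G V : Type*} [CommRing k] [Group G] [AddCommGroup V] [Module k V] {H : Subgroup G}
    (ρ : Representation k G V) : SMulCommClass k (HeckeAlgebra k H) (fixedVectors ρ H) :=
  ⟨fun c f v => Subtype.ext (HeckeAlgebra.orbitMap_smul ρ c v f).symm⟩

instance {k G V : Type*} [CommRing k] [Group G] [AddCommGroup V] [Module k V] {H : Subgroup G}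
    (ρ : Representation k G V) : SMulCommClass (HeckeAlgebra k H) k (fixedVectors ρ H) :=
  SMulCommClass.symm _ _ _

/-! ### The induced trivial module and the invariants of `k[G/K]`. -/

section Spherical

variable {k G : Type*} [Group G] {H K : Subgroup G}

section
variable [CommRing k]

variable (k K) in
/-- The characteristic function of `K`, as an `H`-invariant vector of `k[G/K]`. -/
def unitCoset (hHK : H ≤ K) : fixedVectors (cosetRep k K) H :=
  ⟨Finsupp.single ((1 : G) : G ⧸ K) 1, mem_fixedVectors.2 fun h hh => by
    rw [cosetRep_single, smul_mk_coset]
    congr 1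
    rw [QuotientGroup.eq]
    simpa using hHK hh⟩

theorem coe_unitCoset (hHK : H ≤ K) :
    (unitCoset k K hHK : (G ⧸ K) →₀ k) = Finsupp.single ((1 : G) : G ⧸ K) 1 := rfl

variable (k H) in
/-- The characteristic function of `K`, as a `K`-invariant vector of `k[G/H]`. -/
def subgroupIndicator (hfin : ((QuotientGroup.mk : G → G ⧸ H) '' (K : Set G)).Finite) :
    fixedVectors (cosetRep k H) K :=
  ⟨∑ x ∈ hfin.toFinset, Finsupp.single x 1, mem_fixedVectors.2 fun a ha => by
    rw [map_sum]
    refine Finset.sum_bij (fun x _ => a • x) ?_ (fun x _ y _ h => MulAction.injective a h) ?_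
      fun x _ => cosetRep_single _ _ _ _
    · intro x hx
      rw [Set.Finite.mem_toFinset] at hx ⊢
      obtain ⟨b, hb, rfl⟩ := hx
      exact ⟨a * b, K.mul_mem ha hb, rfl⟩
    · intro x hx
      rw [Set.Finite.mem_toFinset] at hx
      obtain ⟨b, hb, rfl⟩ := hx
      refine ⟨((a⁻¹ * b : G) : G ⧸ H), ?_, ?_⟩
      · rw [Set.Finite.mem_toFinset]
        exact ⟨a⁻¹ * b, K.mul_mem (K.inv_mem ha) hb, rfl⟩
      · rw [smul_mk_coset, mul_inv_cancel_left]⟩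

variable (hHK : H ≤ K) (hfin : ((QuotientGroup.mk : G → G ⧸ H) '' (K : Set G)).Finite)

theorem coe_subgroupIndicator : (subgroupIndicator k H hfin : (G ⧸ H) →₀ k) =
    ∑ x ∈ hfin.toFinset, Finsupp.single x 1 := rfl

variable (k) in
/-- The characteristic function of `K`, as an element of `k[H\G/H]`. -/
def heckeIndicator : HeckeAlgebra k H :=
  ⟨subgroupIndicator k H hfin, mem_fixedVectors.2 fun h hh =>
    mem_fixedVectors.1 (subgroupIndicator k H hfin).2 h (hHK hh)⟩

theorem heckeIndicator_mem : heckeIndicator k hHK hfin ∈ HeckeAlgebra.supportedOn k H K := by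
  refine Submodule.sum_mem (Finsupp.supported k k _) fun x hx => ?_
  exact Finsupp.single_mem_supported k _ (hfin.mem_toFinset.1 hx)

theorem trivialChar_heckeIndicator : HeckeAlgebra.trivialChar k H (heckeIndicator k hHK hfin) =
    (hfin.toFinset.card : k) := by
  change Finsupp.linearCombination k _ (∑ x ∈ hfin.toFinset, Finsupp.single x (1 : k)) = _
  simp

theorem orbitMap_unitCoset_subgroupIndicator :
    orbitMap (cosetRep k K) (unitCoset k K hHK) (subgroupIndicator k H hfin) =
      (hfin.toFinset.card : k) • Finsupp.single ((1 : G) : G ⧸ K) 1 := by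
  rw [coe_subgroupIndicator, map_sum]
  rw [Finset.card_eq_sum_ones, Nat.cast_sum, Finset.sum_smul]
  refine Finset.sum_congr rfl fun x hx => ?_
  obtain ⟨b, hb, rfl⟩ := hfin.mem_toFinset.1 hx
  rw [orbitMap_single, coe_unitCoset, cosetRep_single, smul_mk_coset, Nat.cast_one]
  congr 2
  rw [QuotientGroup.eq]
  simpa using hb

/-- `f ↦ f * 1_K` on `k[G/H]` is the composition of the direct image to `k[G/K]` and the inverse
image. -/
theorem mul_heckeIndicator (f : (G ⧸ H) →₀ k) :
    orbitMap (cosetRep k H) (heckeIndicator k hHK hfin) f =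
      orbitMap (cosetRep k H) (subgroupIndicator k H hfin)
        (orbitMap (cosetRep k K) (unitCoset k K hHK) f) := by
  refine (map_orbitMap (orbitMap (cosetRep k H) (subgroupIndicator k H hfin))
    (fun g v => orbitMap_equivariant _ _ _ _) (unitCoset k K hHK) _ ?_ f).symm
  rw [coe_unitCoset, orbitMap_single, map_one, one_smul]
  rfl

/-- Every coset in the support of `b` has a representative in `K`, which fixes `1_K`, so only the
sum of the values of `b` matters. This makes `h ⊗ c ↦ c (h 1_K)` well defined. -/
theorem smul_unitCoset_of_mem {b : HeckeAlgebra k H} (hb : b ∈ HeckeAlgebra.supportedOn k H K) :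
    b • unitCoset k K hHK = HeckeAlgebra.trivialChar k H b • unitCoset k K hHK := by
  apply Subtype.ext
  rw [HeckeAlgebra.coe_smul, Submodule.coe_smul, coe_unitCoset]
  change Finsupp.sum _ _ = Finsupp.linearCombination k _ _ • _
  rw [Finsupp.linearCombination_apply, Finsupp.sum, Finsupp.sum, Finset.sum_smul]
  refine Finset.sum_congr rfl fun x hx => ?_
  obtain ⟨a, ha, rfl⟩ := (Finsupp.mem_supported k _).1 hb hx
  have h := orbitMap_single (cosetRep k K) (unitCoset k K hHK) a ((b : (G ⧸ H) →₀ k) a)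
  rw [orbitMap, Finsupp.linearCombination_single] at h
  refine h.trans ?_
  rw [coe_unitCoset, cosetRep_single, smul_mk_coset, smul_eq_mul, mul_one a]
  have e : (a : G ⧸ K) = ((1 : G) : G ⧸ K) := by
    rw [eq_comm, QuotientGroup.eq]
    simpa using ha
  rw [e, mul_one]
  rfl

end

section
variable {k B A M : Type*} [CommRing k] [Ring B] [Algebra k B] [Ring A] [Algebra k A]
  [AddCommGroup M] [Module k M]

theorem TensorChar.mkQ_tmul_smul {r : Bᵐᵒᵖ →ₐ[k] Module.End k M} {χ : B →ₐ[k] k} (m : M) (c : k) :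
    (charRelations r χ).mkQ (m ⊗ₜ[k] c) = c • (charRelations r χ).mkQ (m ⊗ₜ[k] 1) := by
  rw [← map_smul, TensorProduct.smul_tmul', TensorProduct.smul_tmul, smul_eq_mul, mul_one]

theorem TensorChar.exists_mkQ {r : Bᵐᵒᵖ →ₐ[k] Module.End k M} {χ : B →ₐ[k] k}
    (x : TensorChar r χ) : ∃ m : M, x = (charRelations r χ).mkQ (m ⊗ₜ[k] 1) := by
  obtain ⟨y, rfl⟩ := Submodule.mkQ_surjective _ x
  refine ⟨TensorProduct.rid k M y, ?_⟩
  congr 1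
  rw [← TensorProduct.rid_symm_apply, LinearEquiv.symm_apply_apply]

theorem TensorChar.mkQ_act {r : Bᵐᵒᵖ →ₐ[k] Module.End k M} {χ : B →ₐ[k] k} (b : B) (m : M) :
    (charRelations r χ).mkQ (r (MulOpposite.op b) m ⊗ₜ[k] 1) =
      χ b • (charRelations r χ).mkQ (m ⊗ₜ[k] 1) := by
  rw [← TensorChar.mkQ_tmul_smul, ← sub_eq_zero, ← map_sub]
  refine (Submodule.Quotient.mk_eq_zero _).2 (Submodule.subset_span ⟨b, m, 1, ?_⟩)
  rw [mul_one]

/-- A linear map out of `M ⊗_{B,χ} k`. -/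
def TensorChar.lift {P : Type*} [AddCommGroup P] [Module k P] {r : Bᵐᵒᵖ →ₐ[k] Module.End k M}
    {χ : B →ₐ[k] k} (T : M →ₗ[k] P) (hT : ∀ b m, T (r (MulOpposite.op b) m) = χ b • T m) :
    TensorChar r χ →ₗ[k] P :=
  (charRelations r χ).liftQ (T ∘ₗ (TensorProduct.rid k M).toLinearMap) (by
    rw [charRelations, Submodule.span_le]
    rintro _ ⟨b, v, c, rfl⟩
    simp [hT, mul_comm (χ b) c, mul_smul])

@[simp] theorem TensorChar.lift_mkQ {P : Type*} [AddCommGroup P] [Module k P]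
    {r : Bᵐᵒᵖ →ₐ[k] Module.End k M} {χ : B →ₐ[k] k} (T : M →ₗ[k] P)
    (hT : ∀ b m, T (r (MulOpposite.op b) m) = χ b • T m) (m : M) (c : k) :
    TensorChar.lift T hT ((charRelations r χ).mkQ (m ⊗ₜ[k] c)) = c • T m := by
  change (T ∘ₗ (TensorProduct.rid k M).toLinearMap) (m ⊗ₜ[k] c) = _
  simp

end

section
variable [Field k] (hHK : H ≤ K)
  (hfin : ((QuotientGroup.mk : G → G ⧸ H) '' (K : Set G)).Finite)

variable (k) in
/-- The map `h ⊗ c ↦ c (h * 1_K)`. -/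
def inducedToFixed : InducedModule (HeckeAlgebra.supportedOn k H K).val
    ((HeckeAlgebra.trivialChar k H).comp (HeckeAlgebra.supportedOn k H K).val) →ₗ[k]
    fixedVectors (cosetRep k K) H :=
  TensorChar.lift (r := rightMul (HeckeAlgebra.supportedOn k H K).val)
    { toFun := fun h => h • unitCoset k K hHK
      map_add' := fun a b => add_smul _ _ _
      map_smul' := fun c a => smul_assoc c a _ } (fun b h => by
      change (h * (b : HeckeAlgebra k H)) • unitCoset k K hHK = _
      rw [mul_smul, smul_unitCoset_of_mem hHK b.2]
      exact smul_comm _ _ _)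

theorem inducedToFixed_tmul (h : HeckeAlgebra k H) (c : k) :
    inducedToFixed k hHK (InducedModule.tmul _ _ h c) = c • (h • unitCoset k K hHK) :=
  TensorChar.lift_mkQ _ _ _ _

theorem InducedModule.exists_tmul {A B : Type*} [Ring A] [Ring B] [Algebra k A] [Algebra k B]
    {f : B →ₐ[k] A} {χ : B →ₐ[k] k} (x : InducedModule f χ) :
    ∃ a : A, x = InducedModule.tmul f χ a 1 :=
  TensorChar.exists_mkQ x

/-- If `h` kills `1_K` in `k[G/K]`, then the convolution of `h` with the indicator of `K` in the
Hecke algebra is zero. In the tensor product that convolution equals `[K : H]` times `h ⊗ 1`, so `h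
⊗ 1 = 0`. Conversely, pulling `f` back to `G/H` and pushing it forward again multiplies it by `[K :
H]`. -/
theorem inducedToFixed_bijective (hcard : (hfin.toFinset.card : k) ≠ 0) :
    Function.Bijective (inducedToFixed k hHK) := by
  constructor
  · rw [injective_iff_map_eq_zero]
    intro x hx
    obtain ⟨h, rfl⟩ := InducedModule.exists_tmul x
    rw [inducedToFixed_tmul, one_smul] at hx
    have h0 : h * heckeIndicator k hHK hfin = 0 := by
      apply Subtype.ext
      rw [HeckeAlgebra.coe_mul, mul_heckeIndicator]
      rw [← HeckeAlgebra.coe_smul, hx]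
      exact map_zero _
    have h1 := TensorChar.mkQ_act (r := rightMul (HeckeAlgebra.supportedOn k H K).val)
      (χ := (HeckeAlgebra.trivialChar k H).comp (HeckeAlgebra.supportedOn k H K).val)
      ⟨_, heckeIndicator_mem hHK hfin⟩ h
    change InducedModule.tmul _ _ (h * heckeIndicator k hHK hfin) 1 =
      HeckeAlgebra.trivialChar k H (heckeIndicator k hHK hfin) • InducedModule.tmul _ _ h 1 at h1
    rw [h0, trivialChar_heckeIndicator] at h1
    have h2 : InducedModule.tmul (HeckeAlgebra.supportedOn k H K).val
      ((HeckeAlgebra.trivialChar k H).comp (HeckeAlgebra.supportedOn k H K).val) 0 1 = 0 := by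
      rw [InducedModule.tmul, TensorProduct.zero_tmul, map_zero]; rfl
    rw [h2, eq_comm] at h1
    exact (smul_eq_zero.1 h1).resolve_left hcard
  · intro f
    refine ⟨InducedModule.tmul _ _ ⟨orbitMap (cosetRep k H) (subgroupIndicator k H hfin) f,
      mem_fixedVectors.2 fun h hh => ?_⟩ (hfin.toFinset.card : k)⁻¹, ?_⟩
    · rw [← orbitMap_equivariant, mem_fixedVectors.1 f.2 h hh]
    · rw [inducedToFixed_tmul]
      apply Subtype.ext
      rw [Submodule.coe_smul, HeckeAlgebra.coe_smul]
      have := map_orbitMap (orbitMap (cosetRep k K) (unitCoset k K hHK))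
        (fun g v => orbitMap_equivariant _ _ _ _) (subgroupIndicator k H hfin)
        ((hfin.toFinset.card : k) • 1 : HeckeAlgebra k K) (by
          rw [orbitMap_unitCoset_subgroupIndicator]; rfl) f
      refine (congrArg _ this).trans ?_
      rw [HeckeAlgebra.orbitMap_smul, HeckeAlgebra.orbitMap_one, smul_smul, inv_mul_cancel₀ hcard, one_smul]

/-- `H(G,H) ⊗_{k[H\K/H]} 1 ≅ k[G/K]^H` when `[K : H]` is invertible in `k`. -/
def inducedEquivFixed (hcard : (hfin.toFinset.card : k) ≠ 0) :
    InducedModule (HeckeAlgebra.supportedOn k H K).val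
      ((HeckeAlgebra.trivialChar k H).comp (HeckeAlgebra.supportedOn k H K).val)
      ≃ₗ[HeckeAlgebra k H] fixedVectors (cosetRep k K) H :=
  LinearEquiv.ofBijective
    { toFun := inducedToFixed k hHK
      map_add' := map_add _
      map_smul' := fun h x => by
        obtain ⟨a, rfl⟩ := InducedModule.exists_tmul x
        rw [InducedModule.smul_tmul, inducedToFixed_tmul, inducedToFixed_tmul, one_smul, one_smul,
          RingHom.id_apply, mul_smul] }
    (inducedToFixed_bijective hHK hfin hcard)

theorem inducedEquivFixed_tmul (hcard : (hfin.toFinset.card : k) ≠ 0) (h : HeckeAlgebra k H) :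
    inducedEquivFixed hHK hfin hcard (InducedModule.tmul _ _ h 1) = h • unitCoset k K hHK :=
  (inducedToFixed_tmul hHK h 1).trans (one_smul _ _)

end

end Spherical

section

/-! ### The filtration of `F` by powers of the uniformizer. -/

section Fil

variable (O : Type*) {F : Type*} [CommRing O] [Field F] [Algebra O F]

/-- The fractional ideal `t^m O` of `F`. -/
def fil (t : Fˣ) (m : ℤ) : AddSubgroup F where
  carrier := {x | ∃ a : O, algebraMap O F a * ((t ^ m : Fˣ) : F) = x}
  add_mem' := by
    rintro _ _ ⟨a, rfl⟩ ⟨b, rfl⟩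
    exact ⟨a + b, by rw [map_add, add_mul]⟩
  zero_mem' := ⟨0, by simp⟩
  neg_mem' := by
    rintro _ ⟨a, rfl⟩
    exact ⟨-a, by simp⟩

variable {O} {t : Fˣ}

theorem mem_fil {m : ℤ} {x : F} :
    x ∈ fil O t m ↔ ∃ a : O, algebraMap O F a * ((t ^ m : Fˣ) : F) = x := Iff.rfl

theorem mem_fil_zero {x : F} : x ∈ fil O t 0 ↔ ∃ a : O, algebraMap O F a = x := by
  simp [mem_fil]

theorem algebraMap_mem_fil (a : O) : algebraMap O F a ∈ fil O t 0 := mem_fil_zero.2 ⟨a, rfl⟩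

theorem one_mem_fil : (1 : F) ∈ fil O t 0 := mem_fil_zero.2 ⟨1, map_one _⟩

theorem mul_mem_fil {a b : ℤ} {x y : F} (hx : x ∈ fil O t a) (hy : y ∈ fil O t b) :
    x * y ∈ fil O t (a + b) := by
  obtain ⟨c, rfl⟩ := hx
  obtain ⟨d, rfl⟩ := hy
  refine ⟨c * d, ?_⟩
  rw [zpow_add, Units.val_mul, map_mul]
  ring

theorem zpow_mem_fil (m : ℤ) : ((t ^ m : Fˣ) : F) ∈ fil O t m := ⟨1, by simp⟩

theorem zpow_mul_mem_fil {a m : ℤ} {x : F} :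
    ((t ^ m : Fˣ) : F) * x ∈ fil O t (m + a) ↔ x ∈ fil O t a := by
  constructor
  · intro h
    have := mul_mem_fil (zpow_mem_fil (O := O) (t := t) (-m)) h
    rwa [← mul_assoc, ← Units.val_mul, ← zpow_add, neg_add_cancel, zpow_zero, Units.val_one,
      one_mul, neg_add_cancel_left] at this
  · exact mul_mem_fil (zpow_mem_fil m)

theorem fil_mono {ϖ : O} (ht : (t : F) = algebraMap O F ϖ) {a b : ℤ} (hab : a ≤ b) :
    fil O t b ≤ fil O t a := by
  rintro _ ⟨c, rfl⟩
  obtain ⟨m, rfl⟩ := Int.le.dest hab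
  refine ⟨c * ϖ ^ m, ?_⟩
  rw [map_mul, map_pow, ← ht, add_comm, zpow_add, Units.val_mul, zpow_natCast, Units.val_pow_eq_pow_val]
  ring

theorem mem_fil_of_le {ϖ : O} (ht : (t : F) = algebraMap O F ϖ) {a b : ℤ} (hab : a ≤ b) {x : F}
    (hx : x ∈ fil O t b) : x ∈ fil O t a := fil_mono ht hab hx

theorem mem_fil_natCast {ϖ : O} (ht : (t : F) = algebraMap O F ϖ) {m : ℕ} {x : F} :
    x ∈ fil O t m ↔ ∃ a : O, algebraMap O F (ϖ ^ m * a) = x := by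
  rw [mem_fil]
  refine exists_congr fun a => ?_
  rw [map_mul, map_pow, ← ht, zpow_natCast, Units.val_pow_eq_pow_val, mul_comm]

theorem sum_mul_mem_fil {ι : Type*} [Fintype ι] {a b : ι → ℤ} {c : ℤ} {x y : ι → F}
    {ϖ : O} (ht : (t : F) = algebraMap O F ϖ)
    (hx : ∀ i, x i ∈ fil O t (a i)) (hy : ∀ i, y i ∈ fil O t (b i)) (hc : ∀ i, c ≤ a i + b i) :
    ∑ i, x i * y i ∈ fil O t c :=
  sum_mem fun i _ => mem_fil_of_le ht (hc i) (mul_mem_fil (hx i) (hy i))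

theorem algebraMap_inv_unit (u : Oˣ) :
    algebraMap O F ((u⁻¹ : Oˣ) : O) = (algebraMap O F u)⁻¹ := by
  refine eq_inv_of_mul_eq_one_left ?_
  rw [← map_mul]
  simp

variable [IsDomain O] [IsDiscreteValuationRing O] [IsFractionRing O F]

theorem exists_eq_unit_mul_zpow {ϖ : O} (hϖ : Irreducible ϖ) (ht : (t : F) = algebraMap O F ϖ)
    {x : F} (hx : x ≠ 0) : ∃ (u : Oˣ) (m : ℤ), x = algebraMap O F u * ((t ^ m : Fˣ) : F) := by
  obtain ⟨a, b, hb, rfl⟩ := IsFractionRing.div_surjective (A := O) x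
  have ha0 : a ≠ 0 := by rintro rfl; simp at hx
  have hb0 : b ≠ 0 := nonZeroDivisors.ne_zero hb
  obtain ⟨i, u, rfl⟩ := IsDiscreteValuationRing.eq_unit_mul_pow_irreducible ha0 hϖ
  obtain ⟨j, v, rfl⟩ := IsDiscreteValuationRing.eq_unit_mul_pow_irreducible hb0 hϖ
  refine ⟨u * v⁻¹, i - j, ?_⟩
  have hv : algebraMap O F v ≠ 0 := by
    rw [Ne, IsFractionRing.to_map_eq_zero_iff]
    exact v.ne_zero
  rw [Units.val_mul, map_mul, map_mul, map_mul, algebraMap_inv_unit, map_pow, map_pow, ← ht, zpow_sub, zpow_natCast,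
    zpow_natCast, Units.val_mul, Units.val_inv_eq_inv_val, Units.val_pow_eq_pow_val,
    Units.val_pow_eq_pow_val]
  have : (t : F) ≠ 0 := t.ne_zero
  field_simp

theorem exists_mem_fil {ϖ : O} (hϖ : Irreducible ϖ) (ht : (t : F) = algebraMap O F ϖ) (x : F) :
    ∃ m : ℤ, x ∈ fil O t m := by
  by_cases hx : x = 0
  · exact ⟨0, hx ▸ zero_mem _⟩
  · obtain ⟨u, m, rfl⟩ := exists_eq_unit_mul_zpow hϖ ht hx
    exact ⟨m, u, rfl⟩

/-- The units of the valuation ring. -/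
theorem inv_mem_fil_zero {ϖ : O} (hϖ : Irreducible ϖ) (ht : (t : F) = algebraMap O F ϖ) {x : F}
    (hx : x ∈ fil O t 0) (hx1 : x ∉ fil O t 1) : x ≠ 0 ∧ x⁻¹ ∈ fil O t 0 := by
  obtain ⟨a, rfl⟩ := mem_fil_zero.1 hx
  have ha : IsUnit a := by
    by_contra h
    have h2 : ϖ ∣ a := by
      rw [← Ideal.mem_span_singleton, ← (IsDiscreteValuationRing.irreducible_iff_uniformizer ϖ).1 hϖ]
      exact h
    obtain ⟨b, rfl⟩ := h2
    exact hx1 ((mem_fil_natCast (m := 1) ht).2 ⟨b, by rw [pow_one]⟩)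
  obtain ⟨u, rfl⟩ := ha
  have hu : algebraMap O F u ≠ 0 := by
    rw [Ne, IsFractionRing.to_map_eq_zero_iff]
    exact u.ne_zero
  refine ⟨hu, mem_fil_zero.2 ⟨((u⁻¹ : Oˣ) : O), algebraMap_inv_unit u⟩⟩

theorem one_notMem_fil_one {ϖ : O} (hϖ : Irreducible ϖ) (ht : (t : F) = algebraMap O F ϖ) :
    (1 : F) ∉ fil O t 1 := by
  intro h
  obtain ⟨a, ha⟩ := (mem_fil_natCast (m := 1) ht).1 h
  rw [← map_one (algebraMap O F)] at ha
  have := IsFractionRing.injective O F ha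
  rw [pow_one] at this
  exact hϖ.not_isUnit (IsUnit.of_mul_eq_one _ this)

theorem notMem_fil_one_of_mul {ϖ : O} (hϖ : Irreducible ϖ) (ht : (t : F) = algebraMap O F ϖ)
    {x y : F} (hy : y ∈ fil O t 0) (h : x * y - 1 ∈ fil O t 1) : x ∉ fil O t 1 := fun hx => by
  have h1 := sub_mem (mul_mem_fil hx hy) (by simpa using h)
  rw [sub_sub_cancel] at h1
  exact one_notMem_fil_one hϖ ht (by simpa using h1)

end Fil

/-! ### Entrywise descriptions of `K`, of the Iwahori subgroup, and of monomial conjugation. -/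

section Groups

open Matrix

variable {n : ℕ} {O F : Type*} [CommRing O] [Field F] [Algebra O F] {t : Fˣ}

theorem mem_borel_iff {R : Type*} [CommRing R] {g : GL (Fin n) R} :
    g ∈ borel n R ↔ ∀ i j, j < i → g i j = 0 := Iff.rfl

theorem GL_mul_apply {R : Type*} [CommRing R] (g h : GL (Fin n) R) (i j : Fin n) :
    (g * h) i j = ∑ l, g i l * h l j := by
  rw [← Matrix.mul_apply]
  rfl

theorem mem_maxCompact_of_det {g : GL (Fin n) F} (h : ∀ i j, g i j ∈ fil O t 0)
    (hd : ∃ u : Oˣ, algebraMap O F u = (g : Matrix (Fin n) (Fin n) F).det) [FaithfulSMul O F] :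
    g ∈ maxCompact n O F := by
  choose X hX using fun i j => mem_fil_zero.1 (h i j)
  obtain ⟨u, hu⟩ := hd
  have hXg : (algebraMap O F).mapMatrix (Matrix.of X) = (g : Matrix (Fin n) (Fin n) F) := by
    ext i j
    exact hX i j
  have hdet : (Matrix.of X).det = u := by
    apply FaithfulSMul.algebraMap_injective O F
    rw [RingHom.map_det, hXg, hu]
  refine ⟨GeneralLinearGroup.mk'' (Matrix.of X) (hdet ▸ u.isUnit), ?_⟩
  ext i j
  exact hX i j

theorem mem_maxCompact_iff [FaithfulSMul O F] {g : GL (Fin n) F} :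
    g ∈ maxCompact n O F ↔ (∀ i j, g i j ∈ fil O t 0) ∧ ∀ i j, g⁻¹ i j ∈ fil O t 0 := by
  constructor
  · rintro ⟨X, rfl⟩
    refine ⟨fun i j => mem_fil_zero.2 ⟨X i j, rfl⟩, fun i j => mem_fil_zero.2 ⟨X⁻¹ i j, ?_⟩⟩
    rw [← map_inv]
    rfl
  · rintro ⟨h1, h2⟩
    choose X hX using fun i j => mem_fil_zero.1 (h1 i j)
    choose Y hY using fun i j => mem_fil_zero.1 (h2 i j)
    have hXg : (algebraMap O F).mapMatrix (Matrix.of X) = (g : Matrix (Fin n) (Fin n) F) := by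
      ext i j
      exact hX i j
    have hYg : (algebraMap O F).mapMatrix (Matrix.of Y) =
        ((g⁻¹ : GL (Fin n) F) : Matrix (Fin n) (Fin n) F) := by
      ext i j
      exact hY i j
    have hinj : Function.Injective (algebraMap O F).mapMatrix (α := Matrix (Fin n) (Fin n) O) :=
      Matrix.map_injective (FaithfulSMul.algebraMap_injective O F)
    refine ⟨⟨Matrix.of X, Matrix.of Y, hinj ?_, hinj ?_⟩, ?_⟩
    · rw [map_mul, map_one, hXg, hYg, ← Units.val_mul, mul_inv_cancel, Units.val_one]
    · rw [map_mul, map_one, hXg, hYg, ← Units.val_mul, inv_mul_cancel, Units.val_one]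
    · ext i j
      exact hX i j

/-- The level of the entry `(i, j)` of the Iwahori subgroup. -/
def iwLevel (i j : Fin n) : ℤ := if j < i then 1 else 0

theorem iwLevel_nonneg (i j : Fin n) : 0 ≤ iwLevel i j := by
  unfold iwLevel; split_ifs <;> norm_num

theorem iwLevel_le_one (i j : Fin n) : iwLevel i j ≤ 1 := by
  unfold iwLevel; split_ifs <;> norm_num

theorem mem_iwahori_iff_lower [FaithfulSMul O F] {ϖ : O} (ht : (t : F) = algebraMap O F ϖ)
    {g : GL (Fin n) F} :
    g ∈ iwahori n F ϖ ↔ g ∈ maxCompact n O F ∧ ∀ i j, j < i → g i j ∈ fil O t 1 := by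
  have key : ∀ X : GL (Fin n) O, GeneralLinearGroup.map (n := Fin n)
      (Ideal.Quotient.mk (Ideal.span {ϖ})) X ∈ borel n (O ⧸ Ideal.span {ϖ}) ↔
      ∀ i j, j < i → algebraMap O F (X i j) ∈ fil O t 1 := fun X => by
    rw [mem_borel_iff]
    refine forall_congr' fun i => forall_congr' fun j => imp_congr_right fun _ => ?_
    rw [GeneralLinearGroup.map_apply, Ideal.Quotient.eq_zero_iff_mem, Ideal.mem_span_singleton]
    have := mem_fil_natCast (O := O) ht (m := 1) (x := algebraMap O F (X i j))
    rw [Nat.cast_one] at this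
    rw [this, pow_one]
    constructor
    · rintro ⟨c, hc⟩
      exact ⟨c, by rw [hc]⟩
    · rintro ⟨c, hc⟩
      exact ⟨c, (FaithfulSMul.algebraMap_injective O F hc).symm⟩
  constructor
  · rintro ⟨X, hX, rfl⟩
    exact ⟨⟨X, rfl⟩, (key X).1 hX⟩
  · rintro ⟨⟨X, rfl⟩, h2⟩
    exact ⟨X, (key X).2 h2, rfl⟩

theorem iwahori_le_maxCompact {ϖ : O} : iwahori n F ϖ ≤ maxCompact n O F := by
  rintro _ ⟨X, -, rfl⟩
  exact ⟨X, rfl⟩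

/-- Bounding the entries of both `g` and `g⁻¹` replaces any condition on the determinant.
Conjugation by a monomial matrix permutes and shifts the levels, so later inclusions between
conjugates of `I` become inequalities of integers. -/
theorem mem_iwahori_iff [FaithfulSMul O F] {ϖ : O} (ht : (t : F) = algebraMap O F ϖ)
    {g : GL (Fin n) F} : g ∈ iwahori n F ϖ ↔
      (∀ i j, g i j ∈ fil O t (iwLevel i j)) ∧ ∀ i j, g⁻¹ i j ∈ fil O t (iwLevel i j) := by
  have key : ∀ h : GL (Fin n) F, (∀ i j, h i j ∈ fil O t (iwLevel i j)) ↔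
      (∀ i j, h i j ∈ fil O t 0) ∧ ∀ i j, j < i → h i j ∈ fil O t 1 := fun h => by
    constructor
    · intro H
      refine ⟨fun i j => mem_fil_of_le ht (iwLevel_nonneg i j) (H i j), fun i j hij => ?_⟩
      simpa [iwLevel, hij] using H i j
    · rintro ⟨H1, H2⟩ i j
      unfold iwLevel
      split_ifs with hij
      exacts [H2 i j hij, H1 i j]
  rw [key, key]
  constructor
  · intro h
    have h1 := (mem_iwahori_iff_lower ht).1 h
    have h2 := (mem_iwahori_iff_lower ht).1 (inv_mem h)
    exact ⟨⟨((mem_maxCompact_iff (t := t)).1 h1.1).1, h1.2⟩,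
      ((mem_maxCompact_iff (t := t)).1 h2.1).1, h2.2⟩
  · rintro ⟨⟨h1, h2⟩, h3, h4⟩
    exact (mem_iwahori_iff_lower ht).2 ⟨(mem_maxCompact_iff (t := t)).2 ⟨h1, h3⟩, h2⟩

/-! ### Monomial matrices -/

/-- The monomial matrix sending the `j`-th basis vector to `t^{ν_j}` times the `π j`-th one. -/
def monomialGL (t : Fˣ) (π : Equiv.Perm (Fin n)) (ν : Fin n → ℤ) : GL (Fin n) F where
  val := Matrix.of fun i j => if i = π j then ((t ^ ν j : Fˣ) : F) else 0
  inv := Matrix.of fun i j => if j = π i then ((t ^ (-ν i) : Fˣ) : F) else 0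
  val_inv := by
    ext i j
    rw [Matrix.mul_apply, Finset.sum_eq_single (π.symm i)]
    · simp only [Matrix.of_apply, Equiv.apply_symm_apply, if_true, mul_ite, mul_zero,
        ← Units.val_mul, ← _root_.zpow_add, add_neg_cancel, zpow_zero, Units.val_one,
        Matrix.one_apply, eq_comm]
    · intro l _ hl
      rw [Matrix.of_apply, if_neg, zero_mul]
      rintro rfl
      simp at hl
    · simp
  inv_val := by
    ext i j
    rw [Matrix.mul_apply, Finset.sum_eq_single (π i)]
    · simp only [Matrix.of_apply, if_true, mul_ite, mul_zero, EmbeddingLike.apply_eq_iff_eq,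
        Matrix.one_apply]
      split_ifs with h
      · rw [h, ← Units.val_mul, ← _root_.zpow_add, neg_add_cancel, zpow_zero, Units.val_one]
      · rfl
    · intro l _ hl
      rw [Matrix.of_apply, if_neg hl, zero_mul]
    · simp

theorem monomialGL_apply (π : Equiv.Perm (Fin n)) (ν : Fin n → ℤ) (i j : Fin n) :
    monomialGL t π ν i j = if i = π j then ((t ^ ν j : Fˣ) : F) else 0 := rfl

theorem monomialGL_inv_apply (π : Equiv.Perm (Fin n)) (ν : Fin n → ℤ) (i j : Fin n) :
    (monomialGL t π ν)⁻¹ i j = if j = π i then ((t ^ (-ν i) : Fˣ) : F) else 0 := rfl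

theorem mul_monomialGL_apply (g : GL (Fin n) F) (π : Equiv.Perm (Fin n)) (ν : Fin n → ℤ)
    (i j : Fin n) : (g * monomialGL t π ν) i j = g i (π j) * ((t ^ ν j : Fˣ) : F) := by
  rw [GL_mul_apply, Finset.sum_eq_single (π j)]
  · rw [monomialGL_apply, if_pos rfl]
  · intro l _ hl
    rw [monomialGL_apply, if_neg hl, mul_zero]
  · simp

theorem monomialGL_inv_mul_apply (g : GL (Fin n) F) (π : Equiv.Perm (Fin n)) (ν : Fin n → ℤ)
    (i j : Fin n) : ((monomialGL t π ν)⁻¹ * g) i j = ((t ^ (-ν i) : Fˣ) : F) * g (π i) j := by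
  rw [GL_mul_apply, Finset.sum_eq_single (π i)]
  · rw [monomialGL_inv_apply, if_pos rfl]
  · intro l _ hl
    rw [monomialGL_inv_apply, if_neg hl, zero_mul]
  · simp

theorem conj_monomialGL_apply (g : GL (Fin n) F) (π : Equiv.Perm (Fin n)) (ν : Fin n → ℤ)
    (i j : Fin n) : ((monomialGL t π ν)⁻¹ * g * monomialGL t π ν) i j =
      ((t ^ (ν j - ν i) : Fˣ) : F) * g (π i) (π j) := by
  rw [mul_monomialGL_apply, monomialGL_inv_mul_apply, sub_eq_neg_add, _root_.zpow_add, Units.val_mul]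
  ring

theorem monomialGL_mul (π σ : Equiv.Perm (Fin n)) (ν μ : Fin n → ℤ) :
    monomialGL t π ν * monomialGL t σ μ = monomialGL t (π * σ) fun j => ν (σ j) + μ j := by
  ext i j
  rw [mul_monomialGL_apply, monomialGL_apply, monomialGL_apply, Equiv.Perm.mul_apply]
  split_ifs
  · rw [_root_.zpow_add, Units.val_mul]
  · rw [zero_mul]

theorem diagPow_eq_monomialGL (μ : Fin n → ℤ) : diagPow t μ = monomialGL t 1 μ := by
  ext i j
  change Matrix.diagonal _ i j = _
  rw [monomialGL_apply, Matrix.diagonal_apply, Equiv.Perm.one_apply]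
  split_ifs with h
  · rw [h]
  · rfl

theorem diagPow_add (μ ν : Fin n → ℤ) : diagPow t (μ + ν) = diagPow t μ * diagPow t ν := by
  rw [diagPow_eq_monomialGL, diagPow_eq_monomialGL, diagPow_eq_monomialGL, monomialGL_mul]
  rfl

theorem diagPow_zero : diagPow t (0 : Fin n → ℤ) = 1 := by
  have h := diagPow_add (t := t) (0 : Fin n → ℤ) 0
  rwa [add_zero, left_eq_mul] at h

theorem diagPow_neg (μ : Fin n → ℤ) : diagPow t (-μ) = (diagPow t μ)⁻¹ := by
  rw [eq_inv_iff_mul_eq_one, ← diagPow_add, neg_add_cancel, diagPow_zero]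

theorem conj_mem_iwahori_iff [FaithfulSMul O F] {ϖ : O} (ht : (t : F) = algebraMap O F ϖ)
    {g : GL (Fin n) F} (π : Equiv.Perm (Fin n)) (ν : Fin n → ℤ) :
    (monomialGL t π ν)⁻¹ * g * monomialGL t π ν ∈ iwahori n F ϖ ↔
      (∀ i j, g (π i) (π j) ∈ fil O t (iwLevel i j + ν i - ν j)) ∧
        ∀ i j, g⁻¹ (π i) (π j) ∈ fil O t (iwLevel i j + ν i - ν j) := by
  have key : ∀ (h : GL (Fin n) F) i j, ((t ^ (ν j - ν i) : Fˣ) : F) * h (π i) (π j) ∈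
      fil O t (iwLevel i j) ↔ h (π i) (π j) ∈ fil O t (iwLevel i j + ν i - ν j) := fun h i j => by
    rw [← zpow_mul_mem_fil (O := O) (a := iwLevel i j + ν i - ν j) (m := ν j - ν i)]
    congr! 2
    ring
  rw [mem_iwahori_iff ht, show ((monomialGL t π ν)⁻¹ * g * monomialGL t π ν)⁻¹ =
    (monomialGL t π ν)⁻¹ * g⁻¹ * monomialGL t π ν by group]
  simp only [conj_monomialGL_apply, key]

theorem conj_inv_mem_iwahori_iff [FaithfulSMul O F] {ϖ : O} (ht : (t : F) = algebraMap O F ϖ)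
    {g : GL (Fin n) F} (π : Equiv.Perm (Fin n)) (ν : Fin n → ℤ) :
    monomialGL t π ν * g * (monomialGL t π ν)⁻¹ ∈ iwahori n F ϖ ↔
      (∀ i j, g i j ∈ fil O t (iwLevel (π i) (π j) - ν i + ν j)) ∧
        ∀ i j, g⁻¹ i j ∈ fil O t (iwLevel (π i) (π j) - ν i + ν j) := by
  have e : monomialGL t π ν = (monomialGL t π⁻¹ fun i => -ν (π⁻¹ i))⁻¹ := by
    rw [eq_inv_iff_mul_eq_one, monomialGL_mul, ← diagPow_zero (t := t), diagPow_eq_monomialGL]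
    congr 1
    · simp
    · ext i; simp
  rw [e, inv_inv, conj_mem_iwahori_iff ht]
  constructor
  · rintro ⟨h1, h2⟩
    exact ⟨fun i j => by simpa [← sub_eq_add_neg] using h1 (π i) (π j),
      fun i j => by simpa [← sub_eq_add_neg] using h2 (π i) (π j)⟩
  · rintro ⟨h1, h2⟩
    exact ⟨fun i j => by simpa [← sub_eq_add_neg] using h1 (π⁻¹ i) (π⁻¹ j),
      fun i j => by simpa [← sub_eq_add_neg] using h2 (π⁻¹ i) (π⁻¹ j)⟩

end Groups

end

section

open Matrix

/-! ### Elementary matrices and subgroups given by levels. -/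

section Elementary

variable {n : ℕ} {F : Type*} [Field F]

/-- The matrix `1 + ∑_{i ≠ m} c_i E_{im}`. -/
def colGL (m : Fin n) (c : Fin n → F) : GL (Fin n) F where
  val := Matrix.of fun i j => (if i = j then 1 else 0) + if j = m ∧ i ≠ m then c i else 0
  inv := Matrix.of fun i j => (if i = j then 1 else 0) + if j = m ∧ i ≠ m then -c i else 0
  val_inv := by
    ext i j
    rw [Matrix.mul_apply]
    simp only [Matrix.of_apply, add_mul, ite_mul, one_mul, zero_mul, Finset.sum_add_distrib,
      Finset.sum_ite_eq, Finset.mem_univ, if_true]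
    rw [Finset.sum_eq_single m (by intro l _ hl; simp [hl]) (by simp), Matrix.one_apply]
    by_cases h1 : j = m <;> by_cases h2 : i = m <;> simp [h1, h2, eq_comm (a := m)]
  inv_val := by
    ext i j
    rw [Matrix.mul_apply]
    simp only [Matrix.of_apply, add_mul, ite_mul, one_mul, zero_mul, Finset.sum_add_distrib,
      Finset.sum_ite_eq, Finset.mem_univ, if_true]
    rw [Finset.sum_eq_single m (by intro l _ hl; simp [hl]) (by simp), Matrix.one_apply]
    by_cases h1 : j = m <;> by_cases h2 : i = m <;> simp [h1, h2, eq_comm (a := m)]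

theorem colGL_apply (m : Fin n) (c : Fin n → F) (i j : Fin n) :
    colGL m c i j = (if i = j then 1 else 0) + if j = m ∧ i ≠ m then c i else 0 := rfl

theorem colGL_inv (m : Fin n) (c : Fin n → F) : (colGL m c)⁻¹ = colGL m (-c) := by
  ext i j
  rfl

theorem colGL_mul_apply (m : Fin n) (c : Fin n → F) (g : GL (Fin n) F) (i j : Fin n) :
    (colGL m c * g) i j = g i j + if i = m then 0 else c i * g m j := by
  rw [GL_mul_apply]
  simp only [colGL_apply, add_mul, ite_mul, one_mul, zero_mul, Finset.sum_add_distrib,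
      Finset.sum_ite_eq, Finset.mem_univ, if_true]
  rw [Finset.sum_eq_single m (by intro l _ hl; simp [hl]) (by simp)]
  by_cases h2 : i = m <;> simp [h2]

theorem mul_colGL_apply (m : Fin n) (c : Fin n → F) (hc : c m = 0) (g : GL (Fin n) F)
    (i j : Fin n) :
    (g * colGL m c) i j = g i j + if j = m then ∑ l, g i l * c l else 0 := by
  rw [GL_mul_apply]
  simp only [colGL_apply, mul_add, mul_ite, mul_one, mul_zero, Finset.sum_add_distrib,
      Finset.sum_ite_eq', Finset.mem_univ, if_true]
  by_cases h : j = m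
  · simp only [h, true_and, if_true]
    congr 1
    refine Finset.sum_congr rfl fun l _ => ?_
    split_ifs with h2
    · rfl
    · rw [not_not.1 h2, hc, mul_zero]
  · simp [h]

/-- The matrix `1 + ∑_{j ≠ m} c_j E_{mj}`. -/
def rowGL (m : Fin n) (c : Fin n → F) : GL (Fin n) F where
  val := (colGL m c).1ᵀ
  inv := (colGL m c).2ᵀ
  val_inv := by rw [← Matrix.transpose_mul, (colGL m c).inv_val, Matrix.transpose_one]
  inv_val := by rw [← Matrix.transpose_mul, (colGL m c).val_inv, Matrix.transpose_one]

theorem rowGL_apply (m : Fin n) (c : Fin n → F) (i j : Fin n) :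
    rowGL m c i j = colGL m c j i := rfl

theorem rowGL_inv (m : Fin n) (c : Fin n → F) : (rowGL m c)⁻¹ = rowGL m (-c) := by
  ext i j
  rfl

theorem mul_rowGL_apply (m : Fin n) (c : Fin n → F) (g : GL (Fin n) F) (i j : Fin n) :
    (g * rowGL m c) i j = g i j + if j = m then 0 else g i m * c j := by
  rw [GL_mul_apply]
  simp only [rowGL_apply, colGL_apply, mul_add, mul_ite, mul_one, mul_zero,
    Finset.sum_add_distrib, Finset.sum_ite_eq, Finset.mem_univ, if_true]
  rw [Finset.sum_eq_single m (by intro l _ hl; simp [hl]) (by simp)]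
  by_cases h2 : j = m <;> simp [h2]

end Elementary

section Level

variable {n : ℕ} {O F : Type*} [CommRing O] [Field F] [Algebra O F] {t : Fˣ} {ϖ : O}

variable (O) in
/-- The matrices `g` such that the `(i, j)` entries of `g` and `g⁻¹` lie in `t^{f(i, j)} O`. -/
def levelSubgroup (ht : (t : F) = algebraMap O F ϖ) (f : Fin n → Fin n → ℤ)
    (hf : ∀ i j l, f i j ≤ f i l + f l j) (hf0 : ∀ i j, f i j ≤ 0 ∨ i ≠ j) :
    Subgroup (GL (Fin n) F) where
  carrier := {g | (∀ i j, g i j ∈ fil O t (f i j)) ∧ ∀ i j, g⁻¹ i j ∈ fil O t (f i j)}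
  mul_mem' := by
    rintro a b ⟨ha, ha'⟩ ⟨hb, hb'⟩
    refine ⟨fun i j => ?_, fun i j => ?_⟩
    · rw [GL_mul_apply]
      exact sum_mul_mem_fil ht (ha i) (fun l => hb l j) fun l => hf i j l
    · rw [_root_.mul_inv_rev, GL_mul_apply]
      exact sum_mul_mem_fil ht (hb' i) (fun l => ha' l j) fun l => hf i j l
  one_mem' := by
    have : ∀ i j, (1 : GL (Fin n) F) i j ∈ fil O t (f i j) := fun i j => by
      rw [Units.val_one, Matrix.one_apply]
      split_ifs with h
      · exact mem_fil_of_le ht ((hf0 i j).resolve_right (not_not.2 h)) one_mem_fil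
      · exact zero_mem _
    exact ⟨this, by rwa [inv_one]⟩
  inv_mem' := by
    rintro a ⟨ha, ha'⟩
    exact ⟨ha', by rwa [inv_inv]⟩

theorem iwLevel_of_lt {i j : Fin n} (h : i < j) : iwLevel i j = 0 := if_neg (by omega)

theorem iwLevel_of_gt {i j : Fin n} (h : j < i) : iwLevel i j = 1 := if_pos h

theorem iwLevel_self (i : Fin n) : iwLevel i i = 0 := if_neg (by omega)

theorem iwLevel_add_symm {i j : Fin n} (h : i ≠ j) : iwLevel i j + iwLevel j i = 1 := by
  unfold iwLevel
  split_ifs <;> omega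

theorem colGL_mem_fil (ht : (t : F) = algebraMap O F ϖ) (m : Fin n) {c : Fin n → F}
    {f : Fin n → Fin n → ℤ} (h0 : ∀ i, f i i ≤ 0) (hc : ∀ i, i ≠ m → c i ∈ fil O t (f i m))
    (i j : Fin n) : colGL m c i j ∈ fil O t (f i j) := by
  rw [colGL_apply]
  refine add_mem ?_ ?_
  · split_ifs with h
    · subst h
      exact mem_fil_of_le ht (h0 i) one_mem_fil
    · exact zero_mem _
  · split_ifs with h
    · rw [h.1]
      exact hc i h.2
    · exact zero_mem _

variable [FaithfulSMul O F]

theorem colGL_mem_maxCompact (ht : (t : F) = algebraMap O F ϖ) (m : Fin n) {c : Fin n → F}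
    (hc : ∀ i, c i ∈ fil O t 0) : colGL m c ∈ maxCompact n O F := by
  rw [mem_maxCompact_iff (t := t), colGL_inv]
  exact ⟨colGL_mem_fil ht (f := fun _ _ => 0) m (fun _ => le_rfl) fun i _ => hc i,
    colGL_mem_fil ht (f := fun _ _ => 0) m (fun _ => le_rfl) fun i _ => neg_mem (hc i)⟩

theorem perm_mem_maxCompact (π : Equiv.Perm (Fin n)) : monomialGL t π 0 ∈ maxCompact n O F := by
  rw [mem_maxCompact_iff (t := t)]
  constructor
  · intro i j
    rw [monomialGL_apply]
    split_ifs
    · simpa using one_mem_fil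
    · exact zero_mem _
  · intro i j
    rw [monomialGL_inv_apply]
    split_ifs
    · simpa using one_mem_fil
    · exact zero_mem _

theorem colGL_mem_iwahori (ht : (t : F) = algebraMap O F ϖ) (m : Fin n) {c : Fin n → F}
    (hc : ∀ i, i ≠ m → c i ∈ fil O t (iwLevel i m)) : colGL m c ∈ iwahori n F ϖ := by
  rw [mem_iwahori_iff ht, colGL_inv]
  exact ⟨colGL_mem_fil ht m (fun i => (iwLevel_self i).le) hc,
    colGL_mem_fil ht m (fun i => (iwLevel_self i).le) fun i hi => neg_mem (hc i hi)⟩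

variable [IsDomain O] [IsDiscreteValuationRing O] [IsFractionRing O F]

/-- In the `(i, i)` entry of `g g⁻¹`, every term other than the diagonal one has exactly one factor
from below the diagonal, hence lies in `tO`. So `g i i` is a unit modulo `t`. -/
theorem iwahori_diag_unit (hϖ : Irreducible ϖ) (ht : (t : F) = algebraMap O F ϖ)
    {g : GL (Fin n) F} (hg : g ∈ iwahori n F ϖ) (i : Fin n) :
    g i i ∈ fil O t 0 ∧ g i i ∉ fil O t 1 ∧ g i i ≠ 0 ∧ (g i i)⁻¹ ∈ fil O t 0 := by
  obtain ⟨h1, h2⟩ := (mem_iwahori_iff ht).1 hg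
  have h0 : g i i ∈ fil O t 0 := iwLevel_self i ▸ h1 i i
  have h3 : g i i ∉ fil O t 1 := by
    refine notMem_fil_one_of_mul hϖ ht (y := g⁻¹ i i) (iwLevel_self i ▸ h2 i i) ?_
    have e : (g * g⁻¹) i i = 1 := by
      rw [mul_inv_cancel, Units.val_one, Matrix.one_apply_eq]
    rw [GL_mul_apply, ← Finset.add_sum_erase _ _ (Finset.mem_univ i)] at e
    rw [← e, sub_add_cancel_left]
    refine neg_mem (sum_mem fun l hl => ?_)
    have := mul_mem_fil (h1 i l) (h2 l i)
    rwa [iwLevel_add_symm (Finset.ne_of_mem_erase hl).symm] at this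
  exact ⟨h0, h3, inv_mem_fil_zero hϖ ht h0 h3⟩

/-! ### Unipotent matrices and the Iwahori decomposition -/

end Level

section Unipotent

variable (n : ℕ) (F : Type*) [Field F]

/-- The group of unipotent upper triangular matrices. -/
def unipotent : Subgroup (GL (Fin n) F) where
  carrier := unipotentUpper n F
  mul_mem' := by
    rintro a b ⟨ha, ha1⟩ ⟨hb, hb1⟩
    refine ⟨mul_mem ha hb, fun i => ?_⟩
    change (a * b) i i = 1
    rw [GL_mul_apply, Finset.sum_eq_single i]
    · rw [ha1, hb1, one_mul]
    · intro l _ hl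
      rcases lt_or_gt_of_ne hl with h | h
      · rw [mem_borel_iff.1 ha i l h, zero_mul]
      · rw [mem_borel_iff.1 hb l i h, mul_zero]
    · simp
  one_mem' := ⟨one_mem _, fun i => by simp⟩
  inv_mem' := by
    rintro a ⟨ha, ha1⟩
    refine ⟨inv_mem ha, fun i => ?_⟩
    have e : (a * a⁻¹) i i = 1 := by
      rw [mul_inv_cancel, Units.val_one, Matrix.one_apply_eq]
    rw [GL_mul_apply, Finset.sum_eq_single i, ha1, one_mul] at e
    · exact e
    · intro l _ hl
      rcases lt_or_gt_of_ne hl with h | h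
      · rw [mem_borel_iff.1 ha i l h, zero_mul]
      · rw [mem_borel_iff.1 (inv_mem ha) l i h, mul_zero]
    · simp

variable {n F}

theorem mem_unipotent_iff {g : GL (Fin n) F} :
    g ∈ unipotent n F ↔ (∀ i j, j < i → g i j = 0) ∧ ∀ i, g i i = 1 := Iff.rfl

theorem colGL_mem_unipotent (m : Fin n) {c : Fin n → F} (hc : ∀ i, m < i → c i = 0) :
    colGL m c ∈ unipotent n F := by
  refine mem_unipotent_iff.2 ⟨fun i j hij => ?_, fun i => ?_⟩
  · rw [colGL_apply, if_neg (by omega), zero_add]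
    split_ifs with h
    · exact hc i (h.1 ▸ hij)
    · rfl
  · rw [colGL_apply, if_pos rfl, if_neg (by tauto), add_zero]

variable {O : Type*} [CommRing O] [Algebra O F] [FaithfulSMul O F] {t : Fˣ} {ϖ : O}

theorem mem_iwahori_of_unipotent (ht : (t : F) = algebraMap O F ϖ) {u : GL (Fin n) F}
    (hu : u ∈ unipotent n F) (hK : u ∈ maxCompact n O F) : u ∈ iwahori n F ϖ :=
  (mem_iwahori_iff_lower ht).2 ⟨hK, fun _ _ hij => hu.1 hij ▸ zero_mem _⟩

variable [IsDomain O] [IsDiscreteValuationRing O] [IsFractionRing O F]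

/-- The Iwahori decomposition. -/
theorem iwahori_factorization (hϖ : Irreducible ϖ) (ht : (t : F) = algebraMap O F ϖ)
    {x : GL (Fin n) F} (hx : x ∈ iwahori n F ϖ) :
    ∃ u ∈ unipotent n F ⊓ maxCompact n O F, ∃ b ∈ iwahori n F ϖ,
      (∀ i j, i < j → b i j = 0) ∧ x = u * b := by
  -- The entries above the diagonal are cleared column by column from the right, `m` being the
  -- number of columns already done. The next column is cleared with its diagonal unit as pivot. The
  -- finished columns survive because the pivot row is zero there.
  have key : ∀ m ≤ n, ∃ u ∈ unipotent n F ⊓ maxCompact n O F,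
      ∀ i j : Fin n, i < j → n - m ≤ j → (u * x) i j = 0 := by
    intro m
    induction m with
    | zero => exact fun _ => ⟨1, one_mem _, fun _ j _ hj => by omega⟩
    | succ m ih =>
      intro hm
      obtain ⟨u, hu, h0⟩ := ih (by omega)
      have hux : u * x ∈ iwahori n F ϖ := mul_mem (mem_iwahori_of_unipotent ht hu.1 hu.2) hx
      let c : Fin n := ⟨n - (m + 1), by omega⟩
      have hc : (c : ℕ) = n - (m + 1) := rfl
      generalize hy : u * x = y at *
      obtain ⟨-, -, hd, hd'⟩ := iwahori_diag_unit hϖ ht hux c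
      let v : Fin n → F := fun i => if i < c then -(y i c * (y c c)⁻¹) else 0
      have hv : ∀ i, v i ∈ fil O t 0 := fun i => by
        simp only [v]
        split_ifs with h
        · have := mul_mem_fil (((mem_iwahori_iff ht).1 hux).1 i c) hd'
          rw [iwLevel_of_lt h, add_zero] at this
          exact neg_mem this
        · exact zero_mem _
      refine ⟨colGL c v * u, mul_mem ⟨colGL_mem_unipotent c fun i hi => ?_,
        colGL_mem_maxCompact ht c hv⟩ hu, fun i j hij hj => ?_⟩
      · simp only [v]
        rw [if_neg (by omega)]
      · rw [mul_assoc, hy, colGL_mul_apply]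
        by_cases hjc : j = c
        · subst hjc
          rw [if_neg hij.ne]
          simp only [v]
          rw [if_pos hij]
          field_simp
          ring
        · have hj' : n - m ≤ (j : ℕ) := by
            have : (j : ℕ) ≠ c := fun h => hjc (Fin.ext h)
            omega
          rw [h0 i j hij hj', zero_add]
          split_ifs with hic
          · rfl
          · rw [h0 c j (by omega) hj', mul_zero]
  obtain ⟨u, hu, h0⟩ := key n le_rfl
  exact ⟨u⁻¹, inv_mem hu, u * x, mul_mem (mem_iwahori_of_unipotent ht hu.1 hu.2) hx,
    fun _ _ hij => h0 _ _ hij (by omega), by rw [inv_mul_cancel_left]⟩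

end Unipotent

end

section

open Matrix

/-! ### Finiteness of coset spaces, by reduction modulo a power of the uniformizer. -/

section Finiteness

variable {n : ℕ} {O F : Type*} [CommRing O] [Field F] [Algebra O F] {t : Fˣ} {ϖ : O}
  [IsDomain O] [IsDiscreteValuationRing O] [IsFractionRing O F]

theorem finite_image_of_factors {α β γ : Type*} [Finite γ] (s : Set α) (f : α → β) (r : α → γ)
    (h : ∀ a ∈ s, ∀ b ∈ s, r a = r b → f a = f b) : (f '' s).Finite := by
  have : (r '' s).Finite := Set.toFinite _
  rcases isEmpty_or_nonempty α with hα | hα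
  · exact (Set.toFinite s).image f
  choose! l hl using fun (c : γ) (hc : c ∈ r '' s) => hc
  refine (this.image fun c => f (l c)).subset ?_
  rintro _ ⟨a, ha, rfl⟩
  have := hl (r a) ⟨a, ha, rfl⟩
  exact ⟨r a, ⟨a, ha, rfl⟩, h _ this.1 _ ha this.2⟩

theorem card_quotient_pow (hϖ : Irreducible ϖ) (m : ℕ) :
    Nat.card (O ⧸ Ideal.span {ϖ ^ m}) = Nat.card (O ⧸ Ideal.span {ϖ}) ^ m := by
  have hm := (IsDiscreteValuationRing.irreducible_iff_uniformizer ϖ).1 hϖ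
  have hp : (Ideal.span {ϖ}).IsPrime := hm ▸ inferInstance
  have hb : Ideal.span {ϖ} ≠ ⊥ := by
    rw [Ne, Ideal.span_singleton_eq_bot]
    exact hϖ.ne_zero
  have := cardQuot_pow_of_prime hb (i := m)
  rw [Ideal.span_singleton_pow] at this
  exact this

theorem finite_quotient_pow [Finite (O ⧸ Ideal.span {ϖ})] (hϖ : Irreducible ϖ) (m : ℕ) :
    Finite (O ⧸ Ideal.span {ϖ ^ m}) := by
  apply Nat.finite_of_card_ne_zero
  rw [card_quotient_pow hϖ]
  exact pow_ne_zero _ Nat.card_pos.ne'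

theorem sub_mem_fil_iff (ht : (t : F) = algebraMap O F ϖ) {m : ℕ} {a b : O} :
    algebraMap O F a - algebraMap O F b ∈ fil O t m ↔
      (Ideal.Quotient.mk (Ideal.span {ϖ ^ m}) a) = Ideal.Quotient.mk _ b := by
  rw [← map_sub, mem_fil_natCast ht, Ideal.Quotient.eq, Ideal.mem_span_singleton]
  constructor
  · rintro ⟨c, hc⟩
    exact ⟨c, (IsFractionRing.injective O F hc).symm⟩
  · rintro ⟨c, hc⟩
    exact ⟨c, by rw [hc]⟩

/-- Congruent elements of `K` have the same image in `G/H` if `H` is deep enough. -/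
theorem finite_image_maxCompact [Finite (O ⧸ Ideal.span {ϖ})] (hϖ : Irreducible ϖ)
    (ht : (t : F) = algebraMap O F ϖ) {β : Type*} (f : GL (Fin n) F → β) (m : ℕ)
    (h : ∀ a ∈ maxCompact n O F, ∀ b ∈ maxCompact n O F, (∀ i j, a i j - b i j ∈ fil O t m) →
      f a = f b) : (f '' (maxCompact n O F : Set (GL (Fin n) F))).Finite := by
  have := finite_quotient_pow (O := O) hϖ m
  have hex : ∀ a : GL (Fin n) F, ∃ X : Matrix (Fin n) (Fin n) O, a ∈ maxCompact n O F →
      ∀ i j, algebraMap O F (X i j) = a i j := fun a => by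
    by_cases ha : a ∈ maxCompact n O F
    · obtain ⟨X, rfl⟩ := ha
      exact ⟨X, fun _ _ _ => rfl⟩
    · exact ⟨0, fun h => absurd h ha⟩
  choose X hX using hex
  refine finite_image_of_factors (γ := Matrix (Fin n) (Fin n) (O ⧸ Ideal.span {ϖ ^ m})) _ f
    (fun a => (X a).map (Ideal.Quotient.mk _)) fun a ha b hb hab => h a ha b hb fun i j => ?_
  rw [← hX a ha, ← hX b hb, sub_mem_fil_iff ht]
  exact congrFun (congrFun hab i) j

theorem inv_mul_sub_one_mem_fil (ht : (t : F) = algebraMap O F ϖ) {m : ℤ} {a b : GL (Fin n) F}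
    (ha : a ∈ maxCompact n O F) (hab : ∀ i j, a i j - b i j ∈ fil O t m) (i j : Fin n) :
    (a⁻¹ * b) i j - (1 : Matrix (Fin n) (Fin n) F) i j ∈ fil O t m := by
  have e : (a⁻¹ * b) i j - (1 : Matrix (Fin n) (Fin n) F) i j =
      ∑ l, a⁻¹ i l * -(a l j - b l j) := by
    have : (1 : Matrix (Fin n) (Fin n) F) i j = (a⁻¹ * a) i j := by
      rw [inv_mul_cancel, Units.val_one]
    rw [this, GL_mul_apply, GL_mul_apply, ← Finset.sum_sub_distrib]
    refine Finset.sum_congr rfl fun l _ => ?_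
    ring
  rw [e]
  refine sum_mul_mem_fil ht (a := fun _ => 0) (b := fun _ => m)
    (fun l => ((mem_maxCompact_iff (t := t)).1 ha).2 i l) (fun l => neg_mem (hab l j)) (by simp)

/-- If `m` bounds all the shifts `1 + ν i - ν j`, then elements of `K` congruent modulo `t^m` send
the monomial coset to the same coset. Only finitely many residue matrices modulo `t^m` exist. -/
theorem finite_orbit_monomialGL [Finite (O ⧸ Ideal.span {ϖ})] (hϖ : Irreducible ϖ)
    (ht : (t : F) = algebraMap O F ϖ) (π : Equiv.Perm (Fin n)) (ν : Fin n → ℤ) :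
    (MulAction.orbit (iwahori n F ϖ) ((monomialGL t π ν : GL (Fin n) F) :
      GL (Fin n) F ⧸ iwahori n F ϖ)).Finite := by
  obtain ⟨m, hm⟩ : ∃ m : ℕ, ∀ i j, 1 + ν i - ν j ≤ m := by
    refine ⟨∑ i, ∑ j, (1 + ν i - ν j).toNat, fun i j => ?_⟩
    refine (Int.self_le_toNat _).trans ?_
    exact_mod_cast (Finset.single_le_sum (f := fun j => (1 + ν i - ν j).toNat)
      (fun _ _ => Nat.zero_le _) (Finset.mem_univ j)).trans
      (Finset.single_le_sum (f := fun i => ∑ j, (1 + ν i - ν j).toNat)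
      (fun _ _ => Nat.zero_le _) (Finset.mem_univ i))
  refine (finite_image_maxCompact hϖ ht (fun a => ((a * monomialGL t π ν : GL (Fin n) F) :
    GL (Fin n) F ⧸ iwahori n F ϖ)) m fun a ha b hb hab => ?_).subset ?_
  · rw [QuotientGroup.eq, _root_.mul_inv_rev, mul_assoc, ← mul_assoc a⁻¹, ← mul_assoc,
      conj_mem_iwahori_iff ht]
    have key : ∀ c : GL (Fin n) F, (∀ i j, c i j - (1 : Matrix (Fin n) (Fin n) F) i j ∈ fil O t m) →
        ∀ i j, c (π i) (π j) ∈ fil O t (iwLevel i j + ν i - ν j) := fun c hc i j => by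
      have h1 := mem_fil_of_le ht (a := iwLevel i j + ν i - ν j)
        ((by linarith [iwLevel_le_one i j] : _ ≤ 1 + ν i - ν j).trans (hm i j)) (hc (π i) (π j))
      rw [← sub_add_cancel (c (π i) (π j)) ((1 : Matrix (Fin n) (Fin n) F) (π i) (π j))]
      refine add_mem h1 ?_
      rw [Matrix.one_apply]
      split_ifs with h
      · rw [EmbeddingLike.apply_eq_iff_eq] at h
        subst h
        rw [iwLevel_self]
        simpa using one_mem_fil
      · exact zero_mem _
    refine ⟨key _ (inv_mul_sub_one_mem_fil ht ha hab), ?_⟩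
    rw [_root_.mul_inv_rev, inv_inv]
    exact key _ (inv_mul_sub_one_mem_fil ht hb fun i j => by
      rw [← neg_sub]; exact neg_mem (hab i j))
  · rintro _ ⟨i, rfl⟩
    exact ⟨i, iwahori_le_maxCompact i.2, rfl⟩

theorem finite_image_maxCompact_iwahori [Finite (O ⧸ Ideal.span {ϖ})] (hϖ : Irreducible ϖ)
    (ht : (t : F) = algebraMap O F ϖ) :
    ((QuotientGroup.mk : GL (Fin n) F → GL (Fin n) F ⧸ iwahori n F ϖ) ''
      (maxCompact n O F : Set (GL (Fin n) F))).Finite := by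
  refine finite_image_maxCompact hϖ ht _ 1 fun a ha b hb hab => ?_
  rw [QuotientGroup.eq, mem_iwahori_iff_lower ht]
  refine ⟨mul_mem (inv_mem ha) hb, fun i j hij => ?_⟩
  have := inv_mul_sub_one_mem_fil ht ha hab i j
  rwa [Matrix.one_apply_ne hij.ne', sub_zero] at this

end Finiteness

/-! ### Products of double cosets whose lengths add. -/

section Product

variable (k : Type*) [CommRing k]
variable {n : ℕ} {O F : Type*} [CommRing O] [Field F] [Algebra O F] {t : Fˣ} {ϖ : O}
  [IsDomain O] [IsDiscreteValuationRing O] [IsFractionRing O F] [Finite (O ⧸ Ideal.span {ϖ})]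

theorem perm_apply_inv {α : Type*} (σ : Equiv.Perm α) (i : α) : σ (σ⁻¹ i) = i :=
  σ.apply_symm_apply i

/-- `[I t^ν π I]` in the Iwahori-Hecke algebra. -/
abbrev heckeMonomial (ϖ : O) (t : Fˣ) (π : Equiv.Perm (Fin n)) (ν : Fin n → ℤ) :
    IwahoriHecke k n F ϖ :=
  HeckeAlgebra.doubleCoset k (iwahori n F ϖ) (monomialGL t π ν)

theorem heckeMonomial_one :
    heckeMonomial k ϖ t (1 : Equiv.Perm (Fin n)) 0 = 1 := by
  rw [heckeMonomial, ← diagPow_eq_monomialGL, diagPow_zero, HeckeAlgebra.doubleCoset_one]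

/-- Multiplicativity from a factorization of `I` and a convexity property. -/
theorem heckeMonomial_mul (hϖ : Irreducible ϖ) (ht : (t : F) = algebraMap O F ϖ)
    (π σ : Equiv.Perm (Fin n)) (ν μ : Fin n → ℤ)
    (hfac : ∀ x ∈ iwahori n F ϖ, ∃ y ∈ iwahori n F ϖ, ∃ z ∈ iwahori n F ϖ, x = y * z ∧
      monomialGL t π ν * y * (monomialGL t π ν)⁻¹ ∈ iwahori n F ϖ ∧
      (monomialGL t σ μ)⁻¹ * z * monomialGL t σ μ ∈ iwahori n F ϖ)
    (hconv : ∀ i j, iwLevel i j + ν i - ν j ≤ iwLevel (π i) (π j) ∨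
      iwLevel i j ≤ iwLevel (σ⁻¹ i) (σ⁻¹ j) + μ (σ⁻¹ i) - μ (σ⁻¹ j)) :
    heckeMonomial k ϖ t π ν * heckeMonomial k ϖ t σ μ =
      heckeMonomial k ϖ t (π * σ) fun j => ν (σ j) + μ j := by
  unfold heckeMonomial
  rw [← monomialGL_mul]
  refine HeckeAlgebra.doubleCoset_mul (finite_orbit_monomialGL hϖ ht _ _)
    (finite_orbit_monomialGL hϖ ht _ _) ?_ hfac fun x hx hx2 => ?_
  · rw [monomialGL_mul]
    exact finite_orbit_monomialGL hϖ ht _ _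
  · rw [monomialGL_mul, conj_mem_iwahori_iff ht] at hx2
    rw [conj_mem_iwahori_iff ht]
    rw [mem_iwahori_iff ht] at hx
    -- Entry by entry, the required bound comes either from `x ∈ I` or from the conjugate by the
    -- product. The two alternatives in `hconv` say which.
    have key : ∀ y : GL (Fin n) F, (∀ i j, y i j ∈ fil O t (iwLevel i j)) →
        (∀ i j, y ((π * σ) i) ((π * σ) j) ∈
          fil O t (iwLevel i j + (ν (σ i) + μ i) - (ν (σ j) + μ j))) →
        ∀ i j, y (π i) (π j) ∈ fil O t (iwLevel i j + ν i - ν j) := fun y h1 h2 i j => by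
      rcases hconv i j with h | h
      · exact mem_fil_of_le ht h (h1 _ _)
      · have := h2 (σ⁻¹ i) (σ⁻¹ j)
        rw [Equiv.Perm.mul_apply, Equiv.Perm.mul_apply, perm_apply_inv,
          perm_apply_inv] at this
        exact mem_fil_of_le ht (by linarith) this
    exact ⟨key x hx.1 hx2.1, key x⁻¹ hx.2 hx2.2⟩

/-- Length-zero elements. -/
theorem heckeMonomial_mul_of_level_eq (hϖ : Irreducible ϖ) (ht : (t : F) = algebraMap O F ϖ)
    (π σ : Equiv.Perm (Fin n)) (ν μ : Fin n → ℤ)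
    (h : ∀ i j, iwLevel (σ i) (σ j) = iwLevel i j + μ i - μ j) :
    heckeMonomial k ϖ t π ν * heckeMonomial k ϖ t σ μ =
      heckeMonomial k ϖ t (π * σ) fun j => ν (σ j) + μ j := by
  have h' : ∀ i j, iwLevel i j = iwLevel (σ⁻¹ i) (σ⁻¹ j) + μ (σ⁻¹ i) - μ (σ⁻¹ j) := fun i j => by
    rw [← h, perm_apply_inv, perm_apply_inv]
  refine heckeMonomial_mul k hϖ ht π σ ν μ (fun x hx => ⟨1, one_mem _, x, hx, by simp, by simp, ?_⟩)
    fun i j => Or.inr (h' i j).le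
  rw [conj_mem_iwahori_iff ht]
  rw [mem_iwahori_iff ht] at hx
  exact ⟨fun i j => h i j ▸ hx.1 _ _, fun i j => h i j ▸ hx.2 _ _⟩

theorem swap_apply_cases {a b : Fin n} (i : Fin n) :
    (i = a ∧ Equiv.swap a b i = b) ∨ (i = b ∧ Equiv.swap a b i = a) ∨
      (i ≠ a ∧ i ≠ b ∧ Equiv.swap a b i = i) := by
  by_cases h1 : i = a
  · exact Or.inl ⟨h1, by rw [h1, Equiv.swap_apply_left]⟩
  · by_cases h2 : i = b
    · exact Or.inr (Or.inl ⟨h2, by rw [h2, Equiv.swap_apply_right]⟩)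
    · exact Or.inr (Or.inr ⟨h1, h2, Equiv.swap_apply_of_ne_of_ne h1 h2⟩)

theorem iwLevel_swap {a b : Fin n} (hab : (b : ℕ) = a + 1) (i j : Fin n)
    (h1 : ¬ (i = a ∧ j = b)) (h2 : ¬ (i = b ∧ j = a)) :
    iwLevel (Equiv.swap a b i) (Equiv.swap a b j) = iwLevel i j := by
  unfold iwLevel
  rcases swap_apply_cases (a := a) (b := b) i with ⟨h, h'⟩ | ⟨h, h'⟩ | ⟨h, h3, h'⟩ <;>
  rcases swap_apply_cases (a := a) (b := b) j with ⟨g, g'⟩ | ⟨g, g'⟩ | ⟨g, g3, g'⟩ <;>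
  rw [h', g'] <;> congr 1 <;> simp only [Fin.lt_def, Fin.ext_iff] at * <;> apply propext <;> omega

/-- An adjacent transposition preserves the relative order of all pairs of indices except `a, b`.
Hence only the `(a, b)` entry, which moves below the diagonal, can take the conjugate out of `I`. -/
theorem mem_fil_swap {a b : Fin n} (hab : (b : ℕ) = a + 1) (ht : (t : F) = algebraMap O F ϖ)
    {z : GL (Fin n) F} (hz : z ∈ iwahori n F ϖ) (hz0 : z a b = 0) :
    (monomialGL t (Equiv.swap a b) 0)⁻¹ * z * monomialGL t (Equiv.swap a b) 0 ∈ iwahori n F ϖ := by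
  have h1 := (mem_iwahori_iff_lower ht).1 hz
  rw [mem_iwahori_iff_lower ht]
  refine ⟨mul_mem (mul_mem (inv_mem (perm_mem_maxCompact _)) h1.1) (perm_mem_maxCompact _),
    fun i j hij => ?_⟩
  rw [conj_monomialGL_apply]
  simp only [Pi.zero_apply, sub_self, zpow_zero, Units.val_one, one_mul]
  by_cases h : i = b ∧ j = a
  · rw [h.1, h.2, Equiv.swap_apply_left, Equiv.swap_apply_right, hz0]
    exact zero_mem _
  · have h2 := ((mem_iwahori_iff ht).1 hz).1 (Equiv.swap a b i) (Equiv.swap a b j)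
    rwa [iwLevel_swap hab i j (fun h' => by rw [h'.1, h'.2] at hij; omega) h, iwLevel_of_gt hij] at h2

/-- `[I g s I] = [I g I] [I s I]` for a simple reflection `s` with `g s` longer than `g`. -/
theorem heckeMonomial_mul_swap (hϖ : Irreducible ϖ) (ht : (t : F) = algebraMap O F ϖ)
    {a b : Fin n} (hab : (b : ℕ) = a + 1) (π : Equiv.Perm (Fin n)) (ν : Fin n → ℤ)
    (h : iwLevel (π a) (π b) ≤ ν a - ν b) :
    heckeMonomial k ϖ t π ν * heckeMonomial k ϖ t (Equiv.swap a b) 0 =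
      heckeMonomial k ϖ t (π * Equiv.swap a b) (ν ∘ Equiv.swap a b) := by
  have hne : a ≠ b := fun h => by rw [h] at hab; omega
  have hlt : a < b := by omega
  refine (heckeMonomial_mul k hϖ ht π (Equiv.swap a b) ν 0 (fun x hx => ?_) fun i j => ?_).trans ?_
  · obtain ⟨-, -, hd, hd'⟩ := iwahori_diag_unit hϖ ht hx b
    have hx1 := (mem_iwahori_iff ht).1 hx
    -- The coefficient is chosen so that removing the root element `1 + v_a E_{ab}` on the left
    -- kills the `(a, b)` entry of `x`. What remains is conjugated into `I` by `s`, and hypothesis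
    -- `h` says that `t^ν π` conjugates the root element into `I`.
    let v : Fin n → F := Pi.single a (x a b * (x b b)⁻¹)
    have hva : v a ∈ fil O t 0 := by
      have := mul_mem_fil (hx1.1 a b) hd'
      rw [iwLevel_of_lt hlt, add_zero] at this
      simpa [v] using this
    have hv : ∀ i, i ≠ a → v i = 0 := fun i hi => by simp [v, hi]
    have hy : colGL b v ∈ iwahori n F ϖ := by
      refine colGL_mem_iwahori ht b fun i hi => ?_
      by_cases hia : i = a
      · rw [hia, iwLevel_of_lt hlt]
        exact hva
      · rw [hv i hia]
        exact zero_mem _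
    refine ⟨_, hy, (colGL b v)⁻¹ * x, mul_mem (inv_mem hy) hx, by rw [mul_inv_cancel_left], ?_, ?_⟩
    · rw [conj_inv_mem_iwahori_iff ht, colGL_inv]
      have key : ∀ w : Fin n → F, (∀ i, i ≠ a → w i = 0) → w a ∈ fil O t 0 → ∀ i j,
          colGL b w i j ∈ fil O t (iwLevel (π i) (π j) - ν i + ν j) := fun w hw hwa i j => by
        refine colGL_mem_fil ht b (f := fun i j => iwLevel (π i) (π j) - ν i + ν j)
          (fun i => by simp [iwLevel_self]) (fun i hi => ?_) i j
        by_cases hia : i = a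
        · rw [hia]
          exact mem_fil_of_le ht (by linarith) hwa
        · rw [hw i hia]
          exact zero_mem _
      exact ⟨key v hv hva, key (-v) (fun i hi => by simp [hv i hi]) (neg_mem hva)⟩
    · refine mem_fil_swap hab ht (mul_mem (inv_mem hy) hx) ?_
      rw [colGL_inv, colGL_mul_apply, if_neg hne]
      simp only [v, Pi.neg_apply, Pi.single_eq_same]
      field_simp
      ring
  · by_cases h1 : i = b ∧ j = a
    · left
      rw [h1.1, h1.2, iwLevel_of_gt hlt]
      have := iwLevel_add_symm (i := π a) (j := π b) (by simpa using hne)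
      linarith
    · right
      rw [Equiv.swap_inv, Pi.zero_apply, Pi.zero_apply, add_zero, sub_zero]
      by_cases h2 : i = a ∧ j = b
      · rw [h2.1, h2.2, iwLevel_of_lt hlt]
        exact iwLevel_nonneg _ _
      · rw [iwLevel_swap hab i j h2 h1]
  · congr 1
    ext j
    simp

end Product

end

section

open Matrix

section Product

variable (k : Type*) [CommRing k]
variable {n : ℕ} {O F : Type*} [CommRing O] [Field F] [Algebra O F] {t : Fˣ} {ϖ : O}
  [IsDomain O] [IsDiscreteValuationRing O] [IsFractionRing O F] [Finite (O ⧸ Ideal.span {ϖ})]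

theorem swap_inv_eq (a b : Fin n) :
    (monomialGL t (Equiv.swap a b) 0)⁻¹ = monomialGL t (Equiv.swap a b) 0 := by
  rw [inv_eq_iff_mul_eq_one, monomialGL_mul, Equiv.swap_mul_self, ← diagPow_zero (t := t),
    diagPow_eq_monomialGL]
  rfl

/-- `[I s h I] = [I s I] [I h I]` for a simple reflection `s` with `s h` longer than `h`. -/
theorem heckeMonomial_swap_mul (hϖ : Irreducible ϖ) (ht : (t : F) = algebraMap O F ϖ)
    {a b : Fin n} (hab : (b : ℕ) = a + 1) (σ : Equiv.Perm (Fin n)) (μ : Fin n → ℤ)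
    (h : iwLevel (σ⁻¹ a) (σ⁻¹ b) + μ (σ⁻¹ a) - μ (σ⁻¹ b) ≤ 0) :
    heckeMonomial k ϖ t (Equiv.swap a b) 0 * heckeMonomial k ϖ t σ μ =
      heckeMonomial k ϖ t (Equiv.swap a b * σ) μ := by
  have hne : a ≠ b := fun h => by rw [h] at hab; omega
  have hlt : a < b := by omega
  refine (heckeMonomial_mul k hϖ ht (Equiv.swap a b) σ 0 μ (fun x hx => ?_) fun i j => ?_).trans ?_
  · obtain ⟨-, -, hd, hd'⟩ := iwahori_diag_unit hϖ ht hx a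
    have hx1 := (mem_iwahori_iff ht).1 hx
    -- Here the root element is split off on the right, so the pivot is `x a a` instead of `x b b`.
    let v : Fin n → F := Pi.single a (x a b * (x a a)⁻¹)
    have hva : v a ∈ fil O t 0 := by
      have := mul_mem_fil (hx1.1 a b) hd'
      rw [iwLevel_of_lt hlt, add_zero] at this
      simpa [v] using this
    have hv : ∀ i, i ≠ a → v i = 0 := fun i hi => by simp [v, hi]
    have hy : colGL b v ∈ iwahori n F ϖ := by
      refine colGL_mem_iwahori ht b fun i hi => ?_
      by_cases hia : i = a
      · rw [hia, iwLevel_of_lt hlt]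
        exact hva
      · rw [hv i hia]
        exact zero_mem _
    refine ⟨x * (colGL b v)⁻¹, mul_mem hx (inv_mem hy), _, hy, by rw [inv_mul_cancel_right], ?_, ?_⟩
    · have := mem_fil_swap hab ht (mul_mem hx (inv_mem hy)) (by
        rw [colGL_inv, mul_colGL_apply _ _ (by simp [hv b hne.symm]), if_pos rfl,
          Finset.sum_eq_single a]
        · simp only [v, Pi.neg_apply, Pi.single_eq_same]
          field_simp
          ring
        · intro l _ hl
          rw [Pi.neg_apply, hv l hl, neg_zero, mul_zero]
        · simp)
      rwa [swap_inv_eq] at this ⊢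
    · rw [conj_mem_iwahori_iff ht, colGL_inv]
      have key : ∀ w : Fin n → F, (∀ i, i ≠ a → w i = 0) → w a ∈ fil O t 0 → ∀ i j,
          colGL b w (σ i) (σ j) ∈ fil O t (iwLevel i j + μ i - μ j) := fun w hw hwa i j => by
        have := colGL_mem_fil ht b (f := fun i j => iwLevel (σ⁻¹ i) (σ⁻¹ j) + μ (σ⁻¹ i) - μ (σ⁻¹ j))
          (c := w) (fun i => by simp [iwLevel_self]) (fun i hi => ?_) (σ i) (σ j)
        · simpa using this
        by_cases hia : i = a
        · rw [hia]
          exact mem_fil_of_le ht h hwa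
        · rw [hw i hia]
          exact zero_mem _
      exact ⟨key v hv hva, key (-v) (fun i hi => by simp [hv i hi]) (neg_mem hva)⟩
  · by_cases h1 : i = b ∧ j = a
    · right
      rw [h1.1, h1.2, iwLevel_of_gt hlt]
      have := iwLevel_add_symm (i := σ⁻¹ a) (j := σ⁻¹ b) (by simpa using hne)
      linarith
    · left
      rw [Pi.zero_apply, Pi.zero_apply, add_zero, sub_zero]
      by_cases h2 : i = a ∧ j = b
      · rw [h2.1, h2.2, iwLevel_of_lt hlt]
        exact iwLevel_nonneg _ _
      · rw [iwLevel_swap hab i j h2 h1]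
  · congr 1
    ext j
    simp

theorem lower_inv {b : GL (Fin n) F} (hb : ∀ i j, i < j → b i j = 0) (i j : Fin n) (hij : i < j) :
    b⁻¹ i j = 0 := by
  have h : (b : Matrix (Fin n) (Fin n) F).BlockTriangular OrderDual.toDual := fun i j hij =>
    hb i j hij
  let _ := b.invertible
  have := blockTriangular_inv_of_blockTriangular h
  rw [← coe_units_inv] at this
  exact this (i := i) (j := j) hij

/-- In the Iwahori decomposition `x = u b`, conjugation by the dominant `t^ν` keeps the upper
unipotent factor in `I`. Hypothesis `h` says that the inverse conjugation by the second factor keeps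
the lower triangular part in `I`. A general `σ` is allowed because the Bernstein relation needs the
case of a simple reflection. -/
theorem heckeMonomial_dominant_mul (hϖ : Irreducible ϖ) (ht : (t : F) = algebraMap O F ϖ)
    (σ : Equiv.Perm (Fin n)) {ν μ : Fin n → ℤ} (hν : Antitone ν)
    (h : ∀ i j, σ i < σ j → 0 ≤ iwLevel i j + μ i - μ j) :
    heckeMonomial k ϖ t 1 ν * heckeMonomial k ϖ t σ μ =
      heckeMonomial k ϖ t σ fun j => ν (σ j) + μ j := by
  refine (heckeMonomial_mul k hϖ ht 1 σ ν μ (fun x hx => ?_) fun i j => ?_).trans ?_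
  · obtain ⟨u, hu, b, hb, hb0, rfl⟩ := iwahori_factorization hϖ ht hx
    refine ⟨u, mem_iwahori_of_unipotent ht hu.1 hu.2, b, hb, rfl, ?_, ?_⟩
    · rw [conj_inv_mem_iwahori_iff ht]
      have key : ∀ u ∈ unipotent n F ⊓ maxCompact n O F, ∀ i j, u i j ∈
          fil O t (iwLevel i j - ν i + ν j) := fun u hu i j => by
        rcases lt_trichotomy i j with h1 | h1 | h1
        · rw [iwLevel_of_lt h1]
          exact mem_fil_of_le ht (by linarith [hν h1.le]) (((mem_maxCompact_iff (t := t)).1 hu.2).1 i j)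
        · rw [← h1, iwLevel_self]
          exact mem_fil_of_le ht (by linarith) (((mem_maxCompact_iff (t := t)).1 hu.2).1 i i)
        · rw [hu.1.1 h1]
          exact zero_mem _
      exact ⟨key u hu, key _ (inv_mem hu)⟩
    · rw [conj_mem_iwahori_iff ht]
      have key : ∀ b ∈ iwahori n F ϖ, (∀ i j, i < j → b i j = 0) → ∀ i j, b (σ i) (σ j) ∈
          fil O t (iwLevel i j + μ i - μ j) := fun b hb hb0 i j => by
        have hb1 := ((mem_iwahori_iff ht).1 hb).1 (σ i) (σ j)
        rcases lt_trichotomy (σ i) (σ j) with h1 | h1 | h1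
        · rw [hb0 _ _ h1]
          exact zero_mem _
        · rw [EmbeddingLike.apply_eq_iff_eq] at h1
          subst h1
          rw [iwLevel_self] at *
          simpa using hb1
        · rw [iwLevel_of_gt h1] at hb1
          refine mem_fil_of_le ht ?_ hb1
          have h2 := h j i h1
          have := iwLevel_add_symm (i := i) (j := j) (fun h => by rw [h] at h1; exact lt_irrefl _ h1)
          linarith
      exact ⟨key b hb hb0, key _ (inv_mem hb) (lower_inv hb0)⟩
  · rcases lt_trichotomy i j with h1 | h1 | h1
    · right
      rw [iwLevel_of_lt h1]
      exact h _ _ (by rwa [perm_apply_inv, perm_apply_inv])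
    · left
      rw [h1]
      simp
    · left
      have := hν h1.le
      simp only [Equiv.Perm.one_apply]
      linarith
  · rw [one_mul]

theorem heckeMonomial_dominant_add (hϖ : Irreducible ϖ) (ht : (t : F) = algebraMap O F ϖ)
    {ν μ : Fin n → ℤ} (hν : Antitone ν) (hμ : Antitone μ) :
    heckeMonomial k ϖ t 1 ν * heckeMonomial k ϖ t 1 μ = heckeMonomial k ϖ t 1 (ν + μ) := by
  refine heckeMonomial_dominant_mul k hϖ ht 1 hν fun i j hij => ?_
  have h1 := hμ (show i ≤ j from le_of_lt hij)
  have h2 := iwLevel_nonneg i j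
  linarith

/-! ### The quadratic relation -/

/-- The levels of the parahoric subgroup generated by `I` and a simple reflection. -/
def parahoricLevel (a b : Fin n) (i j : Fin n) : ℤ := if i = b ∧ j = a then 0 else iwLevel i j

theorem parahoricLevel_triangle {a b : Fin n} (hab : (b : ℕ) = a + 1) (i j l : Fin n) :
    parahoricLevel a b i j ≤ parahoricLevel a b i l + parahoricLevel a b l j := by
  unfold parahoricLevel iwLevel
  simp only [Fin.ext_iff, Fin.lt_def]
  split_ifs <;> omega

variable (O) in
/-- The parahoric subgroup generated by `I` and a simple reflection. -/
def parahoric (ht : (t : F) = algebraMap O F ϖ) {a b : Fin n} (hab : (b : ℕ) = a + 1) :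
    Subgroup (GL (Fin n) F) :=
  levelSubgroup O ht (parahoricLevel a b) (fun i j l => parahoricLevel_triangle hab i j l)
    fun i j => by
      unfold parahoricLevel iwLevel
      simp only [Fin.ext_iff, Fin.lt_def]
      split_ifs <;> omega

theorem parahoricLevel_le (a b i j : Fin n) : parahoricLevel a b i j ≤ iwLevel i j := by
  unfold parahoricLevel
  split_ifs
  · exact iwLevel_nonneg _ _
  · exact le_rfl

theorem parahoricLevel_nonneg (a b i j : Fin n) : 0 ≤ parahoricLevel a b i j := by
  unfold parahoricLevel
  split_ifs
  · exact le_rfl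
  · exact iwLevel_nonneg _ _

theorem iwahori_le_parahoric (ht : (t : F) = algebraMap O F ϖ) {a b : Fin n}
    (hab : (b : ℕ) = a + 1) : iwahori n F ϖ ≤ parahoric O ht hab := fun _ hg =>
  ⟨fun i j => mem_fil_of_le ht (parahoricLevel_le a b i j) (((mem_iwahori_iff ht).1 hg).1 i j),
    fun i j => mem_fil_of_le ht (parahoricLevel_le a b i j) (((mem_iwahori_iff ht).1 hg).2 i j)⟩

theorem parahoric_le_maxCompact (ht : (t : F) = algebraMap O F ϖ) {a b : Fin n}
    (hab : (b : ℕ) = a + 1) : parahoric O ht hab ≤ maxCompact n O F := fun _ hg =>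
  (mem_maxCompact_iff (t := t)).2
    ⟨fun i j => mem_fil_of_le ht (parahoricLevel_nonneg a b i j) (hg.1 i j),
      fun i j => mem_fil_of_le ht (parahoricLevel_nonneg a b i j) (hg.2 i j)⟩

theorem swap_mem_parahoric (ht : (t : F) = algebraMap O F ϖ) {a b : Fin n}
    (hab : (b : ℕ) = a + 1) : monomialGL t (Equiv.swap a b) 0 ∈ parahoric O ht hab := by
  have key : ∀ i j, monomialGL t (Equiv.swap a b) 0 i j ∈ fil O t (parahoricLevel a b i j) := by
    intro i j
    rw [monomialGL_apply]
    split_ifs with h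
    · have : parahoricLevel a b i j = 0 := by
        unfold parahoricLevel iwLevel
        rcases swap_apply_cases (a := a) (b := b) j with ⟨h1, h2⟩ | ⟨h1, h2⟩ | ⟨h1, h3, h2⟩ <;>
        rw [h2] at h <;> simp only [Fin.ext_iff, Fin.lt_def] at * <;> split_ifs <;> omega
      rw [this]
      simpa using one_mem_fil
    · exact zero_mem _
  exact ⟨key, by rwa [swap_inv_eq]⟩

variable (F) in
/-- The root subgroup element `1 + c E_{ab}`. -/
def rootGL (a b : Fin n) (c : O) : GL (Fin n) F := colGL b (Pi.single a (algebraMap O F c))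

theorem rootGL_mem_iwahori (ht : (t : F) = algebraMap O F ϖ) {a b : Fin n} (hlt : a < b) (c : O) :
    rootGL F a b c ∈ iwahori n F ϖ := by
  refine colGL_mem_iwahori ht b fun i hi => ?_
  by_cases hia : i = a
  · rw [hia, iwLevel_of_lt hlt, Pi.single_eq_same]
    exact algebraMap_mem_fil c
  · rw [Pi.single_eq_of_ne hia]
    exact zero_mem _

/-- `P = I ∪ ⋃_c (1 + c E_{ab}) s I`. -/
theorem exists_root_swap_of_mem_parahoric (hϖ : Irreducible ϖ) (ht : (t : F) = algebraMap O F ϖ)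
    {a b : Fin n} (hab : (b : ℕ) = a + 1) {p : GL (Fin n) F} (hp : p ∈ parahoric O ht hab)
    (hpI : p ∉ iwahori n F ϖ) :
    ∃ c : O, (rootGL F a b c * monomialGL t (Equiv.swap a b) 0)⁻¹ * p ∈ iwahori n F ϖ := by
  have hne : a ≠ b := fun h => by rw [h] at hab; omega
  have hlt : a < b := by omega
  have hba0 : p b a ∈ fil O t 0 := mem_fil_of_le ht (parahoricLevel_nonneg a b b a) (hp.1 b a)
  have hba : p b a ∉ fil O t 1 := by
    intro h
    apply hpI
    rw [mem_iwahori_iff_lower ht]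
    refine ⟨parahoric_le_maxCompact ht hab hp, fun i j hij => ?_⟩
    by_cases h1 : i = b ∧ j = a
    · rw [h1.1, h1.2]
      exact h
    · have := hp.1 i j
      rwa [parahoricLevel, if_neg h1, iwLevel_of_gt hij] at this
  obtain ⟨h0, h1⟩ := inv_mem_fil_zero hϖ ht hba0 hba
  -- The value `c = p_aa / p_ba` makes the `(a, a)` entry of `(1 + c E_{ab})⁻¹ p` vanish.
  -- Multiplication by `s` moves that entry to position `(b, a)`, the only place where membership in
  -- `I` could fail.
  obtain ⟨c, hc⟩ := mem_fil_zero.1 (mul_mem_fil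
    (mem_fil_of_le ht (parahoricLevel_nonneg a b a a) (hp.1 a a)) h1)
  refine ⟨c, ?_⟩
  have hr := iwahori_le_parahoric ht hab (rootGL_mem_iwahori (F := F) ht hlt c)
  have hz := mul_mem (inv_mem hr) hp
  rw [_root_.mul_inv_rev, mul_assoc, swap_inv_eq, mem_iwahori_iff_lower ht]
  refine ⟨parahoric_le_maxCompact ht hab (mul_mem (swap_mem_parahoric ht hab) hz), fun i j hij => ?_⟩
  have haa : ((rootGL F a b c)⁻¹ * p) a a = 0 := by
    rw [rootGL, colGL_inv, colGL_mul_apply, if_neg hne, Pi.neg_apply, Pi.single_eq_same, hc]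
    field_simp
    ring
  generalize (rootGL F a b c)⁻¹ * p = z at *
  have e : (monomialGL t (Equiv.swap a b) 0 * z) i j = z (Equiv.swap a b i) j := by
    rw [← swap_inv_eq, monomialGL_inv_mul_apply]
    simp
  rw [e]
  by_cases h2 : Equiv.swap a b i = a ∧ j = a
  · rw [h2.1, h2.2, haa]
    exact zero_mem _
  · have h3 := hz.1 (Equiv.swap a b i) j
    have : parahoricLevel a b (Equiv.swap a b i) j = 1 := by
      unfold parahoricLevel iwLevel
      clear hz haa h3 e
      rcases swap_apply_cases (a := a) (b := b) i with ⟨h5, h4⟩ | ⟨h5, h4⟩ | ⟨h5, h6, h4⟩ <;>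
        rw [h4] at h2 ⊢ <;> simp only [Fin.ext_iff, Fin.lt_def, true_and] at * <;> split_ifs <;> omega
    rwa [this] at h3

end Product

end

section

open Matrix

/-! ### The parahoric of a simple reflection and the invertibility of `T_s`. -/

section Quadratic

variable (k : Type*) [CommRing k]
variable {n : ℕ} {O F : Type*} [CommRing O] [Field F] [Algebra O F] {t : Fˣ} {ϖ : O}
  [IsDomain O] [IsDiscreteValuationRing O] [IsFractionRing O F] [Finite (O ⧸ Ideal.span {ϖ})]

theorem swap_notMem_iwahori (hϖ : Irreducible ϖ) (ht : (t : F) = algebraMap O F ϖ) {a b : Fin n}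
    (hlt : a < b) : monomialGL t (Equiv.swap a b) 0 ∉ iwahori n F ϖ := fun h => by
  have := ((mem_iwahori_iff ht).1 h).1 b a
  rw [iwLevel_of_gt hlt, monomialGL_apply, Equiv.swap_apply_left, if_pos rfl, Pi.zero_apply,
    zpow_zero, Units.val_one] at this
  exact one_notMem_fil_one hϖ ht this

theorem rootGL_inv_mul (a b : Fin n) (hne : a ≠ b) (c d : O) :
    (rootGL F a b c)⁻¹ * rootGL F a b d = rootGL F a b (d - c) := by
  ext i j
  rw [rootGL, colGL_inv, colGL_mul_apply, rootGL, rootGL, colGL_apply, colGL_apply, colGL_apply]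
  by_cases h1 : i = b
  · simp [h1]
  · by_cases h2 : i = a
    · subst h2
      by_cases h3 : j = b
      · subst h3
        simp [h1]
        ring
      · simp [h1, h3, Ne.symm h3]
    · simp [h1, h2]

theorem orbit_swap_eq_range (hϖ : Irreducible ϖ) (ht : (t : F) = algebraMap O F ϖ) {a b : Fin n}
    (hab : (b : ℕ) = a + 1) :
    MulAction.orbit (iwahori n F ϖ) ((monomialGL t (Equiv.swap a b) 0 : GL (Fin n) F) :
      GL (Fin n) F ⧸ iwahori n F ϖ) = Set.range fun c : O =>
        ((rootGL F a b c * monomialGL t (Equiv.swap a b) 0 : GL (Fin n) F) :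
          GL (Fin n) F ⧸ iwahori n F ϖ) := by
  have hlt : a < b := by omega
  ext x
  rw [mem_orbit_coset_iff]
  constructor
  · rintro ⟨i, hi, rfl⟩
    obtain ⟨c, hc⟩ := exists_root_swap_of_mem_parahoric hϖ ht hab
      (mul_mem (iwahori_le_parahoric ht hab hi) (swap_mem_parahoric ht hab))
      fun h => swap_notMem_iwahori hϖ ht hlt ((Subgroup.mul_mem_cancel_left _ hi).1 h)
    exact ⟨c, QuotientGroup.eq.2 hc⟩
  · rintro ⟨c, rfl⟩
    exact ⟨_, rootGL_mem_iwahori ht hlt c, rfl⟩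

/-- Two cosets `(1 + c E_{ab}) s I` and `(1 + d E_{ab}) s I` agree exactly when `c` and `d` agree
modulo `ϖ`: conjugation by `s` turns `1 + (d - c) E_{ab}` into `1 + (d - c) E_{ba}`. -/
theorem card_orbit_swap (hϖ : Irreducible ϖ) (ht : (t : F) = algebraMap O F ϖ) {a b : Fin n}
    (hab : (b : ℕ) = a + 1) :
    Nat.card (MulAction.orbit (iwahori n F ϖ) ((monomialGL t (Equiv.swap a b) 0 : GL (Fin n) F) :
      GL (Fin n) F ⧸ iwahori n F ϖ)) = Nat.card (O ⧸ Ideal.span {ϖ}) := by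
  have hlt : a < b := by omega
  rw [orbit_swap_eq_range hϖ ht hab]
  have key : ∀ c d : O, ((rootGL F a b c * monomialGL t (Equiv.swap a b) 0 : GL (Fin n) F) :
      GL (Fin n) F ⧸ iwahori n F ϖ) =
      ((rootGL F a b d * monomialGL t (Equiv.swap a b) 0 : GL (Fin n) F) :
        GL (Fin n) F ⧸ iwahori n F ϖ) ↔
      Ideal.Quotient.mk (Ideal.span {ϖ}) c = Ideal.Quotient.mk (Ideal.span {ϖ}) d := fun c d => by
    have h1 := sub_mem_fil_iff (F := F) ht (m := 1) (a := d) (b := c)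
    rw [pow_one, Nat.cast_one, ← map_sub] at h1
    rw [QuotientGroup.eq, _root_.mul_inv_rev, mul_assoc, ← mul_assoc _ (rootGL F a b d),
      rootGL_inv_mul a b hlt.ne, ← mul_assoc, eq_comm (a := Ideal.Quotient.mk _ c), ← h1]
    constructor
    · intro h
      have := ((conj_mem_iwahori_iff ht _ _).1 h).1 b a
      rw [Equiv.swap_apply_left, Equiv.swap_apply_right, iwLevel_of_gt hlt, rootGL, colGL_apply,
        if_neg hlt.ne, if_pos ⟨rfl, hlt.ne⟩] at this
      simpa using this
    · intro h
      rw [conj_mem_iwahori_iff ht]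
      have key : ∀ w : Fin n → F, (∀ i, i ≠ a → w i = 0) → w a ∈ fil O t 1 → ∀ i j,
          colGL b w (Equiv.swap a b i) (Equiv.swap a b j) ∈
            fil O t (iwLevel i j + (0 : Fin n → ℤ) i - (0 : Fin n → ℤ) j) := fun w hw hwa i j => by
        have := colGL_mem_fil ht b (f := fun i j => iwLevel (Equiv.swap a b i) (Equiv.swap a b j))
          (c := w) (fun i => (iwLevel_self _).le) (fun i hi => ?_)
          (Equiv.swap a b i) (Equiv.swap a b j)
        · simpa using this
        · by_cases hia : i = a
          · rw [hia, Equiv.swap_apply_left, Equiv.swap_apply_right, iwLevel_of_gt hlt]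
            exact hwa
          · rw [hw i hia]
            exact zero_mem _
      have hs : ∀ i, i ≠ a → (Pi.single a (algebraMap O F (d - c)) : Fin n → F) i = 0 :=
        fun i hi => Pi.single_eq_of_ne hi _
      rw [rootGL, colGL_inv]
      refine ⟨key _ hs ?_, key _ (fun i hi => by rw [Pi.neg_apply, hs i hi, neg_zero]) ?_⟩
      · rw [Pi.single_eq_same]
        exact h
      · rw [Pi.neg_apply, Pi.single_eq_same]
        exact neg_mem h
  let φ : (O ⧸ Ideal.span {ϖ}) → Set.range fun c : O =>
        ((rootGL F a b c * monomialGL t (Equiv.swap a b) 0 : GL (Fin n) F) :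
          GL (Fin n) F ⧸ iwahori n F ϖ) := fun x => ⟨_, Quotient.out x, rfl⟩
  refine (Nat.card_congr (Equiv.ofBijective φ ⟨fun x y hxy => ?_, ?_⟩)).symm
  · have := (key _ _).1 (Subtype.ext_iff.1 hxy)
    rwa [Ideal.Quotient.mk_out, Ideal.Quotient.mk_out] at this
  · rintro ⟨_, c, rfl⟩
    refine ⟨Ideal.Quotient.mk _ c, Subtype.ext ((key _ _).2 ?_)⟩
    rw [Ideal.Quotient.mk_out]

theorem image_parahoric_eq (hϖ : Irreducible ϖ) (ht : (t : F) = algebraMap O F ϖ) {a b : Fin n}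
    (hab : (b : ℕ) = a + 1) :
    (QuotientGroup.mk : GL (Fin n) F → GL (Fin n) F ⧸ iwahori n F ϖ) ''
      (parahoric O ht hab : Set (GL (Fin n) F)) =
    insert ((1 : GL (Fin n) F) : GL (Fin n) F ⧸ iwahori n F ϖ) (MulAction.orbit (iwahori n F ϖ)
      ((monomialGL t (Equiv.swap a b) 0 : GL (Fin n) F) : GL (Fin n) F ⧸ iwahori n F ϖ)) := by
  have hlt : a < b := by omega
  ext x
  constructor
  · rintro ⟨p, hp, rfl⟩
    by_cases hpI : p ∈ iwahori n F ϖ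
    · left
      rw [eq_comm, QuotientGroup.eq]
      simpa using hpI
    · right
      obtain ⟨c, hc⟩ := exists_root_swap_of_mem_parahoric hϖ ht hab hp hpI
      rw [mem_orbit_coset_iff]
      exact ⟨_, rootGL_mem_iwahori ht hlt c, QuotientGroup.eq.2 hc⟩
  · rintro (rfl | h)
    · exact ⟨1, one_mem _, rfl⟩
    · obtain ⟨i, hi, rfl⟩ := mem_orbit_coset_iff.1 h
      exact ⟨_, mul_mem (iwahori_le_parahoric ht hab hi) (swap_mem_parahoric ht hab), rfl⟩

/-- The indicator of the parahoric `P = I ∪ IsI` is `1 + T_s`, with `[P : I] = q + 1`. Both the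
quadratic relation and the passage from `T_s`-eigenvectors to `s`-invariant vectors rest on this. -/
theorem exists_heckeIndicator_parahoric (hϖ : Irreducible ϖ) (ht : (t : F) = algebraMap O F ϖ)
    {a b : Fin n} (hab : (b : ℕ) = a + 1) :
    ∃ hfin : ((QuotientGroup.mk : GL (Fin n) F → GL (Fin n) F ⧸ iwahori n F ϖ) ''
        (parahoric O ht hab : Set (GL (Fin n) F))).Finite,
      hfin.toFinset.card = Nat.card (O ⧸ Ideal.span {ϖ}) + 1 ∧
      heckeIndicator k (iwahori_le_parahoric ht hab) hfin =
        1 + heckeMonomial k ϖ t (Equiv.swap a b) 0 := by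
  classical
  have hlt : a < b := by omega
  have horb := finite_orbit_monomialGL (n := n) hϖ ht (Equiv.swap a b) 0
  have hfin : ((QuotientGroup.mk : GL (Fin n) F → GL (Fin n) F ⧸ iwahori n F ϖ) ''
      (parahoric O ht hab : Set (GL (Fin n) F))).Finite := by
    rw [image_parahoric_eq hϖ ht hab]
    exact horb.insert _
  have hnot : ((1 : GL (Fin n) F) : GL (Fin n) F ⧸ iwahori n F ϖ) ∉ horb.toFinset := by
    rw [Set.Finite.mem_toFinset, mem_orbit_coset_iff]
    rintro ⟨i, hi, h⟩
    rw [eq_comm, QuotientGroup.eq, inv_one, one_mul] at h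
    exact swap_notMem_iwahori hϖ ht hlt ((Subgroup.mul_mem_cancel_left _ hi).1 h)
  have hset : hfin.toFinset = insert ((1 : GL (Fin n) F) : GL (Fin n) F ⧸ iwahori n F ϖ)
      horb.toFinset := by
    ext x
    rw [Set.Finite.mem_toFinset, image_parahoric_eq hϖ ht hab, Finset.mem_insert,
      Set.Finite.mem_toFinset, Set.mem_insert_iff]
  refine ⟨hfin, ?_, ?_⟩
  · rw [hset, Finset.card_insert_of_notMem hnot, ← card_orbit_swap hϖ ht hab,
      ← Nat.card_eq_card_finite_toFinset horb]
  · apply Subtype.ext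
    rw [Submodule.coe_add, HeckeAlgebra.coe_doubleCoset horb, HeckeAlgebra.coe_one]
    change ∑ x ∈ hfin.toFinset, _ = _
    rw [hset, Finset.sum_insert hnot]

/-- The quadratic relation. -/
theorem heckeMonomial_swap_sq (hϖ : Irreducible ϖ) (ht : (t : F) = algebraMap O F ϖ) {a b : Fin n}
    (hab : (b : ℕ) = a + 1) :
    heckeMonomial k ϖ t (Equiv.swap a b) 0 * heckeMonomial k ϖ t (Equiv.swap a b) 0 =
      ((Nat.card (O ⧸ Ideal.span {ϖ}) : k) - 1) • heckeMonomial k ϖ t (Equiv.swap a b) 0 +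
        (Nat.card (O ⧸ Ideal.span {ϖ}) : k) • 1 := by
  obtain ⟨hfin, hcard, he⟩ := exists_heckeIndicator_parahoric k hϖ ht hab
  -- The indicator `e` of the group `P` satisfies `e * e = [P : I] e`. Expanding with `e = 1 + T_s`
  -- gives the relation.
  have hee : heckeIndicator k (iwahori_le_parahoric ht hab) hfin *
      heckeIndicator k (iwahori_le_parahoric ht hab) hfin =
      (hfin.toFinset.card : k) • heckeIndicator k (iwahori_le_parahoric ht hab) hfin := by
    apply Subtype.ext
    rw [HeckeAlgebra.coe_mul, mul_heckeIndicator]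
    refine (congrArg _ (orbitMap_unitCoset_subgroupIndicator _ hfin)).trans ?_
    rw [map_smul, orbitMap_single, one_smul, map_one]
    rfl
  rw [he, hcard] at hee
  generalize heckeMonomial k ϖ t (Equiv.swap a b) 0 = T at *
  rw [mul_add, add_mul, add_mul, one_mul, one_mul, mul_one] at hee
  push_cast at hee
  have : T * T = ((Nat.card (O ⧸ Ideal.span {ϖ}) : k) + 1) • (1 + T) - (1 + T + T) := by
    rw [← hee]; abel
  rw [this]
  module

theorem isUnit_heckeMonomial_swap (hϖ : Irreducible ϖ) (ht : (t : F) = algebraMap O F ϖ)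
    {a b : Fin n} (hab : (b : ℕ) = a + 1) (hq : IsUnit (Nat.card (O ⧸ Ideal.span {ϖ}) : k)) :
    IsUnit (heckeMonomial k ϖ t (Equiv.swap a b) 0 : IwahoriHecke k n F ϖ) := by
  have h := heckeMonomial_swap_sq (F := F) k hϖ ht hab
  obtain ⟨u, hu⟩ := hq
  generalize heckeMonomial k ϖ t (Equiv.swap a b) 0 = T at *
  rw [← hu] at h
  have h2 : T * T - ((u : k) - 1) • T = (u : k) • 1 := by rw [h]; abel
  have h3 : ((u⁻¹ : kˣ) : k) • (T * T - ((u : k) - 1) • T) = 1 := by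
    rw [h2, smul_smul, Units.inv_mul, one_smul]
  refine ⟨⟨T, ((u⁻¹ : kˣ) : k) • (T - ((u : k) - 1) • 1), ?_, ?_⟩, rfl⟩
  · rw [mul_smul_comm, mul_sub, mul_smul_comm, mul_one, h3]
  · rw [smul_mul_assoc, sub_mul, smul_mul_assoc, one_mul, h3]

end Quadratic

/-! ### Invertibility of the elements attached to diagonal matrices. -/

section Units

variable (k : Type*) [CommRing k]
variable {n : ℕ} {O F : Type*} [CommRing O] [Field F] [Algebra O F] {t : Fˣ} {ϖ : O}

theorem perm_induction_adjacent {P : Equiv.Perm (Fin n) → Prop} (one : P 1)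
    (mul : ∀ x y, P x → P y → P (x * y))
    (swap : ∀ a b : Fin n, (b : ℕ) = a + 1 → P (Equiv.swap a b)) (π : Equiv.Perm (Fin n)) : P π := by
  cases n with
  | zero => exact Subsingleton.elim 1 π ▸ one
  | succ m =>
    have h := Equiv.Perm.mclosure_swap_castSucc_succ m
    have hπ : π ∈ Submonoid.closure
        (Set.range fun i : Fin m => Equiv.swap i.castSucc i.succ) := h ▸ Submonoid.mem_top _
    induction hπ using Submonoid.closure_induction with
    | mem x hx =>
      obtain ⟨i, rfl⟩ := hx
      exact swap _ _ (by simp)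
    | one => exact one
    | mul x y _ _ hx hy => exact mul _ _ hx hy

theorem perm_mem_subgroup (S : Subgroup (GL (Fin n) F))
    (hS : ∀ a b : Fin n, (b : ℕ) = a + 1 → monomialGL t (Equiv.swap a b) 0 ∈ S)
    (π : Equiv.Perm (Fin n)) : monomialGL t π 0 ∈ S := by
  refine perm_induction_adjacent (P := fun π => monomialGL t π 0 ∈ S) ?_ (fun x y hx hy => ?_) hS π
  · rw [← diagPow_eq_monomialGL, diagPow_zero]
    exact S.one_mem
  · have := S.mul_mem hx hy
    rw [monomialGL_mul] at this
    exact this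

theorem perm_conj_diagPow (π : Equiv.Perm (Fin n)) (ν : Fin n → ℤ) :
    monomialGL t π 0 * diagPow t ν * (monomialGL t π 0)⁻¹ = diagPow t (fun i => ν (π⁻¹ i)) := by
  rw [mul_inv_eq_iff_eq_mul, diagPow_eq_monomialGL, diagPow_eq_monomialGL, monomialGL_mul,
    monomialGL_mul, mul_one, one_mul]
  congr 1
  ext j
  simp

variable [IsDomain O] [IsDiscreteValuationRing O] [IsFractionRing O F]
  [Finite (O ⧸ Ideal.span {ϖ})]

/-- Right multiplications that preserve invertibility of `[IgI]`. -/
theorem isUnit_heckeMonomial (hϖ : Irreducible ϖ) (ht : (t : F) = algebraMap O F ϖ)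
    (hq : IsUnit (Nat.card (O ⧸ Ideal.span {ϖ}) : k)) (ν : Fin n → ℤ) :
    IsUnit (heckeMonomial k ϖ t 1 ν : IwahoriHecke k n F ϖ) := by
  have hmon : ∀ π σ (ν μ : Fin n → ℤ), ∃ τ : Equiv.Perm (Fin n), ∃ κ : Fin n → ℤ,
    monomialGL t π ν * monomialGL t σ μ = monomialGL t τ κ := fun π σ ν μ =>
    ⟨_, _, monomialGL_mul π σ ν μ⟩
  have hinv : ∀ σ (μ : Fin n → ℤ), ∃ τ : Equiv.Perm (Fin n), ∃ κ : Fin n → ℤ,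
    (monomialGL t σ μ)⁻¹ = monomialGL t τ κ := fun σ μ => by
      refine ⟨σ⁻¹, fun i => -μ (σ⁻¹ i), ?_⟩
      rw [inv_eq_iff_mul_eq_one, monomialGL_mul, ← diagPow_zero (t := t), diagPow_eq_monomialGL]
      congr 1
      · simp
      · ext i; simp
  let U : GL (Fin n) F → Prop := fun g => IsUnit (HeckeAlgebra.doubleCoset k (iwahori n F ϖ) g)
  -- `S` consists of the monomial `w` for which `[IgI]` and `[IgwI]` are simultaneously invertible,
  -- for every monomial `g`. Being a group, it can be tested on generators, with no reduced words.
  -- For a simple reflection `s`, one of `g`, `gs` is the longer one, and its double coset is the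
  -- product of the other with the unit `T_s`.
  let S : Subgroup (GL (Fin n) F) :=
    { carrier := {w | (∃ σ μ, w = monomialGL t σ μ) ∧
        ∀ π ν, U (monomialGL t π ν) ↔ U (monomialGL t π ν * w)}
      mul_mem' := by
        rintro _ _ ⟨⟨σ, μ, rfl⟩, h1⟩ ⟨⟨σ', μ', rfl⟩, h2⟩
        refine ⟨hmon _ _ _ _, fun π ν => ?_⟩
        obtain ⟨τ, κ, h⟩ := hmon π σ ν μ
        rw [h1, h, h2, ← h, mul_assoc]
      one_mem' := ⟨⟨1, 0, by rw [← diagPow_eq_monomialGL, diagPow_zero]⟩, fun π ν => by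
        rw [mul_one]⟩
      inv_mem' := by
        rintro _ ⟨⟨σ, μ, rfl⟩, h1⟩
        refine ⟨hinv _ _, fun π ν => ?_⟩
        obtain ⟨τ, κ, h⟩ := hinv σ μ
        obtain ⟨τ', κ', h'⟩ := hmon π τ ν κ
        rw [h, h', h1 τ' κ', ← h', ← h, inv_mul_cancel_right] }
  have hswap : ∀ a b : Fin n, (b : ℕ) = a + 1 → monomialGL t (Equiv.swap a b) 0 ∈ S := by
    intro a b hab
    refine ⟨⟨_, _, rfl⟩, fun π ν => ?_⟩
    have hs := isUnit_heckeMonomial_swap (F := F) k hϖ ht hab hq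
    have hne : a ≠ b := fun h => by rw [h] at hab; omega
    by_cases h : iwLevel (π a) (π b) ≤ ν a - ν b
    · have h1 := heckeMonomial_mul_swap (F := F) k hϖ ht hab π ν h
      have h2 : monomialGL t π ν * monomialGL t (Equiv.swap a b) 0 =
          monomialGL t (π * Equiv.swap a b) (ν ∘ Equiv.swap a b) := by
        rw [monomialGL_mul]
        congr 1
        ext j
        simp
      simp only [U]
      rw [h2, ← heckeMonomial, ← heckeMonomial, ← h1]
      obtain ⟨u, hu⟩ := hs
      rw [← hu, Units.isUnit_mul_units]
    · have h2 : monomialGL t π ν * monomialGL t (Equiv.swap a b) 0 =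
          monomialGL t (π * Equiv.swap a b) (ν ∘ Equiv.swap a b) := by
        rw [monomialGL_mul]
        congr 1
        ext j
        simp
      have h1 := heckeMonomial_mul_swap (F := F) k hϖ ht hab (π * Equiv.swap a b)
        (ν ∘ Equiv.swap a b) (by
          have := iwLevel_add_symm (i := π a) (j := π b) (by simpa using hne)
          simp only [Equiv.Perm.mul_apply, Equiv.swap_apply_left, Equiv.swap_apply_right,
            Function.comp_apply]
          omega)
      have h3 : (ν ∘ Equiv.swap a b) ∘ Equiv.swap a b = ν := by
        ext j
        simp
      rw [mul_assoc, Equiv.swap_mul_self, mul_one, h3] at h1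
      simp only [U]
      rw [h2, ← heckeMonomial, ← heckeMonomial, ← h1]
      obtain ⟨u, hu⟩ := hs
      rw [← hu, Units.isUnit_mul_units]
  have hperm := perm_mem_subgroup S hswap
  have hdiag : diagPow t ν ∈ S := by
    have hsing : ∀ i : Fin n, diagPow t (Pi.single i 1) ∈ S := by
      intro i
      obtain ⟨m, rfl⟩ : ∃ m, n = m + 1 := ⟨n - 1, by have := i.2; omega⟩
      -- The cyclic permutation `i ↦ i - 1` combined with `t` in the column of index zero has length
      -- zero: it normalises `I`, as the level identity `hlev` expresses.
      let σ : Equiv.Perm (Fin (m + 1)) := (finRotate (m + 1))⁻¹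
      have hσ : ∀ i : Fin (m + 1), ((σ i : Fin (m + 1)) : ℕ) = if (i : ℕ) = 0 then m else i - 1 := by
        intro i
        have h1 := coe_finRotate (σ i)
        rw [show finRotate (m + 1) (σ i) = i from perm_apply_inv _ _] at h1
        have h2 := (σ i).2
        simp only [Fin.ext_iff, Fin.val_last] at h1
        split_ifs at h1 ⊢ <;> omega
      have hlev : ∀ i j, iwLevel (σ i) (σ j) =
          iwLevel i j + (Pi.single 0 1 : Fin (m + 1) → ℤ) i - (Pi.single 0 1 : Fin (m + 1) → ℤ) j := by
        intro i j
        have hi := i.2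
        have hj := j.2
        simp only [iwLevel, Fin.lt_def, hσ, Pi.single_apply, Fin.ext_iff, Fin.val_zero]
        split_ifs <;> omega
      have hω : monomialGL t σ (Pi.single 0 1) ∈ S := by
        refine ⟨⟨_, _, rfl⟩, fun π ν => ?_⟩
        have h1 := heckeMonomial_mul_of_level_eq (F := F) k hϖ ht π σ ν _ hlev
        have h2 := heckeMonomial_mul_of_level_eq (F := F) k hϖ ht σ⁻¹ σ
          (fun i => -(Pi.single 0 1 : Fin (m + 1) → ℤ) (σ⁻¹ i)) _ hlev
        have h3 := heckeMonomial_mul_of_level_eq (F := F) k hϖ ht σ σ⁻¹ (Pi.single 0 1)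
          (fun i => -(Pi.single 0 1 : Fin (m + 1) → ℤ) (σ⁻¹ i)) fun i j => by
            have := hlev (σ⁻¹ i) (σ⁻¹ j)
            rw [perm_apply_inv, perm_apply_inv] at this
            rw [this]
            ring
        have h4 : (fun j => (fun i => -(Pi.single 0 1 : Fin (m + 1) → ℤ) (σ⁻¹ i)) (σ j) +
            (Pi.single 0 1 : Fin (m + 1) → ℤ) j) = 0 := by ext; simp
        have h5 : (fun j => (Pi.single 0 1 : Fin (m + 1) → ℤ) (σ⁻¹ j) +
            (fun i => -(Pi.single 0 1 : Fin (m + 1) → ℤ) (σ⁻¹ i)) j) = 0 := by ext; simp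
        rw [h4, inv_mul_cancel, heckeMonomial_one] at h2
        rw [h5, mul_inv_cancel, heckeMonomial_one] at h3
        have h6 : IsUnit (heckeMonomial k ϖ t σ (Pi.single 0 1) : IwahoriHecke k (m + 1) F ϖ) :=
          ⟨⟨_, _, h3, h2⟩, rfl⟩
        simp only [U]
        rw [monomialGL_mul, ← heckeMonomial, ← heckeMonomial, ← h1]
        obtain ⟨u, hu⟩ := h6
        rw [← hu, Units.isUnit_mul_units]
      -- Removing the permutation from the length-zero element leaves `t` in one diagonal position.
      -- Conjugation by a transposition then moves it to position `i`.
      have h7 := S.mul_mem hω (hperm σ⁻¹)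
      rw [monomialGL_mul, mul_inv_cancel, ← diagPow_eq_monomialGL] at h7
      have h8 := S.mul_mem (S.mul_mem (hperm (Equiv.swap i (σ 0))) h7)
        (S.inv_mem (hperm (Equiv.swap i (σ 0))))
      rw [perm_conj_diagPow] at h8
      convert h8 using 2
      ext j
      simp only [Pi.zero_apply, add_zero, Pi.single_apply]
      congr 1
      rw [Equiv.Perm.inv_eq_iff_eq]
      apply propext
      rw [Equiv.Perm.inv_eq_iff_eq, Equiv.swap_apply_right]
    let T : AddSubgroup (Fin n → ℤ) :=
      { carrier := {ν | diagPow t ν ∈ S}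
        add_mem' := fun {a b} ha hb => by
          rw [Set.mem_ofPred_eq, diagPow_add]
          exact S.mul_mem ha hb
        zero_mem' := by
          rw [Set.mem_ofPred_eq, diagPow_zero]
          exact S.one_mem
        neg_mem' := fun {a} ha => by
          rw [Set.mem_ofPred_eq, diagPow_neg]
          exact S.inv_mem ha }
    change ν ∈ T
    rw [← Finset.univ_sum_single ν]
    refine sum_mem fun i _ => ?_
    have : (Pi.single i (ν i) : Fin n → ℤ) = ν i • Pi.single i 1 := by
      rw [← Pi.single_smul, smul_eq_mul, mul_one]
    rw [this]
    exact T.zsmul_mem (hsing i) _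
  -- The defining property of `S` is applied with `g = 1`, whose double coset is the unit element.
  have h1 := (hdiag.2 1 0).1 (by
    simp only [U]
    rw [← heckeMonomial, heckeMonomial_one]
    exact isUnit_one)
  simp only [U] at h1
  rwa [← diagPow_eq_monomialGL, diagPow_zero, one_mul, diagPow_eq_monomialGL] at h1

end Units

end

section

open Matrix

/-! ### Extension from dominant weights to all weights, and the Bernstein homomorphism. -/

section Grothendieck

/-- A homomorphism from a generating submonoid of a commutative group extends to the group. -/
theorem exists_extend_units {Λ A : Type*} [AddCommGroup Λ] [Monoid A] (D : AddSubmonoid Λ)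
    (hD : ∀ x : Λ, ∃ a ∈ D, ∃ b ∈ D, x + b = a) (u : Λ → Aˣ)
    (hu : ∀ a ∈ D, ∀ b ∈ D, u (a + b) = u a * u b) :
    ∃ f : Multiplicative Λ →* Aˣ, ∀ a ∈ D, f (Multiplicative.ofAdd a) = u a := by
  have hcomm : ∀ a ∈ D, ∀ b ∈ D, Commute (u a) (u b) := fun a ha b hb => by
    rw [Commute, SemiconjBy, ← hu a ha b hb, ← hu b hb a ha, add_comm]
  choose p hp m hm hpm using hD
  have key : ∀ a ∈ D, ∀ b ∈ D, ∀ c ∈ D, ∀ d ∈ D, a + d = c + b →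
      u a * (u b)⁻¹ = u c * (u d)⁻¹ := fun a ha b hb c hc d hd h => by
    have h1 : u a * u d = u c * u b := by rw [← hu a ha d hd, ← hu c hc b hb, h]
    have h2 : (u b)⁻¹ * (u d)⁻¹ = (u d)⁻¹ * (u b)⁻¹ := ((hcomm b hb d hd).inv_inv).eq
    calc u a * (u b)⁻¹ = u a * u d * ((u d)⁻¹ * (u b)⁻¹) := by group
      _ = u c * u b * ((u b)⁻¹ * (u d)⁻¹) := by rw [h1, h2]
      _ = u c * (u d)⁻¹ := by group
  have h0 : u 0 = 1 := by
    have := hu 0 D.zero_mem 0 D.zero_mem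
    rwa [add_zero, left_eq_mul] at this
  refine ⟨MonoidHom.mk' (fun x => u (p x.toAdd) * (u (m x.toAdd))⁻¹) fun x y => ?_, fun a ha => ?_⟩
  · generalize hx : x.toAdd = x'
    generalize hy : y.toAdd = y'
    rw [toAdd_mul, hx, hy]
    have h1 : u (p x') * (u (m x'))⁻¹ * (u (p y') * (u (m y'))⁻¹) =
        u (p x' + p y') * (u (m x' + m y'))⁻¹ := by
      rw [hu _ (hp _) _ (hp _), add_comm (m x'), hu _ (hm _) _ (hm _), _root_.mul_inv_rev, mul_assoc,
        mul_assoc, ← mul_assoc _ (u (p y')), ← mul_assoc (u (p y')),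
        ((hcomm _ (hp y') _ (hm x')).inv_right).eq]
    rw [h1]
    refine key _ (hp _) _ (hm _) _ (D.add_mem (hp _) (hp _)) _ (D.add_mem (hm _) (hm _)) ?_
    rw [← hpm x', ← hpm y', ← hpm (x' + y')]
    abel
  · change u (p a) * (u (m a))⁻¹ = u a
    rw [key _ (hp a) _ (hm a) a ha 0 D.zero_mem (by rw [add_zero, hpm]), h0, inv_one, mul_one]

end Grothendieck

section Bernstein

variable {n : ℕ}

variable (n) in
/-- The monoid of dominant weights. -/
def dominant : AddSubmonoid (Fin n → ℤ) where
  carrier := {μ | Antitone μ}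
  add_mem' := fun ha hb => ha.add hb
  zero_mem' := antitone_const

variable (n) in
/-- A strictly dominant weight. -/
def stair : Fin n → ℤ := fun i => -(i : ℤ)

theorem stair_apply (i : Fin n) : stair n i = -(i : ℤ) := rfl

theorem smul_stair_apply (N : ℕ) (i : Fin n) : (N • stair n) i = -((N : ℤ) * i) := by
  rw [Pi.smul_apply, nsmul_eq_mul, stair_apply, mul_neg]

theorem smul_stair_antitone (N : ℕ) : Antitone (N • stair n) := fun i j hij => by
  rw [smul_stair_apply, smul_stair_apply]
  have : (i : ℤ) ≤ j := by exact_mod_cast hij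
  nlinarith [Int.natCast_nonneg N]

theorem eventually_antitone_add_stair (μ : Fin n → ℤ) :
    ∀ᶠ N : ℕ in Filter.atTop, Antitone (N • stair n + μ) := by
  have h : ∀ i j : Fin n, ∀ᶠ N : ℕ in Filter.atTop, i < j →
      (N • stair n + μ) j ≤ (N • stair n + μ) i := fun i j => by
    filter_upwards [Filter.eventually_ge_atTop (μ j - μ i).toNat] with N hN hij
    rw [Pi.add_apply, Pi.add_apply, smul_stair_apply, smul_stair_apply]
    have h1 : (i : ℤ) + 1 ≤ j := by exact_mod_cast hij
    have h2 : μ j - μ i ≤ N := (Int.self_le_toNat _).trans (by exact_mod_cast hN)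
    nlinarith [Int.natCast_nonneg N]
  filter_upwards [Filter.eventually_all.2 fun i => Filter.eventually_all.2 (h i)] with N hN i j hij
  rcases hij.lt_or_eq with h1 | rfl
  · exact hN i j h1
  · exact le_rfl

theorem exists_dominant_sub (μ : Fin n → ℤ) :
    ∃ a ∈ dominant n, ∃ b ∈ dominant n, μ + b = a := by
  obtain ⟨N, hN⟩ := (eventually_antitone_add_stair μ).exists
  exact ⟨_, hN, _, smul_stair_antitone N, add_comm _ _⟩

theorem twoRho_add (μ ν : Fin n → ℤ) : twoRho (μ + ν) = twoRho μ + twoRho ν := by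
  simp only [twoRho, ← Finset.sum_add_distrib, Pi.add_apply]
  refine Finset.sum_congr rfl fun i _ => Finset.sum_congr rfl fun j _ => by ring

theorem twoRho_zero : twoRho (0 : Fin n → ℤ) = 0 := by
  simp [twoRho]

variable {k : Type*} [Field k] {O F : Type*} [CommRing O] [Field F] [Algebra O F] {t : Fˣ} {ϖ : O}
  [IsDomain O] [IsDiscreteValuationRing O] [IsFractionRing O F] [Finite (O ⧸ Ideal.span {ϖ})]

/-- The defining property of the Bernstein homomorphism. -/
def IsBernstein (t : Fˣ) (s : k)
    (θ : AddMonoidAlgebra k (Fin n → ℤ) →ₐ[k] IwahoriHecke k n F ϖ) : Prop :=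
  ∀ μ : Fin n → ℤ, Antitone μ → θ (AddMonoidAlgebra.single μ 1) =
    s ^ (-twoRho μ) • HeckeAlgebra.doubleCoset k (iwahori n F ϖ) (diagPow t μ)

/-- The normalised dominant elements are units and multiply like the weights. They therefore extend
to the group `Λ` generated by the dominant monoid, and then linearly to its group algebra. -/
theorem exists_isBernstein (hϖ : Irreducible ϖ) (ht : (t : F) = algebraMap O F ϖ)
    (hq : (Nat.card (O ⧸ Ideal.span {ϖ}) : k) ≠ 0) {s : k} (hs : s ≠ 0) :
    ∃ θ : AddMonoidAlgebra k (Fin n → ℤ) →ₐ[k] IwahoriHecke k n F ϖ, IsBernstein t s θ := by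
  have hu : ∀ μ : Fin n → ℤ, IsUnit (s ^ (-twoRho μ) •
      (heckeMonomial k ϖ t 1 μ : IwahoriHecke k n F ϖ)) := fun μ => by
    rw [Algebra.smul_def]
    exact ((isUnit_iff_ne_zero.2 (zpow_ne_zero _ hs)).map (algebraMap k _)).mul
      (isUnit_heckeMonomial k hϖ ht (isUnit_iff_ne_zero.2 hq) μ)
  choose u hu using hu
  obtain ⟨f, hf⟩ := exists_extend_units (dominant n) exists_dominant_sub u fun a ha b hb => by
    apply Units.ext
    rw [Units.val_mul, hu, hu, hu, smul_mul_smul_comm, heckeMonomial_dominant_add k hϖ ht ha hb,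
      twoRho_add, neg_add, zpow_add₀ hs]
  refine ⟨AddMonoidAlgebra.lift k _ (Fin n → ℤ) ((Units.coeHom _).comp f), fun μ hμ => ?_⟩
  rw [AddMonoidAlgebra.lift_single, one_smul, MonoidHom.comp_apply, hf μ hμ, Units.coeHom_apply, hu,
    heckeMonomial, diagPow_eq_monomialGL]

end Bernstein

end

section

open Matrix

/-! ### Indices of congruence subgroups in the integral unipotent group. -/

section Counting

variable {n : ℕ} {O F : Type*} [CommRing O] [Field F] [Algebra O F] {t : Fˣ} {ϖ : O}
  [IsDomain O] [IsDiscreteValuationRing O] [IsFractionRing O F]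

variable (n O F) in
/-- The integral unipotent upper triangular matrices. -/
abbrev unipotentInt : Subgroup (GL (Fin n) F) := unipotent n F ⊓ maxCompact n O F

theorem unipotentInt_le_iwahori (ht : (t : F) = algebraMap O F ϖ) :
    unipotentInt n O F ≤ iwahori n F ϖ := fun _ hu => mem_iwahori_of_unipotent ht hu.1 hu.2

variable (n O) in
/-- The unipotent matrices congruent to `1` modulo `t^M`. -/
def unipotentCongr (ht : (t : F) = algebraMap O F ϖ) (M : ℕ) : Subgroup (unipotentInt n O F) where
  carrier := {u | ∀ i j, (u : GL (Fin n) F) i j - (1 : Matrix (Fin n) (Fin n) F) i j ∈ fil O t M}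
  mul_mem' := by
    rintro ⟨a, ha⟩ ⟨b, hb⟩ h1 h2 i j
    have e : (a * b) i j - (1 : Matrix (Fin n) (Fin n) F) i j =
        ∑ l, a i l * (b l j - (1 : Matrix (Fin n) (Fin n) F) l j) +
          (a i j - (1 : Matrix (Fin n) (Fin n) F) i j) := by
      have e2 : ∑ l, a i l * (1 : Matrix (Fin n) (Fin n) F) l j = a i j := by
        simp [Matrix.one_apply]
      simp only [mul_sub, Finset.sum_sub_distrib]
      rw [GL_mul_apply, e2]
      ring
    change (a * b) i j - _ ∈ _
    rw [e]
    exact add_mem (sum_mul_mem_fil ht (a := fun _ => 0) (b := fun _ => M)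
      (fun l => ((mem_maxCompact_iff (t := t)).1 ha.2).1 i l) (fun l => h2 l j) (by simp)) (h1 i j)
  one_mem' i j := by
    change (1 : GL (Fin n) F) i j - _ ∈ _
    rw [Units.val_one, sub_self]
    exact zero_mem _
  inv_mem' := by
    rintro ⟨a, ha⟩ h1 i j
    have := inv_mul_sub_one_mem_fil ht (m := M) (a := a) (b := 1) ha.2
      (fun i j => by rw [Units.val_one]; exact h1 i j) i j
    rwa [mul_one] at this

theorem inv_mul_mem_unipotentCongr {ht : (t : F) = algebraMap O F ϖ} {M : ℕ}
    {u v : unipotentInt n O F} : u⁻¹ * v ∈ unipotentCongr n O ht M ↔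
      ∀ i j, (u : GL (Fin n) F) i j - (v : GL (Fin n) F) i j ∈ fil O t M := by
  constructor
  · intro h i j
    have e : (u : GL (Fin n) F) i j - (v : GL (Fin n) F) i j = ∑ l, (u : GL (Fin n) F) i l *
        -(((u⁻¹ * v : unipotentInt n O F) : GL (Fin n) F) l j -
          (1 : Matrix (Fin n) (Fin n) F) l j) := by
      have h1 : (v : GL (Fin n) F) i j = ((u : GL (Fin n) F) *
          ((u⁻¹ * v : unipotentInt n O F) : GL (Fin n) F)) i j := by
        rw [Subgroup.coe_mul, Subgroup.coe_inv, mul_inv_cancel_left]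
      have h2 : (u : GL (Fin n) F) i j = ((u : GL (Fin n) F) * 1) i j := by rw [mul_one]
      rw [h1, h2, GL_mul_apply, GL_mul_apply, ← Finset.sum_sub_distrib]
      refine Finset.sum_congr rfl fun l _ => ?_
      rw [Units.val_one]
      ring
    rw [e]
    exact sum_mul_mem_fil ht (a := fun _ => 0) (b := fun _ => M)
      (fun l => ((mem_maxCompact_iff (t := t)).1 u.2.2).1 i l) (fun l => neg_mem (h l j)) (by simp)
  · intro h
    exact inv_mul_sub_one_mem_fil ht u.2.2 h

instance (ht : (t : F) = algebraMap O F ϖ) (M : ℕ) : (unipotentCongr n O ht M).Normal := by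
  constructor
  intro x hx g
  have h1 : x⁻¹ * 1 ∈ unipotentCongr n O ht M := by
    rw [mul_one]
    exact inv_mem hx
  rw [inv_mul_mem_unipotentCongr] at h1
  have h2 : (g * x * g⁻¹)⁻¹ * 1 ∈ unipotentCongr n O ht M := by
    rw [inv_mul_mem_unipotentCongr]
    intro i j
    have e : ((g * x * g⁻¹ : unipotentInt n O F) : GL (Fin n) F) i j -
        ((1 : unipotentInt n O F) : GL (Fin n) F) i j = ∑ l, (g : GL (Fin n) F) i l *
        ∑ m, ((x : GL (Fin n) F) l m - ((1 : unipotentInt n O F) : GL (Fin n) F) l m) *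
          (g⁻¹ : GL (Fin n) F) m j := by
      have h3 : ((1 : unipotentInt n O F) : GL (Fin n) F) i j =
          ((g : GL (Fin n) F) * (((1 : unipotentInt n O F) : GL (Fin n) F) * (g : GL (Fin n) F)⁻¹)) i j := by
        rw [Subgroup.coe_one, one_mul, mul_inv_cancel]
      rw [h3, Subgroup.coe_mul, Subgroup.coe_mul, Subgroup.coe_inv]
      rw [mul_assoc, GL_mul_apply, GL_mul_apply, ← Finset.sum_sub_distrib]
      refine Finset.sum_congr rfl fun l _ => ?_
      rw [GL_mul_apply, GL_mul_apply, ← mul_sub, ← Finset.sum_sub_distrib]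
      congr 1
      refine Finset.sum_congr rfl fun m _ => ?_
      ring
    rw [e]
    have hg := (mem_maxCompact_iff (t := t)).1 g.2.2
    exact sum_mul_mem_fil ht (a := fun _ => 0) (b := fun _ => M) (fun l => hg.1 i l)
      (fun l => sum_mul_mem_fil ht (a := fun _ => M) (b := fun _ => 0) (fun m => h1 l m)
        (fun m => hg.2 m j) (c := M) (by simp)) (by simp)
  rw [mul_one] at h2
  simpa using inv_mem h2

/-- The unipotent matrix with prescribed entries above the diagonal. -/
def upperGL (x : Fin n → Fin n → F) : GL (Fin n) F :=
  GeneralLinearGroup.mk'' (Matrix.of fun i j => if i = j then 1 else if i < j then x i j else 0) (by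
    rw [Matrix.det_of_isUpperTriangular]
    · simp
    · intro i j hij
      simp only [id] at hij
      rw [Matrix.of_apply, if_neg hij.ne', if_neg (not_lt_of_gt hij)])

theorem upperGL_apply (x : Fin n → Fin n → F) (i j : Fin n) :
    upperGL x i j = if i = j then 1 else if i < j then x i j else 0 := rfl

theorem upperGL_mem_unipotent (x : Fin n → Fin n → F) : upperGL x ∈ unipotent n F :=
  mem_unipotent_iff.2 ⟨fun i j hij => by
    rw [upperGL_apply, if_neg hij.ne', if_neg (not_lt_of_gt hij)], fun i => by
    rw [upperGL_apply, if_pos rfl]⟩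

theorem mem_maxCompact_of_unipotent {u : GL (Fin n) F} (hu : u ∈ unipotent n F)
    (h : ∀ i j, i < j → u i j ∈ fil O t 0) : u ∈ maxCompact n O F := by
  refine mem_maxCompact_of_det (t := t) (fun i j => ?_) ⟨1, ?_⟩
  · rcases lt_trichotomy i j with h1 | h1 | h1
    · exact h i j h1
    · rw [← h1, hu.2 i]
      exact one_mem_fil
    · rw [hu.1 h1]
      exact zero_mem _
  · rw [Matrix.det_of_isUpperTriangular hu.1, Finset.prod_congr rfl fun i _ => hu.2 i]
    simp

/-- The index of a congruence subgroup in a subgroup of `N(O)` defined by divisibility of entries. -/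
theorem relIndex_unipotentCongr (hϖ : Irreducible ϖ) (ht : (t : F) = algebraMap O F ϖ) (M : ℕ)
    (f : Fin n → Fin n → ℕ) (hf : ∀ i j, f i j ≤ M) (T : Subgroup (unipotentInt n O F))
    (hT : ∀ u, u ∈ T ↔ ∀ i j, i < j → (u : GL (Fin n) F) i j ∈ fil O t (f i j)) :
    (unipotentCongr n O ht M).relIndex T =
      ∏ i, ∏ j ∈ Finset.Ioi i, Nat.card (O ⧸ Ideal.span {ϖ}) ^ (M - f i j) := by
  have hex : ∀ (u : T) (i j : Fin n), ∃ a : O, i < j →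
      algebraMap O F (ϖ ^ f i j * a) = ((u : unipotentInt n O F) : GL (Fin n) F) i j := by
    intro u i j
    by_cases hij : i < j
    · obtain ⟨a, ha⟩ := (mem_fil_natCast ht).1 ((hT u).1 u.2 i j hij)
      exact ⟨a, fun _ => ha⟩
    · exact ⟨0, fun h => absurd h hij⟩
  choose a ha using hex
  have hsub : ∀ (i j : Fin n) (x y : O), algebraMap O F (ϖ ^ f i j * x) -
      algebraMap O F (ϖ ^ f i j * y) ∈ fil O t M ↔
      Ideal.Quotient.mk (Ideal.span {ϖ ^ (M - f i j)}) x = Ideal.Quotient.mk _ y := by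
    intro i j x y
    rw [Ideal.Quotient.eq, Ideal.mem_span_singleton, ← map_sub, ← mul_sub, mem_fil_natCast ht]
    have e : ϖ ^ M = ϖ ^ f i j * ϖ ^ (M - f i j) := by rw [← pow_add, Nat.add_sub_cancel' (hf i j)]
    constructor
    · rintro ⟨c, hc⟩
      have := IsFractionRing.injective O F hc
      rw [e, mul_assoc] at this
      exact ⟨c, (mul_left_cancel₀ (pow_ne_zero _ hϖ.ne_zero) this).symm⟩
    · rintro ⟨c, hc⟩
      exact ⟨c, by rw [hc, e, mul_assoc]⟩
  -- Each entry above the diagonal, divided by its guaranteed power of `t`, matters only modulo the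
  -- remaining power `t^(M - f)`. These residues are independent and classify the cosets.
  let φ : T → (p : Σ i : Fin n, Finset.Ioi i) → O ⧸ Ideal.span {ϖ ^ (M - f p.1 p.2)} :=
    fun u p => Ideal.Quotient.mk _ (a u p.1 p.2)
  have hφ : ∀ u v : T, φ u = φ v ↔ u⁻¹ * v ∈ (unipotentCongr n O ht M).subgroupOf T := by
    intro u v
    rw [Subgroup.mem_subgroupOf, Subgroup.coe_mul, Subgroup.coe_inv, inv_mul_mem_unipotentCongr]
    constructor
    · intro h i j
      rcases lt_trichotomy i j with h1 | h1 | h1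
      · rw [← ha u i j h1, ← ha v i j h1, hsub]
        exact congrFun h ⟨i, j, Finset.mem_Ioi.2 h1⟩
      · rw [← h1]
        have h2 := (u : unipotentInt n O F).2.1.2 i
        have h3 := (v : unipotentInt n O F).2.1.2 i
        rw [h2, h3, sub_self]
        exact zero_mem _
      · have h2 := (u : unipotentInt n O F).2.1.1 h1
        have h3 := (v : unipotentInt n O F).2.1.1 h1
        rw [h2, h3, sub_self]
        exact zero_mem _
    · intro h
      funext p
      have h1 := Finset.mem_Ioi.1 p.2.2
      exact (hsub _ _ _ _).1 (by rw [ha u _ _ h1, ha v _ _ h1]; exact h _ _)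
  have hsurj : Function.Surjective φ := by
    intro y
    let x : Fin n → Fin n → F := fun i j =>
      if h : i < j then algebraMap O F (ϖ ^ f i j * Quotient.out (y ⟨i, j, Finset.mem_Ioi.2 h⟩))
      else 0
    have hx : ∀ i j, i < j → upperGL x i j ∈ fil O t (f i j) := fun i j hij => by
      rw [upperGL_apply, if_neg hij.ne, if_pos hij]
      simp only [x]
      rw [dif_pos hij]
      exact (mem_fil_natCast ht).2 ⟨_, rfl⟩
    have hu : upperGL x ∈ unipotentInt n O F := ⟨upperGL_mem_unipotent x,
      mem_maxCompact_of_unipotent (t := t) (upperGL_mem_unipotent x) fun i j hij =>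
        mem_fil_of_le ht (Int.natCast_nonneg _) (hx i j hij)⟩
    refine ⟨⟨⟨_, hu⟩, (hT _).2 hx⟩, ?_⟩
    funext p
    have h1 := Finset.mem_Ioi.1 p.2.2
    have h2 := ha ⟨⟨_, hu⟩, (hT _).2 hx⟩ p.1 p.2 h1
    change _ = upperGL x _ _ at h2
    rw [upperGL_apply, if_neg h1.ne, if_pos h1] at h2
    simp only [x] at h2
    rw [dif_pos h1] at h2
    have h3 := mul_left_cancel₀ (pow_ne_zero _ hϖ.ne_zero) (IsFractionRing.injective O F h2)
    change Ideal.Quotient.mk _ (a _ _ _) = _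
    rw [h3]
    exact Ideal.Quotient.mk_out _
  have e : (T ⧸ (unipotentCongr n O ht M).subgroupOf T) ≃
      ((p : Σ i : Fin n, Finset.Ioi i) → O ⧸ Ideal.span {ϖ ^ (M - f p.1 p.2)}) := by
    refine Equiv.ofBijective (fun x => Quotient.liftOn' x φ fun u v huv =>
      (hφ u v).2 (QuotientGroup.leftRel_apply.1 huv)) ⟨?_, ?_⟩
    · intro x y
      induction x using QuotientGroup.induction_on with
      | H u =>
        induction y using QuotientGroup.induction_on with
        | H v => exact fun h => QuotientGroup.eq.2 ((hφ u v).1 h)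
    · intro y
      obtain ⟨u, rfl⟩ := hsurj y
      exact ⟨(u : T ⧸ _), rfl⟩
  change Nat.card (T ⧸ (unipotentCongr n O ht M).subgroupOf T) = _
  rw [Nat.card_congr e, Nat.card_pi, Fintype.prod_sigma]
  refine Finset.prod_congr rfl fun i _ => ?_
  exact (Finset.prod_congr rfl fun j _ => card_quotient_pow hϖ _).trans
    (Finset.prod_coe_sort (Finset.Ioi i) fun j => _ ^ (M - f i j))

variable (ϖ) in
/-- The subgroup `N(O) ∩ t^ν I t^{-ν}` of `N(O)`. -/
def unipotentConj (t : Fˣ) (ν : Fin n → ℤ) : Subgroup (unipotentInt n O F) :=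
  ((iwahori n F ϖ).map (MulAut.conj (diagPow t ν)).toMonoidHom).subgroupOf (unipotentInt n O F)

theorem mem_unipotentConj {ν : Fin n → ℤ} {u : unipotentInt n O F} :
    u ∈ unipotentConj ϖ t ν ↔ (diagPow t ν)⁻¹ * u * diagPow t ν ∈ iwahori n F ϖ := by
  rw [unipotentConj, Subgroup.mem_subgroupOf]
  constructor
  · rintro ⟨x, hx, h⟩
    rw [← h]
    convert hx using 1
    simp [mul_assoc]
  · intro h
    exact ⟨_, h, by simp [mul_assoc]⟩

theorem mem_unipotentConj_iff (ht : (t : F) = algebraMap O F ϖ) {ν : Fin n → ℤ}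
    {u : unipotentInt n O F} :
    u ∈ unipotentConj ϖ t ν ↔ ∀ i j, i < j → (u : GL (Fin n) F) i j ∈ fil O t (ν i - ν j) := by
  rw [mem_unipotentConj]
  have e : ∀ i j, ((diagPow t ν)⁻¹ * (u : GL (Fin n) F) * diagPow t ν) i j =
      ((t ^ (ν j - ν i) : Fˣ) : F) * (u : GL (Fin n) F) i j := fun i j => by
    rw [diagPow_eq_monomialGL, conj_monomialGL_apply]
    rfl
  have hun : (diagPow t ν)⁻¹ * (u : GL (Fin n) F) * diagPow t ν ∈ unipotent n F := by
    refine mem_unipotent_iff.2 ⟨fun i j hij => ?_, fun i => ?_⟩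
    · rw [e, u.2.1.1 hij, mul_zero]
    · rw [e, u.2.1.2 i, sub_self, zpow_zero, Units.val_one, mul_one]
  have hfil : ∀ i j, ((t ^ (ν j - ν i) : Fˣ) : F) * (u : GL (Fin n) F) i j ∈ fil O t 0 ↔
      (u : GL (Fin n) F) i j ∈ fil O t (ν i - ν j) := fun i j => by
    rw [← zpow_mul_mem_fil (O := O) (m := ν j - ν i) (a := ν i - ν j)]
    congr! 2
    ring
  constructor
  · intro h i j hij
    have := ((mem_iwahori_iff ht).1 h).1 i j
    rwa [e, iwLevel_of_lt hij, hfil] at this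
  · intro h
    refine mem_iwahori_of_unipotent ht hun (mem_maxCompact_of_unipotent (t := t) hun fun i j hij => ?_)
    rw [e, hfil]
    exact h i j hij

theorem unipotentCongr_le_conj (ht : (t : F) = algebraMap O F ϖ) {ν : Fin n → ℤ} {M : ℕ}
    (hM : ∀ i j, ν i - ν j ≤ M) : unipotentCongr n O ht M ≤ unipotentConj ϖ t ν := fun u hu => by
  rw [mem_unipotentConj_iff ht]
  intro i j hij
  have := hu i j
  rw [Matrix.one_apply_ne hij.ne, sub_zero] at this
  exact mem_fil_of_le ht (hM i j) this

theorem finite_quotient_unipotentCongr [Finite (O ⧸ Ideal.span {ϖ})] (hϖ : Irreducible ϖ)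
    (ht : (t : F) = algebraMap O F ϖ) (M : ℕ) :
    Finite (unipotentInt n O F ⧸ unipotentCongr n O ht M) := by
  apply Nat.finite_of_card_ne_zero
  change (unipotentCongr n O ht M).index ≠ 0
  rw [← Subgroup.relIndex_top_right, relIndex_unipotentCongr hϖ ht M (fun _ _ => 0) (by simp) ⊤]
  · exact Finset.prod_ne_zero_iff.2 fun i _ => Finset.prod_ne_zero_iff.2 fun j _ =>
      pow_ne_zero _ Nat.card_pos.ne'
  · intro u
    simp only [Subgroup.mem_top, true_iff]
    exact fun i j _ => ((mem_maxCompact_iff (t := t)).1 u.2.2).1 i j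

theorem index_unipotentCongr (hϖ : Irreducible ϖ) (ht : (t : F) = algebraMap O F ϖ) (M : ℕ) :
    ∃ m : ℕ, (unipotentCongr n O ht M).index = Nat.card (O ⧸ Ideal.span {ϖ}) ^ m := by
  rw [← Subgroup.relIndex_top_right, relIndex_unipotentCongr hϖ ht M (fun _ _ => 0) (by simp) ⊤]
  · simp only [Finset.prod_pow_eq_pow_sum]
    exact ⟨_, rfl⟩
  · intro u
    simp only [Subgroup.mem_top, true_iff]
    exact fun i j _ => ((mem_maxCompact_iff (t := t)).1 u.2.2).1 i j

/-- `[N(O) : t^ν N(O) t^{-ν}] = q^{⟨2ρ, ν⟩}` for dominant `ν`. -/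
theorem index_eq_relIndex_mul (hϖ : Irreducible ϖ) (ht : (t : F) = algebraMap O F ϖ) {M : ℕ}
    {ν : Fin n → ℤ} (hν : Antitone ν) (hM : ∀ i j, ν i - ν j ≤ M) :
    ∃ m : ℕ, (m : ℤ) = twoRho ν ∧ (unipotentCongr n O ht M).index =
      (unipotentCongr n O ht M).relIndex (unipotentConj ϖ t ν) *
        Nat.card (O ⧸ Ideal.span {ϖ}) ^ m := by
  have hc : ∀ i j, i < j → ((ν i - ν j).toNat : ℤ) = ν i - ν j := fun i j hij =>
    Int.toNat_of_nonneg (sub_nonneg.2 (hν hij.le))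
  refine ⟨∑ i, ∑ j ∈ Finset.Ioi i, (ν i - ν j).toNat, ?_, ?_⟩
  · push_cast
    exact Finset.sum_congr rfl fun i _ => Finset.sum_congr rfl fun j hj =>
      by rw [← hc i j (Finset.mem_Ioi.1 hj)]; simp
  · rw [← Subgroup.relIndex_top_right, relIndex_unipotentCongr hϖ ht M (fun _ _ => 0) (by simp) ⊤,
      relIndex_unipotentCongr hϖ ht M (fun i j => (ν i - ν j).toNat)
        (fun i j => Int.toNat_le.2 (hM i j)) (unipotentConj ϖ t ν)]
    · simp only [Finset.prod_pow_eq_pow_sum]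
      rw [← pow_add, ← Finset.sum_add_distrib]
      congr 1
      refine Finset.sum_congr rfl fun i _ => ?_
      rw [← Finset.sum_add_distrib]
      refine Finset.sum_congr rfl fun j _ => ?_
      rw [tsub_zero, Nat.sub_add_cancel (Int.toNat_le.2 (hM i j))]
    · intro u
      rw [mem_unipotentConj_iff ht]
      exact forall_congr' fun i => forall_congr' fun j => imp_congr_right fun hij => by
        rw [hc i j hij]
    · intro u
      simp only [Subgroup.mem_top, true_iff]
      exact fun i j _ => ((mem_maxCompact_iff (t := t)).1 u.2.2).1 i j

end Counting

end

section

open Matrix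

/-! ### The Iwasawa decomposition. -/

section Iwasawa

variable {n : ℕ} {O F : Type*} [CommRing O] [Field F] [Algebra O F] {t : Fˣ} {ϖ : O}
  [IsDomain O] [IsDiscreteValuationRing O] [IsFractionRing O F]

/-- The diagonal matrix with given invertible entries. -/
def diagGL (d : Fin n → Fˣ) : GL (Fin n) F :=
  Units.map (Matrix.diagonalRingHom (Fin n) F).toMonoidHom (MulEquiv.piUnits.symm d)

theorem diagGL_apply (d : Fin n → Fˣ) (i j : Fin n) :
    diagGL d i j = if i = j then (d i : F) else 0 := by
  change Matrix.diagonal (fun i => (d i : F)) i j = _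
  rw [Matrix.diagonal_apply]

theorem diagGL_inv (d : Fin n → Fˣ) : (diagGL d)⁻¹ = diagGL d⁻¹ := by
  rw [diagGL, diagGL, ← map_inv]
  rfl

theorem mul_diagGL_apply (g : GL (Fin n) F) (d : Fin n → Fˣ) (i j : Fin n) :
    (g * diagGL d) i j = g i j * d j := by
  rw [GL_mul_apply]
  simp [diagGL_apply]

theorem diagGL_mem_iwahori (ht : (t : F) = algebraMap O F ϖ) (d : Fin n → Oˣ) :
    diagGL (fun i => Units.map (algebraMap O F).toMonoidHom (d i)) ∈ iwahori n F ϖ := by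
  have h : ∀ (e : Fin n → Oˣ) (i j : Fin n),
      diagGL (fun i => Units.map (algebraMap O F).toMonoidHom (e i)) i j ∈
        fil O t (iwLevel i j) := fun e i j => by
    rw [diagGL_apply]
    split_ifs with hij
    · rw [hij, iwLevel_self]
      exact algebraMap_mem_fil _
    · exact zero_mem _
  refine (mem_iwahori_iff ht).2 ⟨h d, ?_⟩
  rw [diagGL_inv]
  have : (fun i => Units.map (algebraMap O F).toMonoidHom (d i))⁻¹ =
      fun i => Units.map (algebraMap O F).toMonoidHom ((d⁻¹) i) := by
    funext i
    simp
  rw [this]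
  exact h _

/-- A matrix with this vanishing pattern is singular. -/
theorem exists_ne_zero_of_triangular_below {g : GL (Fin n) F} {r : Fin n}
    (h : ∀ i j, r < i → j < i → g i j = 0) : ∃ j ≤ r, g r j ≠ 0 := by
  by_contra! hc
  have hdet : (g : Matrix (Fin n) (Fin n) F).det = 0 := by
    rw [Matrix.det_apply]
    refine Finset.sum_eq_zero fun σ _ => ?_
    have : ∃ i, g (σ i) i = 0 := by
      by_contra! hn
      -- Pigeonhole: a nonzero term of the determinant would inject the rows from `r` on into the
      -- columns strictly after `r`, and there are too few of those.
      have h1 : ∀ i ∈ Finset.Ici r, σ⁻¹ i ∈ Finset.Ioi r := fun i hi => by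
        rw [Finset.mem_Ici] at hi
        rw [Finset.mem_Ioi]
        by_contra! hle
        have h2 := hn (σ⁻¹ i)
        rw [perm_apply_inv] at h2
        rcases hi.lt_or_eq with h3 | h3
        · exact h2 (h _ _ h3 (hle.trans_lt h3))
        · rw [← h3] at h2 hle
          exact h2 (hc _ hle)
      have h2 := Finset.card_le_card_of_injOn (fun i => σ⁻¹ i) h1 (σ⁻¹.injective.injOn)
      have h3 : (Finset.Ioi r).card < (Finset.Ici r).card :=
        Finset.card_lt_card ⟨fun x hx => Finset.mem_Ici.2 (Finset.mem_Ioi.1 hx).le, fun hs =>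
          absurd (Finset.mem_Ioi.1 (hs (Finset.mem_Ici.2 le_rfl))) (lt_irrefl _)⟩
      omega
    obtain ⟨i, hi⟩ := this
    have hz : ∏ i, (g : Matrix (Fin n) (Fin n) F) (σ i) i = 0 :=
      Finset.prod_eq_zero (Finset.mem_univ i) hi
    rw [hz, smul_zero]
  exact (Matrix.isUnits_det_units g).ne_zero hdet

/-- Conjugation by the order-reversing permutation makes this lower triangular matrix upper
triangular and integral, hence an element of `I`. Only `I` and the permutation matrices are used, so
`S` need not be known to contain `K`. -/
theorem rowGL_mem_of_perm {S : Subgroup (GL (Fin n) F)} (ht : (t : F) = algebraMap O F ϖ)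
    (hI : iwahori n F ϖ ≤ S) (hp : ∀ π, monomialGL t π 0 ∈ S) (r : Fin n) {c : Fin n → F}
    (hc : ∀ i, c i ∈ fil O t 0) (hr : ∀ i, r ≤ i → c i = 0) : rowGL r c ∈ S := by
  have key : ∀ (e : Fin n → F), (∀ i, e i ∈ fil O t 0) → (∀ i, r ≤ i → e i = 0) → ∀ i j,
      rowGL r e (Fin.revPerm i) (Fin.revPerm j) ∈ fil O t (iwLevel i j + (0 : Fin n → ℤ) i -
        (0 : Fin n → ℤ) j) := fun e he hr i j => by
    rw [Pi.zero_apply, Pi.zero_apply, add_zero, sub_zero, rowGL_apply, colGL_apply]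
    rcases lt_trichotomy i j with h | rfl | h
    · rw [iwLevel_of_lt h, if_neg (by simpa using h.ne'), zero_add]
      split_ifs
      · exact he _
      · exact zero_mem _
    · rw [iwLevel_self, if_pos rfl, if_neg (by tauto), add_zero]
      exact one_mem_fil
    · rw [if_neg (by simpa using h.ne), zero_add]
      split_ifs with h1
      · rw [hr _ (by rw [← h1.1, Fin.revPerm_apply, Fin.revPerm_apply, Fin.rev_le_rev]; exact h.le)]
        exact zero_mem _
      · exact zero_mem _
  have h1 : (monomialGL t Fin.revPerm 0)⁻¹ * rowGL r c * monomialGL t Fin.revPerm 0 ∈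
      iwahori n F ϖ := by
    rw [conj_mem_iwahori_iff ht, rowGL_inv]
    exact ⟨key c hc hr, key (-c) (fun i => neg_mem (hc i)) fun i hi => by
      rw [Pi.neg_apply, hr i hi, neg_zero]⟩
  have h2 := S.mul_mem (S.mul_mem (hp Fin.revPerm) (hI h1)) (S.inv_mem (hp Fin.revPerm))
  convert h2 using 1
  group

/-- Reduction to a triangular matrix by column operations in `GL_n(O)`. -/
theorem exists_mul_triangular (hϖ : Irreducible ϖ) (ht : (t : F) = algebraMap O F ϖ)
    {S : Subgroup (GL (Fin n) F)} (hI : iwahori n F ϖ ≤ S) (hp : ∀ π, monomialGL t π 0 ∈ S)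
    (g : GL (Fin n) F) : ∃ κ ∈ S, ∀ i j, j < i → (g * κ) i j = 0 := by
  -- Rows are cleared from the bottom, `m` of them so far. Keeping `S` general serves twice: `S = K`
  -- gives the Iwasawa decomposition, and smaller `S` give the generation of `K` by `I` and the
  -- simple reflections.
  suffices h : ∀ m : ℕ, ∃ κ ∈ S, ∀ i j : Fin n, n ≤ i + m → j < i → (g * κ) i j = 0 by
    obtain ⟨κ, hκ, h⟩ := h n
    exact ⟨κ, hκ, fun i j hij => h i j (by omega) hij⟩
  intro m
  induction m with
  | zero => exact ⟨1, S.one_mem, fun i j hi => by omega⟩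
  | succ m ih =>
    obtain ⟨κ, hκ, h⟩ := ih
    by_cases hm : n ≤ m
    · exact ⟨κ, hκ, fun i j hi => h i j (by omega)⟩
    let r : Fin n := ⟨n - m - 1, by omega⟩
    have hr : (r : ℕ) = n - m - 1 := rfl
    obtain ⟨j₀, hj₀, hne₀⟩ := exists_ne_zero_of_triangular_below (g := g * κ) (r := r)
      fun i j hi hj => h i j (by have : (r : ℕ) < i := hi; omega) hj
    have hval : ∀ j, ∃ v : ℤ, (g * κ) r j ≠ 0 → ∃ u : Oˣ,
        (g * κ) r j = algebraMap O F u * ((t ^ v : Fˣ) : F) := fun j => by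
      by_cases h0 : (g * κ) r j = 0
      · exact ⟨0, fun h => absurd h0 h⟩
      · obtain ⟨u, v, e⟩ := exists_eq_unit_mul_zpow hϖ ht h0
        exact ⟨v, fun _ => ⟨u, e⟩⟩
    choose v hv using hval
    classical
    -- The pivot is an entry of least valuation in the row, so that all the quotients needed to
    -- clear the row are integral.
    obtain ⟨l, hl, hmin⟩ := Finset.exists_min_image
      (Finset.univ.filter fun j => j ≤ r ∧ (g * κ) r j ≠ 0) v
      ⟨j₀, Finset.mem_filter.2 ⟨Finset.mem_univ _, hj₀, hne₀⟩⟩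
    obtain ⟨-, hlr, hl0⟩ := Finset.mem_filter.1 hl
    have hdiv : ∀ j, j ≤ r → (g * κ) r j / (g * κ) r l ∈ fil O t 0 := fun j hj => by
      by_cases h0 : (g * κ) r j = 0
      · rw [h0, zero_div]
        exact zero_mem _
      · obtain ⟨u, hu⟩ := hv j h0
        obtain ⟨w, hw⟩ := hv l hl0
        have hle := hmin j (Finset.mem_filter.2 ⟨Finset.mem_univ _, hj, h0⟩)
        rw [hu, hw, mul_div_mul_comm]
        refine mem_fil_of_le ht (a := 0) (b := 0 + (v j - v l)) (by omega) (mul_mem_fil ?_ ?_)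
        · rw [div_eq_mul_inv, ← algebraMap_inv_unit, ← map_mul]
          exact algebraMap_mem_fil _
        · rw [← Units.val_div_eq_div_val, div_eq_mul_inv, ← _root_.zpow_sub]
          exact zpow_mem_fil _
    let σ := Equiv.swap l r
    let c : Fin n → F := fun j => if j < r then -((g * κ) r (σ j) / (g * κ) r l) else 0
    have hσ : ∀ j, j ≤ r → σ j ≤ r := fun j hj => by
      rcases swap_apply_cases (a := l) (b := r) j with h1 | h1 | h1
      · exact h1.2.le
      · exact h1.2.le.trans hlr
      · exact h1.2.2.le.trans hj
    have hc : ∀ j, c j ∈ fil O t 0 := fun j => by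
      simp only [c]
      split_ifs with hj
      · exact neg_mem (hdiv _ (hσ j hj.le))
      · exact zero_mem _
    refine ⟨κ * monomialGL t σ 0 * rowGL r c, S.mul_mem (S.mul_mem hκ (hp σ))
      (rowGL_mem_of_perm ht hI hp r hc fun i hi => if_neg (not_lt_of_ge hi)), fun i j hi hj => ?_⟩
    have hσr : σ r = l := Equiv.swap_apply_right l r
    rw [← mul_assoc, ← mul_assoc, mul_rowGL_apply, mul_monomialGL_apply, mul_monomialGL_apply]
    simp only [Pi.zero_apply, zpow_zero, Units.val_one, mul_one]
    rw [hσr]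
    by_cases hir : i = r
    · rw [hir] at hj ⊢
      rw [if_neg hj.ne]
      simp only [c]
      rw [if_pos hj]
      field_simp
      ring
    · have hri : r < i := by
        rw [Fin.lt_def]
        have : (i : ℕ) ≠ r := fun h => hir (Fin.ext h)
        omega
      have hin : n ≤ i + m := by
        have : (r : ℕ) < i := hri
        omega
      rw [h i l hin (hlr.trans_lt hri), zero_mul, ite_self, add_zero]
      refine h i (σ j) hin ?_
      rcases swap_apply_cases (a := l) (b := r) j with h1 | h1 | h1
      · rw [h1.2]; exact hri
      · rw [h1.2]; exact hlr.trans_lt hri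
      · rw [h1.2.2]; exact hj

/-- The Iwasawa decomposition. -/
theorem iwasawa (hϖ : Irreducible ϖ) (ht : (t : F) = algebraMap O F ϖ) (g : GL (Fin n) F) :
    ∃ u ∈ unipotent n F, ∃ μ, ∃ κ ∈ maxCompact n O F, g = u * diagPow t μ * κ := by
  obtain ⟨κ, hκ, h⟩ := exists_mul_triangular hϖ ht (S := maxCompact n O F)
    iwahori_le_maxCompact perm_mem_maxCompact g
  have hdet : (g * κ : GL (Fin n) F).val.det ≠ 0 := (Matrix.isUnits_det_units _).ne_zero
  rw [Matrix.det_of_isUpperTriangular fun i j hij => h i j hij, Finset.prod_ne_zero_iff] at hdet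
  choose d μ hd using fun i => exists_eq_unit_mul_zpow hϖ ht (hdet i (Finset.mem_univ i))
  let D : GL (Fin n) F := diagGL (fun i => Units.map (algebraMap O F).toMonoidHom (d i))
  have hD : D ∈ maxCompact n O F := iwahori_le_maxCompact (diagGL_mem_iwahori ht d)
  have e : ∀ i j, (g * κ * D⁻¹ * diagPow t (-μ)) i j =
      (g * κ) i j * (algebraMap O F (d j))⁻¹ * ((t ^ (-μ j) : Fˣ) : F) := fun i j => by
    rw [diagPow_eq_monomialGL, mul_monomialGL_apply, diagGL_inv, mul_diagGL_apply]
    simp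
  refine ⟨g * κ * D⁻¹ * diagPow t (-μ), mem_unipotent_iff.2 ⟨fun i j hij => ?_, fun i => ?_⟩, μ,
    D * κ⁻¹, Subgroup.mul_mem _ hD (Subgroup.inv_mem _ hκ), ?_⟩
  · rw [e, h i j hij, zero_mul, zero_mul]
  · rw [e]
    have h0 : algebraMap O F (d i) ≠ 0 := fun h0 =>
      hdet i (Finset.mem_univ i) (by rw [hd, h0, zero_mul])
    rw [hd, _root_.zpow_neg, Units.val_inv_eq_inv_val]
    field_simp
  · rw [diagPow_neg]
    group

end Iwasawa

/-! ### Contraction: averages over `N(O)` of dominant translates. -/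

section Average

theorem eventually_sub_le {n : ℕ} (ν : Fin n → ℤ) :
    ∀ᶠ M : ℕ in Filter.atTop, ∀ i j, ν i - ν j ≤ M :=
  Filter.eventually_all.2 fun i => Filter.eventually_all.2 fun j => by
    filter_upwards [Filter.eventually_ge_atTop (ν i - ν j).toNat] with M hM
    exact (Int.self_le_toNat _).trans (Int.ofNat_le.2 hM)

variable {k : Type*} [Field k] {n : ℕ} {O F : Type*} [CommRing O] [Field F] [Algebra O F]
  {t : Fˣ} {ϖ : O} [IsDomain O] [IsDiscreteValuationRing O] [IsFractionRing O F]
  [Finite (O ⧸ Ideal.span {ϖ})] {V : Type*} [AddCommGroup V] [Module k V]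

variable (k n) in
/-- The characteristic function of `K`, in `k[G/K]^I`. -/
abbrev sphericalVector (ϖ : O) : fixedVectors (cosetRep k (maxCompact n O F)) (iwahori n F ϖ) :=
  unitCoset k (maxCompact n O F) iwahori_le_maxCompact

/-- For dominant `ν`, conjugation by `t^{-ν}` keeps the lower triangular factor of the Iwahori
decomposition in `I`. So `N(O)` alone is transitive on `I t^ν I / I`, and the average over it
computes the Hecke operator up to an index. The statement holds in every representation, which
allows `k[G/K]` and its quotients to be compared. -/
theorem cosetSum_diagPow (hϖ : Irreducible ϖ) (ht : (t : F) = algebraMap O F ϖ)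
    (ρ : Representation k (GL (Fin n) F) V) (v : fixedVectors ρ (iwahori n F ϖ)) {M : ℕ}
    {ν : Fin n → ℤ} (hν : Antitone ν) (hM : ∀ i j, ν i - ν j ≤ M) :
    cosetSum ρ (unipotentCongr n O ht M) (ρ (diagPow t ν) v) =
      (unipotentCongr n O ht M).relIndex (unipotentConj ϖ t ν) •
        ((heckeMonomial k ϖ t 1 ν • v : fixedVectors ρ (iwahori n F ϖ)) : V) := by
  have := finite_quotient_unipotentCongr (n := n) hϖ ht M
  have h := (cosetSum_eq_doubleCoset_smul ρ (H := iwahori n F ϖ) (diagPow t ν)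
    (unipotentCongr n O ht M) (unipotentConj ϖ t ν) (unipotentCongr_le_conj ht hM)
    (fun _ => mem_unipotentConj) (unipotentInt_le_iwahori ht) (fun h hh => ?_) v).2
  · rw [h, heckeMonomial, diagPow_eq_monomialGL]
  · obtain ⟨u, hu, b, hb, hlow, rfl⟩ := iwahori_factorization hϖ ht hh
    refine ⟨u, hu, ?_⟩
    have e : (u * diagPow t ν)⁻¹ * (u * b * diagPow t ν) =
        (diagPow t ν)⁻¹ * b * diagPow t ν := by group
    rw [e, diagPow_eq_monomialGL, conj_mem_iwahori_iff ht]
    have key : ∀ c : GL (Fin n) F, (∀ i j, c i j ∈ fil O t (iwLevel i j)) →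
        (∀ i j, i < j → c i j = 0) → ∀ i j, c i j ∈ fil O t (iwLevel i j + ν i - ν j) := by
      intro c hc hl i j
      rcases lt_or_ge i j with h1 | h1
      · rw [hl i j h1]
        exact zero_mem _
      · exact mem_fil_of_le ht (by have := hν h1; omega) (hc i j)
    have hb' := (mem_iwahori_iff ht).1 hb
    exact ⟨key b hb'.1 hlow, key b⁻¹ hb'.2 (lower_inv hlow)⟩

/-- The index divides `[N(O) : N(O)_M]`, a power of `q`, and `q` is nonzero in `k`. This is the
reason for averaging over `N(O)` and not over `I`. -/
theorem relIndex_ne_zero (hϖ : Irreducible ϖ) (ht : (t : F) = algebraMap O F ϖ)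
    (hq : (Nat.card (O ⧸ Ideal.span {ϖ}) : k) ≠ 0) {M : ℕ}
    {ν : Fin n → ℤ} (hν : Antitone ν) (hM : ∀ i j, ν i - ν j ≤ M) :
    ((unipotentCongr n O ht M).relIndex (unipotentConj ϖ t ν) : k) ≠ 0 := by
  obtain ⟨m, hm⟩ := index_unipotentCongr (n := n) (O := O) hϖ ht M
  obtain ⟨m', -, hm'⟩ := index_eq_relIndex_mul hϖ ht hν hM
  intro h
  have h1 := congrArg (Nat.cast (R := k)) (hm.symm.trans hm')
  rw [Nat.cast_mul, h, zero_mul, Nat.cast_pow] at h1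
  exact pow_ne_zero _ hq h1

/-- The `(i, j)` entry gets multiplied by `t^{N(j - i)}`, and `j - i ≥ 1` above the diagonal, so
large `N` makes `u` integral. -/
theorem eventually_conj_stair_mem (hϖ : Irreducible ϖ) (ht : (t : F) = algebraMap O F ϖ)
    {u : GL (Fin n) F} (hu : u ∈ unipotent n F) : ∀ᶠ N : ℕ in Filter.atTop,
      diagPow t (N • stair n) * u * (diagPow t (N • stair n))⁻¹ ∈ unipotentInt n O F := by
  choose m hm using fun i j => exists_mem_fil hϖ ht (u i j)
  have h : ∀ᶠ N : ℕ in Filter.atTop, ∀ i j, -(N : ℤ) ≤ m i j :=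
    Filter.eventually_all.2 fun i => Filter.eventually_all.2 fun j => by
      filter_upwards [Filter.eventually_ge_atTop (-m i j).toNat] with N hN
      have := (Int.self_le_toNat (-m i j)).trans (Int.ofNat_le.2 hN)
      omega
  filter_upwards [h] with N hN
  have e : ∀ i j, (diagPow t (N • stair n) * u * (diagPow t (N • stair n))⁻¹) i j =
      ((t ^ ((N : ℤ) * ((j : ℤ) - i)) : Fˣ) : F) * u i j := fun i j => by
    rw [← diagPow_neg, ← neg_neg (N • stair n), diagPow_neg, neg_neg, diagPow_eq_monomialGL,
      conj_monomialGL_apply, Pi.neg_apply, Pi.neg_apply, smul_stair_apply, smul_stair_apply]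
    congr 3
    ring
  have hun : diagPow t (N • stair n) * u * (diagPow t (N • stair n))⁻¹ ∈ unipotent n F := by
    refine mem_unipotent_iff.2 ⟨fun i j hij => ?_, fun i => ?_⟩
    · rw [e, hu.1 hij, mul_zero]
    · rw [e, hu.2, sub_self, mul_zero, zpow_zero, Units.val_one, mul_one]
  refine ⟨hun, mem_maxCompact_of_unipotent (t := t) hun fun i j hij => ?_⟩
  rw [e]
  refine mem_fil_of_le ht ?_ (mul_mem_fil (zpow_mem_fil _) (hm i j))
  have h1 : (1 : ℤ) ≤ (j : ℤ) - i := by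
    have : (i : ℕ) < j := hij
    omega
  have := hN i j
  nlinarith [Int.natCast_nonneg N]

/-- After contraction by a strictly dominant element, averages over `N(O)` of functions on `G/K`
are combinations of the vectors `[I t^μ I] 1_K` with `μ` dominant. -/
theorem eventually_cosetSum_mem_span (hϖ : Irreducible ϖ) (ht : (t : F) = algebraMap O F ϖ)
    (f : (GL (Fin n) F ⧸ maxCompact n O F) →₀ k) :
    ∀ᶠ N : ℕ in Filter.atTop, ∀ᶠ M : ℕ in Filter.atTop,
      cosetSum (cosetRep k (maxCompact n O F)) (unipotentCongr n O ht M)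
        (cosetRep k (maxCompact n O F) (diagPow t (N • stair n)) f) ∈
      Submodule.span k {x | ∃ μ, Antitone μ ∧
        x = ((heckeMonomial k ϖ t 1 μ : IwahoriHecke k n F ϖ) • sphericalVector k n ϖ).val} := by
  -- With both conditions stated as holding eventually, the claim is additive in `f`. The bound on
  -- `M` has to come after `N`, since it depends on the gaps of `N • stair n + μ`.
  induction f using Finsupp.induction_linear with
  | zero => simp
  | add f g hf hg =>
    filter_upwards [hf, hg] with N h1 h2
    filter_upwards [h1, h2] with M h3 h4
    rw [map_add, map_add]
    exact add_mem h3 h4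
  | single x c =>
    induction x using QuotientGroup.induction_on with
    | H g =>
      obtain ⟨u, hu, μ, κ, hκ, rfl⟩ := iwasawa hϖ ht g
      filter_upwards [eventually_conj_stair_mem hϖ ht hu, eventually_antitone_add_stair μ]
        with N h1 h2
      set ν := N • stair n + μ
      filter_upwards [eventually_sub_le ν] with M hM
      have hfin := finite_quotient_unipotentCongr (n := n) hϖ ht M
      set v : fixedVectors (cosetRep k (maxCompact n O F)) (iwahori n F ϖ) := sphericalVector k n ϖ
      -- By the Iwasawa decomposition, the translated coset is `u' t^ν K`, with `u'` the contracted,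
      -- now integral, unipotent part and `ν` dominant. The average then absorbs `u'`.
      have e1 : cosetRep k (maxCompact n O F) (diagPow t (N • stair n))
          (Finsupp.single ((u * diagPow t μ * κ : GL (Fin n) F) : _ ⧸ maxCompact n O F) c) =
          c • cosetRep k (maxCompact n O F) (diagPow t (N • stair n) * u *
            (diagPow t (N • stair n))⁻¹) (cosetRep k (maxCompact n O F) (diagPow t ν) v) := by
        rw [← Module.End.mul_apply, ← map_mul, coe_unitCoset, cosetRep_single, cosetRep_single,
          smul_mk_coset, smul_mk_coset, Finsupp.smul_single, smul_eq_mul, mul_one]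
        congr 1
        rw [QuotientGroup.eq, diagPow_add]
        convert Subgroup.inv_mem _ hκ using 1
        group
      rw [e1, map_smul]
      refine Submodule.smul_mem _ _ ?_
      have hfix : ∀ x ∈ unipotentCongr n O ht M,
          cosetRep k (maxCompact n O F) (x : GL (Fin n) F)
            (cosetRep k (maxCompact n O F) (diagPow t ν) v) =
          cosetRep k (maxCompact n O F) (diagPow t ν) v := fun x hx => by
        have h3 := mem_unipotentConj.1 (unipotentCongr_le_conj ht hM hx)
        have h4 := mem_fixedVectors.1 v.2 _ h3
        conv_rhs => rw [← h4]
        rw [← Module.End.mul_apply, ← Module.End.mul_apply, ← map_mul, ← map_mul]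
        congr 2
        group
      have := cosetSum_translate (cosetRep k (maxCompact n O F)) (unipotentCongr n O ht M)
        ⟨_, h1⟩ _ hfix
      rw [this, cosetSum_diagPow hϖ ht _ v h2 hM, ← Nat.cast_smul_eq_nsmul k]
      exact Submodule.smul_mem _ _ (Submodule.subset_span ⟨ν, h2, rfl⟩)

end Average

end

section

open Matrix

/-! ### Integrals over horocycles. -/

section Horocycle

variable {k : Type*} [Field k] {n : ℕ} {O F : Type*} [CommRing O] [Field F] [Algebra O F]
  {t : Fˣ} {ϖ : O}

variable (O) in
/-- The image of `t^λ U` in `G/K`. -/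
def horocycle (t : Fˣ) (μ : Fin n → ℤ) : Set (GL (Fin n) F ⧸ maxCompact n O F) :=
  {x | ∃ u ∈ unipotentUpper n F, x = ((diagPow t μ * u : GL (Fin n) F) : _ ⧸ maxCompact n O F)}

variable (k O) in
/-- The integral of a function on `G/K` over `t^λ U`. -/
def horoInt (t : Fˣ) (μ : Fin n → ℤ) : ((GL (Fin n) F ⧸ maxCompact n O F) →₀ k) →ₗ[k] k :=
  Finsupp.linearCombination k ((horocycle O t μ).indicator 1)

theorem unipotentIntegral_eq_horoInt (μ : Fin n → ℤ)
    (z : (GL (Fin n) F ⧸ maxCompact n O F) →₀ k) :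
    unipotentIntegral z (diagPow t μ) = horoInt k O t μ z := by
  classical
  change ∑ᶠ x ∈ horocycle O t μ, z x = _
  rw [horoInt, Finsupp.linearCombination_apply, Finsupp.sum,
    ← finsum_mem_inter_support (fun x => z x), finsum_mem_eq_finite_toFinset_sum _
      (Set.Finite.subset z.hasFiniteSupport Set.inter_subset_right)]
  · rw [← Finset.sum_filter_add_sum_filter_not z.support (· ∈ horocycle O t μ)]
    rw [Finset.sum_eq_zero (s := z.support.filter (· ∉ horocycle O t μ)), add_zero]
    · refine (Finset.sum_congr ?_ fun x hx => ?_).symm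
      · ext x
        simp [and_comm]
      · rw [Set.Finite.mem_toFinset] at hx
        rw [Set.indicator_of_mem hx.1]
        simp
    · intro x hx
      rw [Set.indicator_of_notMem (Finset.mem_filter.1 hx).2, smul_zero]

theorem unipotent_conj_diagPow {u : GL (Fin n) F} (hu : u ∈ unipotent n F) (μ : Fin n → ℤ) :
    (diagPow t μ)⁻¹ * u * diagPow t μ ∈ unipotent n F := by
  rw [diagPow_eq_monomialGL]
  refine mem_unipotent_iff.2 ⟨fun i j hij => ?_, fun i => ?_⟩
  · rw [conj_monomialGL_apply]
    change _ * u i j = 0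
    rw [hu.1 hij, mul_zero]
  · rw [conj_monomialGL_apply]
    change _ * u i i = 1
    rw [hu.2, sub_self, zpow_zero, Units.val_one, mul_one]

theorem smul_mem_horocycle {u : GL (Fin n) F} (hu : u ∈ unipotent n F) {μ : Fin n → ℤ}
    {x : GL (Fin n) F ⧸ maxCompact n O F} (hx : x ∈ horocycle O t μ) : u • x ∈ horocycle O t μ := by
  obtain ⟨v, hv, rfl⟩ := hx
  refine ⟨_, (unipotent n F).mul_mem (unipotent_conj_diagPow (t := t) hu μ) hv, ?_⟩
  rw [smul_mk_coset]
  congr 1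
  group

theorem smul_mem_horocycle_iff {u : GL (Fin n) F} (hu : u ∈ unipotent n F) {μ : Fin n → ℤ}
    {x : GL (Fin n) F ⧸ maxCompact n O F} : u • x ∈ horocycle O t μ ↔ x ∈ horocycle O t μ :=
  ⟨fun h => by simpa using smul_mem_horocycle ((unipotent n F).inv_mem hu) h,
    smul_mem_horocycle hu⟩

theorem diagPow_smul_mem_horocycle {ν μ : Fin n → ℤ} {x : GL (Fin n) F ⧸ maxCompact n O F}
    (hx : x ∈ horocycle O t μ) : diagPow t ν • x ∈ horocycle O t (ν + μ) := by
  obtain ⟨v, hv, rfl⟩ := hx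
  exact ⟨v, hv, by rw [smul_mk_coset, diagPow_add, mul_assoc]⟩

theorem diagPow_smul_mem_horocycle_iff {ν μ : Fin n → ℤ}
    {x : GL (Fin n) F ⧸ maxCompact n O F} :
    diagPow t ν • x ∈ horocycle O t μ ↔ x ∈ horocycle O t (μ - ν) :=
  ⟨fun h => by
    have := diagPow_smul_mem_horocycle (ν := -ν) h
    rwa [diagPow_neg, inv_smul_smul, neg_add_eq_sub] at this,
  fun h => by
    have := diagPow_smul_mem_horocycle (ν := ν) h
    rwa [add_sub_cancel] at this⟩

theorem horoInt_smul {g : GL (Fin n) F} {μ ν : Fin n → ℤ}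
    (h : ∀ x, g • x ∈ horocycle O t μ ↔ x ∈ horocycle O t ν)
    (f : (GL (Fin n) F ⧸ maxCompact n O F) →₀ k) :
    horoInt k O t μ (cosetRep k _ g f) = horoInt k O t ν f := by
  classical
  induction f using Finsupp.induction_linear with
  | zero => simp
  | add f g hf hg => simp only [map_add, hf, hg]
  | single x c =>
    rw [cosetRep_single, horoInt, horoInt, Finsupp.linearCombination_single,
      Finsupp.linearCombination_single, Set.indicator_apply, Set.indicator_apply]
    simp only [h]
    rfl

end Horocycle

/-! ### The isomorphism `x ↦ θ(x) 1_K` and the Satake homomorphism. -/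

section Satake

variable {k : Type*} [Field k] {n : ℕ} {O F : Type*} [CommRing O] [Field F] [Algebra O F]
  {t : Fˣ} {ϖ : O} [IsDomain O] [IsDiscreteValuationRing O] [IsFractionRing O F]

/-- If `t^μ u` lies in `K`, its diagonal entries `t^{μ i}` and the inverses of these are integral.
This computes the integrals of `1_K`. -/
theorem one_mem_horocycle_iff (hϖ : Irreducible ϖ) (ht : (t : F) = algebraMap O F ϖ)
    {μ : Fin n → ℤ} :
    ((1 : GL (Fin n) F) : GL (Fin n) F ⧸ maxCompact n O F) ∈ horocycle O t μ ↔ μ = 0 := by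
  constructor
  · rintro ⟨u, hu, h⟩
    rw [QuotientGroup.eq, inv_one, one_mul] at h
    have key : ∀ (m : ℤ), ((t ^ m : Fˣ) : F) ∈ fil O t 0 → 0 ≤ m := fun m hm => by
      by_contra! hneg
      have h1 := mul_mem_fil hm (zpow_mem_fil (O := O) (t := t) (-m))
      rw [← Units.val_mul, ← _root_.zpow_add, add_neg_cancel, zpow_zero, Units.val_one, zero_add]
        at h1
      exact one_notMem_fil_one hϖ ht (mem_fil_of_le ht (by omega) h1)
    have h1 := (mem_maxCompact_iff (t := t)).1 h
    have e1 : ∀ i, (diagPow t μ * u) i i = ((t ^ μ i : Fˣ) : F) := fun i => by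
      have := monomialGL_inv_mul_apply (t := t) u 1 (-μ) i i
      rw [← diagPow_eq_monomialGL, diagPow_neg, inv_inv] at this
      rw [this, Equiv.Perm.one_apply, hu.2, mul_one, Pi.neg_apply, neg_neg]
    have e2 : ∀ i, (diagPow t μ * u)⁻¹ i i = ((t ^ (-μ i) : Fˣ) : F) := fun i => by
      have hu' : u⁻¹ ∈ unipotent n F := (unipotent n F).inv_mem hu
      rw [_root_.mul_inv_rev, ← diagPow_neg, diagPow_eq_monomialGL, mul_monomialGL_apply]
      rw [Equiv.Perm.one_apply, hu'.2, one_mul, Pi.neg_apply]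
    funext i
    have h2 := key _ (by rw [← e1 i]; exact h1.1 i i)
    have h3 := key _ (by rw [← e2 i]; exact h1.2 i i)
    rw [Pi.zero_apply]
    omega
  · rintro rfl
    exact ⟨1, (unipotent n F).one_mem, by rw [diagPow_zero, one_mul]⟩

variable [Finite (O ⧸ Ideal.span {ϖ})]

/-- Horocycles are stable under unipotent translations and are shifted by `t^ν`, so integrating the
identity of `cosetSum_diagPow` leaves a quotient of two indices. That quotient is `q^{⟨2ρ, ν⟩}`. -/
theorem horoInt_heckeMonomial_smul (hϖ : Irreducible ϖ) (ht : (t : F) = algebraMap O F ϖ)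
    (hq : (Nat.card (O ⧸ Ideal.span {ϖ}) : k) ≠ 0) {ν : Fin n → ℤ} (hν : Antitone ν)
    (v : fixedVectors (cosetRep k (maxCompact n O F)) (iwahori n F ϖ)) (μ : Fin n → ℤ) :
    horoInt k O t μ ((heckeMonomial k ϖ t 1 ν : IwahoriHecke k n F ϖ) • v).val =
      (Nat.card (O ⧸ Ideal.span {ϖ}) : k) ^ twoRho ν * horoInt k O t (μ - ν) v.val := by
  obtain ⟨M, hM⟩ := (eventually_sub_le ν).exists
  have := finite_quotient_unipotentCongr (n := n) hϖ ht M
  have := Fintype.ofFinite (unipotentInt n O F ⧸ unipotentCongr n O ht M)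
  have h1 := congrArg (horoInt k O t μ) (cosetSum_diagPow hϖ ht _ v hν hM)
  rw [cosetSum_apply, finsum_eq_sum_of_fintype, map_sum, Finset.sum_congr rfl fun q _ =>
    horoInt_smul (fun x => smul_mem_horocycle_iff q.out.2.1) _, Finset.sum_const,
    Finset.card_univ, ← Nat.card_eq_fintype_card,
    horoInt_smul (fun x => diagPow_smul_mem_horocycle_iff), map_nsmul, nsmul_eq_mul,
    nsmul_eq_mul] at h1
  obtain ⟨m, hm, hm'⟩ := index_eq_relIndex_mul hϖ ht hν hM
  change ((unipotentCongr n O ht M).index : k) * _ = _ at h1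
  rw [hm', Nat.cast_mul, mul_assoc] at h1
  rw [← mul_left_cancel₀ (relIndex_ne_zero hϖ ht hq hν hM) h1, ← hm, zpow_natCast, Nat.cast_pow]

variable {s : k} {θ : AddMonoidAlgebra k (Fin n → ℤ) →ₐ[k] IwahoriHecke k n F ϖ}

variable (O) in
/-- The normalised integral `δ_B(t^λ)^{1/2} ∫_U f(t^λ u) du`. -/
def satakeCoeff (t : Fˣ) (s : k) (μ : Fin n → ℤ) :
    ((GL (Fin n) F ⧸ maxCompact n O F) →₀ k) →ₗ[k] k := s ^ (-twoRho μ) • horoInt k O t μ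

/-- The factor `q^{⟨2ρ, ν⟩}` is cancelled by two half powers, one from the normalisation of `θ` and
one from the change of `μ` to `μ - ν` in the normalised integral. -/
theorem satakeCoeff_dominant (hϖ : Irreducible ϖ) (ht : (t : F) = algebraMap O F ϖ)
    (hs0 : s ≠ 0) (hs : s ^ 2 = (Nat.card (O ⧸ Ideal.span {ϖ}) : k)) (hθ : IsBernstein t s θ)
    {ν : Fin n → ℤ} (hν : Antitone ν)
    (v : fixedVectors (cosetRep k (maxCompact n O F)) (iwahori n F ϖ)) (μ : Fin n → ℤ) :
    satakeCoeff O t s μ (θ (AddMonoidAlgebra.single ν 1) • v).val =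
      satakeCoeff O t s (μ - ν) v.val := by
  have hq : (Nat.card (O ⧸ Ideal.span {ϖ}) : k) ≠ 0 := by rw [← hs]; exact pow_ne_zero _ hs0
  have h := horoInt_heckeMonomial_smul hϖ ht hq hν v μ
  rw [hθ ν hν, smul_assoc, Submodule.coe_smul, map_smul, satakeCoeff, satakeCoeff,
    LinearMap.smul_apply, LinearMap.smul_apply, smul_eq_mul, smul_eq_mul, smul_eq_mul,
    diagPow_eq_monomialGL, h, ← hs, ← mul_assoc, ← mul_assoc]
  congr 1
  rw [← zpow_natCast, ← _root_.zpow_mul, ← zpow_add₀ hs0, ← zpow_add₀ hs0]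
  congr 1
  have := twoRho_add (μ - ν) ν
  rw [sub_add_cancel] at this
  push_cast
  linarith

/-- With `ν = a - b` for dominant `a` and `b`, the dominant case is used for `b` applied to `θ(ν) v`
and for `a` applied to `v`. -/
theorem satakeCoeff_single (hϖ : Irreducible ϖ) (ht : (t : F) = algebraMap O F ϖ)
    (hs0 : s ≠ 0) (hs : s ^ 2 = (Nat.card (O ⧸ Ideal.span {ϖ}) : k)) (hθ : IsBernstein t s θ)
    (ν : Fin n → ℤ) (v : fixedVectors (cosetRep k (maxCompact n O F)) (iwahori n F ϖ))
    (μ : Fin n → ℤ) :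
    satakeCoeff O t s μ (θ (AddMonoidAlgebra.single ν 1) • v).val =
      satakeCoeff O t s (μ - ν) v.val := by
  obtain ⟨a, ha, b, hb, hab⟩ := exists_dominant_sub ν
  have h1 := satakeCoeff_dominant hϖ ht hs0 hs hθ hb (θ (AddMonoidAlgebra.single ν 1) • v) (μ + b)
  rw [← mul_smul, ← map_mul, AddMonoidAlgebra.single_mul_single, one_mul, add_comm b, hab,
    satakeCoeff_dominant hϖ ht hs0 hs hθ ha, add_sub_cancel_right] at h1
  rw [← h1, ← hab]
  congr 2
  abel

/-- The normalised integrals of `1_K` are `1` at `μ = 0` and `0` elsewhere, and `θ` shifts them.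
This gives an explicit left inverse of `bernsteinMap`, later the formula for the Satake transform.
-/
theorem satakeCoeff_smul_sphericalVector (hϖ : Irreducible ϖ) (ht : (t : F) = algebraMap O F ϖ)
    (hs0 : s ≠ 0) (hs : s ^ 2 = (Nat.card (O ⧸ Ideal.span {ϖ}) : k)) (hθ : IsBernstein t s θ)
    (x : AddMonoidAlgebra k (Fin n → ℤ)) (μ : Fin n → ℤ) :
    satakeCoeff O t s μ (θ x • sphericalVector k n ϖ).val = x.coeff μ := by
  classical
  induction x using AddMonoidAlgebra.induction_linear with
  | zero => simp
  | add x y hx hy => simp only [map_add, add_smul, Submodule.coe_add, hx, hy,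
      AddMonoidAlgebra.coeff_add, Finsupp.add_apply]
  | single ν c =>
    have e : (AddMonoidAlgebra.single ν c : AddMonoidAlgebra k (Fin n → ℤ)) =
        c • AddMonoidAlgebra.single ν 1 := by simp
    rw [e, map_smul, smul_assoc, Submodule.coe_smul, map_smul,
      satakeCoeff_single hϖ ht hs0 hs hθ, AddMonoidAlgebra.coeff_smul, Finsupp.smul_apply,
      AddMonoidAlgebra.coeff_single, Finsupp.single_apply]
    congr 1
    rw [satakeCoeff, LinearMap.smul_apply, coe_unitCoset, horoInt,
      Finsupp.linearCombination_single, Set.indicator_apply, one_mem_horocycle_iff hϖ ht,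
      sub_eq_zero]
    by_cases h : μ = ν
    · rw [if_pos h, if_pos h.symm, h, sub_self, twoRho_zero]
      simp
    · rw [if_neg h, if_neg (Ne.symm h)]
      simp

/-- The map `x ↦ θ(x) 1_K`. -/
def bernsteinMap (θ : AddMonoidAlgebra k (Fin n → ℤ) →ₐ[k] IwahoriHecke k n F ϖ) :
    AddMonoidAlgebra k (Fin n → ℤ) →ₗ[k]
      fixedVectors (cosetRep k (maxCompact n O F)) (iwahori n F ϖ) :=
  ((LinearMap.toSpanSingleton (IwahoriHecke k n F ϖ) _
    (sphericalVector k n ϖ)).restrictScalars k) ∘ₗ θ.toLinearMap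

theorem bernsteinMap_apply (x : AddMonoidAlgebra k (Fin n → ℤ)) :
    bernsteinMap θ x = θ x • sphericalVector k n ϖ := rfl

theorem bernsteinMap_mul (x y : AddMonoidAlgebra k (Fin n → ℤ)) :
    bernsteinMap θ (x * y) = θ x • bernsteinMap θ y := by
  rw [bernsteinMap_apply, map_mul, mul_smul]
  rfl

/-- Dividing by `θ` of a dominant weight. -/
theorem eq_smul_of_cosetSum {V : Type*} [AddCommGroup V] [Module k V] (hϖ : Irreducible ϖ)
    (ht : (t : F) = algebraMap O F ϖ) (hs0 : s ≠ 0)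
    (hs : s ^ 2 = (Nat.card (O ⧸ Ideal.span {ϖ}) : k)) (hθ : IsBernstein t s θ)
    (ρ : Representation k (GL (Fin n) F) V) (v : fixedVectors ρ (iwahori n F ϖ)) {M : ℕ}
    {ν : Fin n → ℤ} (hν : Antitone ν) (hM : ∀ i j, ν i - ν j ≤ M) :
    ∃ c : k, ∀ w : fixedVectors ρ (iwahori n F ϖ),
      cosetSum ρ (unipotentCongr n O ht M) (ρ (diagPow t ν) v) = w →
        v = θ (AddMonoidAlgebra.single (-ν) c) • w := by
  have hq : (Nat.card (O ⧸ Ideal.span {ϖ}) : k) ≠ 0 := by rw [← hs]; exact pow_ne_zero _ hs0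
  have hr := relIndex_ne_zero hϖ ht hq hν hM
  refine ⟨s ^ (-twoRho ν) * ((unipotentCongr n O ht M).relIndex (unipotentConj ϖ t ν) : k)⁻¹,
    fun w hw => ?_⟩
  rw [cosetSum_diagPow hϖ ht _ v hν hM, ← Nat.cast_smul_eq_nsmul k, ← Submodule.coe_smul] at hw
  rw [← Subtype.ext hw]
  have e : (AddMonoidAlgebra.single (-ν) (s ^ (-twoRho ν) *
      ((unipotentCongr n O ht M).relIndex (unipotentConj ϖ t ν) : k)⁻¹) :
        AddMonoidAlgebra k (Fin n → ℤ)) =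
      (s ^ (-twoRho ν) * ((unipotentCongr n O ht M).relIndex (unipotentConj ϖ t ν) : k)⁻¹) •
        AddMonoidAlgebra.single (-ν) 1 := by simp
  rw [e, map_smul, smul_assoc, smul_comm (θ _) (_ : k), smul_smul, inv_mul_cancel_right₀ hr,
    smul_comm (s ^ (_ : ℤ)), ← smul_assoc (s ^ (_ : ℤ)), heckeMonomial,
    ← diagPow_eq_monomialGL, ← hθ _ hν, ← mul_smul, ← map_mul,
    AddMonoidAlgebra.single_mul_single, neg_add_cancel, mul_one]
  change v = θ 1 • v
  rw [map_one, one_smul]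

/-- No invariance of `f` is assumed. This matters for the quotient `M_λ`, where an `I`-invariant
vector is first lifted to an arbitrary function. -/
theorem eventually_exists_bernsteinMap (hϖ : Irreducible ϖ)
    (ht : (t : F) = algebraMap O F ϖ) (hs0 : s ≠ 0) (hθ : IsBernstein t s θ)
    (f : (GL (Fin n) F ⧸ maxCompact n O F) →₀ k) :
    ∀ᶠ N : ℕ in Filter.atTop, ∀ᶠ M : ℕ in Filter.atTop, ∃ y, (bernsteinMap θ y).val =
      cosetSum (cosetRep k (maxCompact n O F)) (unipotentCongr n O ht M)
        (cosetRep k (maxCompact n O F) (diagPow t (N • stair n)) f) := by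
  have hle : Submodule.span k {x | ∃ μ, Antitone μ ∧
      x = ((heckeMonomial k ϖ t 1 μ : IwahoriHecke k n F ϖ) • sphericalVector k n ϖ).val} ≤
      LinearMap.range (Submodule.subtype _ ∘ₗ bernsteinMap θ) := by
    refine Submodule.span_le.2 ?_
    rintro _ ⟨μ, hμ, rfl⟩
    refine ⟨s ^ twoRho μ • AddMonoidAlgebra.single μ 1, ?_⟩
    rw [LinearMap.comp_apply, map_smul, bernsteinMap_apply, hθ μ hμ, smul_assoc, smul_smul,
      ← zpow_add₀ hs0, add_neg_cancel, zpow_zero, one_smul, diagPow_eq_monomialGL]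
    rfl
  filter_upwards [eventually_cosetSum_mem_span hϖ ht f] with N hN
  filter_upwards [hN] with M hM
  exact hle hM

/-- Injectivity reads the coefficients off from the integrals. For surjectivity, the average of `t^ν
f` with `ν = N • stair n` lies in the image, and for `I`-invariant `f` it determines `f` after
applying a multiple of `θ(-ν)`. The image is stable under `θ`. -/
theorem bernsteinMap_bijective (hϖ : Irreducible ϖ) (ht : (t : F) = algebraMap O F ϖ)
    (hs0 : s ≠ 0) (hs : s ^ 2 = (Nat.card (O ⧸ Ideal.span {ϖ}) : k)) (hθ : IsBernstein t s θ) :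
    Function.Bijective (bernsteinMap θ) := by
  have key := satakeCoeff_smul_sphericalVector hϖ ht hs0 hs hθ
  refine ⟨fun x y hxy => ?_, fun f => ?_⟩
  · apply AddMonoidAlgebra.ext
    ext μ
    rw [← key x μ, ← key y μ, ← bernsteinMap_apply, hxy, bernsteinMap_apply]
  · obtain ⟨N, hN⟩ := (eventually_exists_bernsteinMap hϖ ht hs0 hθ f.val).exists
    obtain ⟨M, ⟨y, hy⟩, hM⟩ := (hN.and (eventually_sub_le (N • stair n))).exists
    obtain ⟨c, hc⟩ := eq_smul_of_cosetSum hϖ ht hs0 hs hθ _ f (smul_stair_antitone N) hM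
    exact ⟨_, (bernsteinMap_mul _ y).trans (hc _ hy.symm).symm⟩

/-- The isomorphism `k[Λ] ≅ k[G/K]^I`, `x ↦ θ(x) 1_K`. -/
def bernsteinEquiv (hϖ : Irreducible ϖ) (ht : (t : F) = algebraMap O F ϖ)
    (hs0 : s ≠ 0) (hs : s ^ 2 = (Nat.card (O ⧸ Ideal.span {ϖ}) : k)) (hθ : IsBernstein t s θ) :
    AddMonoidAlgebra k (Fin n → ℤ) ≃ₗ[k]
      fixedVectors (cosetRep k (maxCompact n O F)) (iwahori n F ϖ) :=
  LinearEquiv.ofBijective (bernsteinMap θ) (bernsteinMap_bijective hϖ ht hs0 hs hθ)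

theorem coeff_bernsteinEquiv_symm (hϖ : Irreducible ϖ) (ht : (t : F) = algebraMap O F ϖ)
    (hs0 : s ≠ 0) (hs : s ^ 2 = (Nat.card (O ⧸ Ideal.span {ϖ}) : k)) (hθ : IsBernstein t s θ)
    (f : fixedVectors (cosetRep k (maxCompact n O F)) (iwahori n F ϖ)) (μ : Fin n → ℤ) :
    ((bernsteinEquiv hϖ ht hs0 hs hθ).symm f).coeff μ = satakeCoeff O t s μ f.val := by
  obtain ⟨x, rfl⟩ := (bernsteinEquiv hϖ ht hs0 hs hθ).surjective f
  rw [LinearEquiv.symm_apply_apply]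
  exact (satakeCoeff_smul_sphericalVector hϖ ht hs0 hs hθ x μ).symm

theorem injective_of_isBernstein (hϖ : Irreducible ϖ) (ht : (t : F) = algebraMap O F ϖ)
    (hs0 : s ≠ 0) (hs : s ^ 2 = (Nat.card (O ⧸ Ideal.span {ϖ}) : k)) (hθ : IsBernstein t s θ) :
    Function.Injective θ := fun x y hxy => (bernsteinMap_bijective hϖ ht hs0 hs hθ).1 (by
  rw [bernsteinMap_apply, hxy, bernsteinMap_apply])

variable (k n F ϖ) in
/-- The inclusion `k[K\G/K] ⊆ k[G/K]^I`. -/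
def sphericalInclusion : SphericalHecke k n O F →ₗ[k]
    fixedVectors (cosetRep k (maxCompact n O F)) (iwahori n F ϖ) :=
  Submodule.inclusion fun _ hv => mem_fixedVectors.2 fun h hh =>
    mem_fixedVectors.1 hv h (iwahori_le_maxCompact hh)

theorem orbitMap_smul_of_equivariant {G : Type*} [Group G] {H K : Subgroup G}
    (z : HeckeAlgebra k K) (h : HeckeAlgebra k H) (v : fixedVectors (cosetRep k K) H) :
    orbitMap (cosetRep k K) z (h • v).val =
      orbitMap (cosetRep k K) (⟨orbitMap (cosetRep k K) z v.val, mem_fixedVectors.2 fun g hg => by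
        rw [← orbitMap_equivariant, mem_fixedVectors.1 v.2 g hg]⟩ :
          fixedVectors (cosetRep k K) H) h.val :=
  map_orbitMap (orbitMap (cosetRep k K) z) (orbitMap_equivariant _ z) v _ rfl h

/-- Right convolution by `z` is multiplication by the Satake transform of `z`. -/
theorem orbitMap_bernsteinMap (hϖ : Irreducible ϖ) (ht : (t : F) = algebraMap O F ϖ)
    (hs0 : s ≠ 0) (hs : s ^ 2 = (Nat.card (O ⧸ Ideal.span {ϖ}) : k)) (hθ : IsBernstein t s θ)
    (z : SphericalHecke k n O F) (x : AddMonoidAlgebra k (Fin n → ℤ)) :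
    orbitMap (cosetRep k (maxCompact n O F)) z (bernsteinMap θ x).val =
      (bernsteinMap θ (x * (bernsteinEquiv hϖ ht hs0 hs hθ).symm
        (sphericalInclusion k n F ϖ z))).val := by
  rw [bernsteinMap_apply, orbitMap_smul_of_equivariant, bernsteinMap_mul]
  have e : bernsteinMap θ ((bernsteinEquiv hϖ ht hs0 hs hθ).symm (sphericalInclusion k n F ϖ z)) =
      sphericalInclusion k n F ϖ z :=
    (bernsteinEquiv hϖ ht hs0 hs hθ).apply_symm_apply _
  rw [e]
  change _ = orbitMap _ (sphericalInclusion k n F ϖ z) (θ x).val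
  congr 2
  apply Subtype.ext
  change orbitMap (cosetRep k (maxCompact n O F)) z (sphericalVector k n ϖ).val = z.val
  rw [coe_unitCoset, orbitMap_single, one_smul, map_one]
  rfl

/-- The Satake homomorphism. -/
def satake (hϖ : Irreducible ϖ) (ht : (t : F) = algebraMap O F ϖ)
    (hs0 : s ≠ 0) (hs : s ^ 2 = (Nat.card (O ⧸ Ideal.span {ϖ}) : k)) (hθ : IsBernstein t s θ) :
    SphericalHecke k n O F →ₐ[k] AddMonoidAlgebra k (Fin n → ℤ) :=
  AlgHom.ofLinearMap
    ((bernsteinEquiv hϖ ht hs0 hs hθ).symm.toLinearMap ∘ₗ sphericalInclusion k n F ϖ)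
    (by
      rw [LinearMap.comp_apply, LinearEquiv.coe_coe, LinearEquiv.symm_apply_eq]
      change _ = bernsteinMap θ 1
      rw [bernsteinMap_apply, map_one θ, one_smul]
      rfl)
    -- The product `z * w` is the right convolution of `z` by `w`, which `orbitMap_bernsteinMap`
    -- turns into multiplication by the transform of `w`.
    (fun z w => by
      rw [LinearMap.comp_apply, LinearEquiv.coe_coe, LinearEquiv.symm_apply_eq]
      apply Subtype.ext
      change _ = (bernsteinMap θ _).val
      refine Eq.trans ?_ (orbitMap_bernsteinMap hϖ ht hs0 hs hθ w _)
      have e : bernsteinMap θ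
          ((bernsteinEquiv hϖ ht hs0 hs hθ).symm (sphericalInclusion k n F ϖ z)) =
          sphericalInclusion k n F ϖ z := (bernsteinEquiv hϖ ht hs0 hs hθ).apply_symm_apply _
      change _ = orbitMap _ w (bernsteinMap θ
          ((bernsteinEquiv hϖ ht hs0 hs hθ).symm (sphericalInclusion k n F ϖ z))).val
      rw [e]
      rfl)

theorem bernsteinMap_satake (hϖ : Irreducible ϖ) (ht : (t : F) = algebraMap O F ϖ)
    (hs0 : s ≠ 0) (hs : s ^ 2 = (Nat.card (O ⧸ Ideal.span {ϖ}) : k)) (hθ : IsBernstein t s θ)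
    (z : SphericalHecke k n O F) :
    bernsteinMap θ (satake hϖ ht hs0 hs hθ z) = sphericalInclusion k n F ϖ z :=
  (bernsteinEquiv hϖ ht hs0 hs hθ).apply_symm_apply _

theorem isSatakeEmbedding_satake (hϖ : Irreducible ϖ) (ht : (t : F) = algebraMap O F ϖ)
    (hs0 : s ≠ 0) (hs : s ^ 2 = (Nat.card (O ⧸ Ideal.span {ϖ}) : k)) (hθ : IsBernstein t s θ) :
    IsSatakeEmbedding t s (satake hϖ ht hs0 hs hθ) := by
  refine ⟨fun z w h => ?_, fun z μ => ?_⟩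
  · have h1 := congrArg (bernsteinMap θ) h
    rw [bernsteinMap_satake, bernsteinMap_satake] at h1
    exact Submodule.inclusion_injective _ h1
  · rw [unipotentIntegral_eq_horoInt]
    exact coeff_bernsteinEquiv_symm hϖ ht hs0 hs hθ (sphericalInclusion k n F ϖ z) μ

end Satake

end

section

open Matrix

/-! ### Tensor products along a character as quotients. -/

section TensorCharOf

variable {k B M : Type*} [CommRing k] [Ring B] [Algebra k B] [AddCommGroup M] [Module k M]

/-- The map `m ↦ m ⊗ 1`. -/
def TensorChar.of (r : Bᵐᵒᵖ →ₐ[k] Module.End k M) (χ : B →ₐ[k] k) : M →ₗ[k] TensorChar r χ :=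
  (charRelations r χ).mkQ ∘ₗ (TensorProduct.rid k M).symm.toLinearMap

theorem TensorChar.of_apply (r : Bᵐᵒᵖ →ₐ[k] Module.End k M) (χ : B →ₐ[k] k) (m : M) :
    TensorChar.of r χ m = (charRelations r χ).mkQ (m ⊗ₜ[k] 1) := by
  rw [TensorChar.of, LinearMap.comp_apply, LinearEquiv.coe_coe, TensorProduct.rid_symm_apply]

theorem TensorChar.of_surjective (r : Bᵐᵒᵖ →ₐ[k] Module.End k M) (χ : B →ₐ[k] k) :
    Function.Surjective (TensorChar.of r χ) := fun x => by
  obtain ⟨m, rfl⟩ := TensorChar.exists_mkQ x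
  exact ⟨m, TensorChar.of_apply r χ m⟩

theorem TensorChar.of_act (r : Bᵐᵒᵖ →ₐ[k] Module.End k M) (χ : B →ₐ[k] k) (b : B) (m : M) :
    TensorChar.of r χ (r (MulOpposite.op b) m) = χ b • TensorChar.of r χ m := by
  rw [TensorChar.of_apply, TensorChar.of_apply, TensorChar.mkQ_act]

/-- The quotient of `M` by these relations receives a map from the tensor product, so nothing else
is killed. -/
theorem TensorChar.mem_span_of_of_eq_zero {r : Bᵐᵒᵖ →ₐ[k] Module.End k M} {χ : B →ₐ[k] k} {m : M}
    (h : TensorChar.of r χ m = 0) :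
    m ∈ Submodule.span k {x | ∃ b v, x = r (MulOpposite.op b) v - χ b • v} := by
  set J := Submodule.span k {x | ∃ b v, x = r (MulOpposite.op b) v - χ b • v}
  have h1 := TensorChar.lift_mkQ (r := r) (χ := χ) J.mkQ (fun b v => by
    rw [← map_smul, ← sub_eq_zero, ← map_sub, Submodule.mkQ_apply, Submodule.Quotient.mk_eq_zero]
    exact Submodule.subset_span ⟨b, v, rfl⟩) m 1
  rw [← TensorChar.of_apply, h, map_zero, one_smul] at h1
  exact (Submodule.Quotient.mk_eq_zero J).1 h1.symm

/-- The map `a ↦ a ⊗ 1`. -/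
def InducedModule.of {A : Type*} [Ring A] [Algebra k A] (f : B →ₐ[k] A) (χ : B →ₐ[k] k) :
    A →ₗ[k] InducedModule f χ := TensorChar.of (rightMul f) χ

theorem InducedModule.of_apply {A : Type*} [Ring A] [Algebra k A] (f : B →ₐ[k] A)
    (χ : B →ₐ[k] k) (a : A) : InducedModule.of f χ a = InducedModule.tmul f χ a 1 :=
  TensorChar.of_apply _ _ _

end TensorCharOf

/-! ### The module `M_λ` and its `I`-invariants. -/

section Universal

variable {k G : Type*} [CommRing k] [Group G] {H K : Subgroup G} (χ : HeckeAlgebra k K →ₐ[k] k)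

theorem TensorChar.of_equivariant (g : G) (f : (G ⧸ K) →₀ k) :
    TensorChar.of (HeckeAlgebra.rightConv k K) χ (cosetRep k K g f) =
      universalModule K χ g (TensorChar.of _ χ f) := by
  rw [TensorChar.of_apply, TensorChar.of_apply]
  rfl

variable (H) in
/-- The map induced on `H`-invariants by `k[G/K] → k[G/K] ⊗_{k[K\G/K], χ} k`. -/
def toUniversalFixed :
    fixedVectors (cosetRep k K) H →ₗ[HeckeAlgebra k H] fixedVectors (universalModule K χ) H where
  toFun v := ⟨TensorChar.of _ χ v.val, mem_fixedVectors.2 fun h hh => by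
    rw [← TensorChar.of_equivariant, mem_fixedVectors.1 v.2 h hh]⟩
  map_add' v w := Subtype.ext (map_add (TensorChar.of _ χ) v.val w.val)
  map_smul' f v := Subtype.ext (map_orbitMap _ (TensorChar.of_equivariant χ) v _ rfl f.val)

theorem coe_toUniversalFixed (v : fixedVectors (cosetRep k K) H) :
    (toUniversalFixed H χ v).val = TensorChar.of _ χ v.val := rfl

theorem toUniversalFixed_smul (c : k) (v : fixedVectors (cosetRep k K) H) :
    toUniversalFixed H χ (c • v) = c • toUniversalFixed H χ v :=
  Subtype.ext (map_smul (TensorChar.of _ χ) c v.val)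

end Universal

section Main

variable {k : Type*} [Field k] {n : ℕ} {O F : Type*} [CommRing O] [Field F] [Algebra O F]
  {t : Fˣ} {ϖ : O} [IsDomain O] [IsDiscreteValuationRing O] [IsFractionRing O F]
  [Finite (O ⧸ Ideal.span {ϖ})] {s : k}
  {θ : AddMonoidAlgebra k (Fin n → ℤ) →ₐ[k] IwahoriHecke k n F ϖ}

/-- An invariant vector `m` is lifted to any function `f`. The contracted average of `f` lies in the
image of `bernsteinMap`, hence is `I`-invariant, and it maps to the average of `m`. From the latter
`m` is recovered by a multiple of `θ(-ν)`. -/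
theorem toUniversalFixed_surjective (hϖ : Irreducible ϖ) (ht : (t : F) = algebraMap O F ϖ)
    (hs0 : s ≠ 0) (hs : s ^ 2 = (Nat.card (O ⧸ Ideal.span {ϖ}) : k)) (hθ : IsBernstein t s θ)
    (χ : SphericalHecke k n O F →ₐ[k] k) :
    Function.Surjective (toUniversalFixed (iwahori n F ϖ) χ) := fun m => by
  obtain ⟨f, hf⟩ := TensorChar.of_surjective _ χ m.val
  obtain ⟨N, hN⟩ := (eventually_exists_bernsteinMap hϖ ht hs0 hθ f).exists
  obtain ⟨M, ⟨y, hy⟩, hM⟩ := (hN.and (eventually_sub_le (N • stair n))).exists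
  have := finite_quotient_unipotentCongr (n := n) hϖ ht M
  obtain ⟨c, hc⟩ := eq_smul_of_cosetSum hϖ ht hs0 hs hθ _ m (smul_stair_antitone N) hM
  rw [hc (toUniversalFixed _ χ (bernsteinMap θ y)), ← map_smul]
  · exact ⟨_, rfl⟩
  · rw [coe_toUniversalFixed, hy, map_cosetSum _ (TensorChar.of_equivariant χ),
      TensorChar.of_equivariant, hf]

variable (hϖ : Irreducible ϖ) (ht : (t : F) = algebraMap O F ϖ)
    (hs0 : s ≠ 0) (hs : s ^ 2 = (Nat.card (O ⧸ Ideal.span {ϖ}) : k)) (hθ : IsBernstein t s θ)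
    (χ : SphericalHecke k n O F →ₐ[k] k)

/-- The relations defining `k[Λ] ⊗_{Z, χ} k`. -/
def satakeRelations : Submodule k (AddMonoidAlgebra k (Fin n → ℤ)) :=
  Submodule.span k {x | ∃ z y, x = y * satake hϖ ht hs0 hs hθ z - χ z • y}

theorem mul_mem_satakeRelations {x : AddMonoidAlgebra k (Fin n → ℤ)}
    (hx : x ∈ satakeRelations hϖ ht hs0 hs hθ χ) (y : AddMonoidAlgebra k (Fin n → ℤ)) :
    y * x ∈ satakeRelations hϖ ht hs0 hs hθ χ := by
  have : satakeRelations hϖ ht hs0 hs hθ χ ≤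
      (satakeRelations hϖ ht hs0 hs hθ χ).comap (LinearMap.mulLeft k y) := by
    refine Submodule.span_le.2 ?_
    rintro _ ⟨z, w, rfl⟩
    refine Submodule.subset_span ⟨z, y * w, ?_⟩
    rw [LinearMap.mulLeft_apply, mul_sub, mul_assoc, mul_smul_comm]
  exact this hx

/-- The vector is a sum of relations `v * z - χ(z) v` with `v` not necessarily `I`-invariant. The
contracted average commutes with right convolution and replaces `v` by some `θ(y) 1_K`, so each
relation becomes `y S(z) - χ(z) y` in `k[Λ]`. Undoing the contraction multiplies by an element of
`k[Λ]`, and the relations form an ideal. -/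
theorem mem_satakeRelations_of_toUniversalFixed_eq_zero {x : AddMonoidAlgebra k (Fin n → ℤ)}
    (h : toUniversalFixed (iwahori n F ϖ) χ (bernsteinMap θ x) = 0) :
    x ∈ satakeRelations hϖ ht hs0 hs hθ χ := by
  have h1 := TensorChar.mem_span_of_of_eq_zero (congrArg Subtype.val h)
  have key : ∀ w ∈ Submodule.span k {x | ∃ b v, x = HeckeAlgebra.rightConv k
      (maxCompact n O F) (MulOpposite.op b) v - χ b • v},
      ∀ᶠ N : ℕ in Filter.atTop, ∀ᶠ M : ℕ in Filter.atTop,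
        ∃ y ∈ satakeRelations hϖ ht hs0 hs hθ χ, (bernsteinMap θ y).val =
          cosetSum (cosetRep k (maxCompact n O F)) (unipotentCongr n O ht M)
            (cosetRep k (maxCompact n O F) (diagPow t (N • stair n)) w) := by
    intro w hw
    induction hw using Submodule.span_induction with
    | zero =>
      refine Filter.Eventually.of_forall fun N => Filter.Eventually.of_forall fun M => ⟨0, ?_⟩
      simp
    | add a b _ _ ha hb =>
      filter_upwards [ha, hb] with N ha hb
      filter_upwards [ha, hb] with M ⟨y, hy, ey⟩ ⟨z, hz, ez⟩
      exact ⟨y + z, add_mem hy hz, by rw [map_add, Submodule.coe_add, ey, ez, map_add, map_add]⟩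
    | smul c a _ ha =>
      filter_upwards [ha] with N ha
      filter_upwards [ha] with M ⟨y, hy, ey⟩
      exact ⟨c • y, Submodule.smul_mem _ c hy, by
        rw [map_smul, Submodule.coe_smul, ey, map_smul, map_smul]⟩
    | mem w hw =>
      obtain ⟨z, v, rfl⟩ := hw
      filter_upwards [eventually_exists_bernsteinMap hϖ ht hs0 hθ v] with N hN
      filter_upwards [hN] with M ⟨y, hy⟩
      have := finite_quotient_unipotentCongr (n := n) hϖ ht M
      refine ⟨_, Submodule.subset_span ⟨z, y, rfl⟩, ?_⟩
      rw [map_sub, map_smul, Submodule.coe_sub, Submodule.coe_smul, hy, map_sub, map_sub, map_smul,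
        map_smul]
      congr 1
      change _ = cosetSum _ _ (cosetRep k _ _ (orbitMap _ z v))
      rw [← orbitMap_equivariant, ← map_cosetSum _ (orbitMap_equivariant _ z), ← hy,
        orbitMap_bernsteinMap hϖ ht hs0 hs hθ]
      rfl
  obtain ⟨N, hN⟩ := (key _ h1).exists
  obtain ⟨M, ⟨y, hy, ey⟩, hM⟩ := (hN.and (eventually_sub_le (N • stair n))).exists
  obtain ⟨c, hc⟩ := eq_smul_of_cosetSum hϖ ht hs0 hs hθ _ (bernsteinMap θ x)
    (smul_stair_antitone N) hM
  have h2 := hc _ ey.symm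
  rw [← bernsteinMap_mul] at h2
  rw [(bernsteinMap_bijective hϖ ht hs0 hs hθ).1 h2]
  exact mul_mem_satakeRelations hϖ ht hs0 hs hθ χ hy _

variable (θ) in
/-- The map `a ↦ a 1_K ⊗ 1`. -/
def rangeToUniversal : θ.range →ₗ[k]
    fixedVectors (universalModule (maxCompact n O F) χ) (iwahori n F ϖ) where
  toFun a := toUniversalFixed (iwahori n F ϖ) χ
    ((a : IwahoriHecke k n F ϖ) • sphericalVector k n ϖ)
  map_add' a b := by rw [← map_add, ← add_smul]; rfl
  map_smul' c a := by
    rw [RingHom.id_apply, ← toUniversalFixed_smul, ← smul_assoc]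
    rfl

theorem rangeToUniversal_apply (x : AddMonoidAlgebra k (Fin n → ℤ)) :
    rangeToUniversal θ χ (θ.rangeRestrict x) =
      toUniversalFixed (iwahori n F ϖ) χ (bernsteinMap θ x) := rfl

theorem rangeToUniversal_act (z : SphericalHecke k n O F) (a : θ.range) :
    rangeToUniversal θ χ (rightMul (θ.rangeRestrict.comp (satake hϖ ht hs0 hs hθ))
      (MulOpposite.op z) a) = χ z • rangeToUniversal θ χ a := by
  obtain ⟨x, rfl⟩ := θ.rangeRestrict_surjective a
  have e : rightMul (θ.rangeRestrict.comp (satake hϖ ht hs0 hs hθ)) (MulOpposite.op z)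
      (θ.rangeRestrict x) = θ.rangeRestrict (x * satake hϖ ht hs0 hs hθ z) :=
    (map_mul θ.rangeRestrict _ _).symm
  rw [e, rangeToUniversal_apply, rangeToUniversal_apply]
  apply Subtype.ext
  rw [coe_toUniversalFixed, Submodule.coe_smul, coe_toUniversalFixed, ← TensorChar.of_act]
  congr 1
  exact (orbitMap_bernsteinMap hϖ ht hs0 hs hθ z x).symm

/-- The map `a ⊗ c ↦ c (a 1_K ⊗ 1)`. -/
def inducedToUniversal :
    InducedModule (θ.rangeRestrict.comp (satake hϖ ht hs0 hs hθ)) χ →ₗ[k]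
      fixedVectors (universalModule (maxCompact n O F) χ) (iwahori n F ϖ) :=
  TensorChar.lift (rangeToUniversal θ χ) (rangeToUniversal_act hϖ ht hs0 hs hθ χ)

theorem inducedToUniversal_tmul (a : θ.range) (c : k) :
    inducedToUniversal hϖ ht hs0 hs hθ χ (InducedModule.tmul _ _ a c) =
      c • toUniversalFixed (iwahori n F ϖ) χ
        ((a : IwahoriHecke k n F ϖ) • sphericalVector k n ϖ) :=
  TensorChar.lift_mkQ _ _ _ _

theorem tmul_eq_zero_of_mem_satakeRelations {x : AddMonoidAlgebra k (Fin n → ℤ)}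
    (hx : x ∈ satakeRelations hϖ ht hs0 hs hθ χ) :
    InducedModule.tmul (θ.rangeRestrict.comp (satake hϖ ht hs0 hs hθ)) χ (θ.rangeRestrict x) 1 =
      0 := by
  have : satakeRelations hϖ ht hs0 hs hθ χ ≤ LinearMap.ker
      (TensorChar.of (rightMul (θ.rangeRestrict.comp (satake hϖ ht hs0 hs hθ))) χ ∘ₗ
        θ.rangeRestrict.toLinearMap) := by
    refine Submodule.span_le.2 ?_
    rintro _ ⟨z, y, rfl⟩
    change TensorChar.of _ χ (θ.rangeRestrict _) = 0
    rw [map_sub, map_smul, map_sub, map_smul, map_mul, sub_eq_zero, ← TensorChar.of_act]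
    rfl
  have h := LinearMap.mem_ker.1 (this hx)
  rw [LinearMap.comp_apply, TensorChar.of_apply] at h
  exact h

theorem inducedToUniversal_bijective :
    Function.Bijective (inducedToUniversal hϖ ht hs0 hs hθ χ) := by
  constructor
  · refine (injective_iff_map_eq_zero _).2 fun x hx => ?_
    obtain ⟨⟨_, y, rfl⟩, rfl⟩ := InducedModule.exists_tmul x
    rw [inducedToUniversal_tmul, one_smul] at hx
    exact tmul_eq_zero_of_mem_satakeRelations hϖ ht hs0 hs hθ χ
      (mem_satakeRelations_of_toUniversalFixed_eq_zero hϖ ht hs0 hs hθ χ hx)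
  · intro m
    obtain ⟨v, rfl⟩ := toUniversalFixed_surjective hϖ ht hs0 hs hθ χ m
    obtain ⟨x, rfl⟩ := (bernsteinMap_bijective hϖ ht hs0 hs hθ).2 v
    refine ⟨InducedModule.tmul _ _ (θ.rangeRestrict x) 1, ?_⟩
    rw [inducedToUniversal_tmul, one_smul]
    rfl

/-- The isomorphism `H ⊗_{H_W} 1 ≅ k[G/K]^I`, `h ⊗ 1 ↦ h 1_K`. -/
theorem exists_induced_equiv_fixed (hϖ : Irreducible ϖ) (ht : (t : F) = algebraMap O F ϖ)
    (hcard : ((finite_image_maxCompact_iwahori (n := n) hϖ ht).toFinset.card : k) ≠ 0) :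
    ∃ Θ : InducedTrivial k n F ϖ ≃ₗ[IwahoriHecke k n F ϖ]
        fixedVectors (cosetRep k (maxCompact n O F)) (iwahori n F ϖ),
      ∀ a, Θ (InducedModule.tmul _ _ a 1) = a • sphericalVector k n ϖ :=
  ⟨inducedEquivFixed iwahori_le_maxCompact (finite_image_maxCompact_iwahori hϖ ht) hcard,
    inducedEquivFixed_tmul _ _ hcard⟩

/-- The isomorphism `A ≅ H ⊗_{H_W} 1`, `a ↦ a ⊗ 1`. -/
theorem exists_bernstein_equiv_induced
    (Θ : InducedTrivial k n F ϖ ≃ₗ[IwahoriHecke k n F ϖ]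
      fixedVectors (cosetRep k (maxCompact n O F)) (iwahori n F ϖ))
    (hΘ : ∀ a, Θ (InducedModule.tmul _ _ a 1) = a • sphericalVector k n ϖ)
    (hβ : Function.Bijective (bernsteinMap (F := F) θ)) :
    ∃ φ : θ.range ≃ₗ[k] InducedTrivial k n F ϖ,
      (∀ a : θ.range, φ a = InducedModule.tmul _ _ (a : IwahoriHecke k n F ϖ) 1) ∧
      ∀ (h : IwahoriHecke k n F ϖ) (a : θ.range),
        (φ.symm (h • φ a) : IwahoriHecke k n F ϖ) •
            (sphericalVector k n ϖ : fixedVectors (cosetRep k (maxCompact n O F)) _) =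
          h • (a : IwahoriHecke k n F ϖ) • sphericalVector k n ϖ := by
  obtain ⟨ψ, hψ⟩ : ∃ ψ : θ.range →ₗ[k] InducedTrivial k n F ϖ,
      ∀ a : θ.range, ψ a = InducedModule.tmul _ _ (a : IwahoriHecke k n F ϖ) 1 :=
    ⟨InducedModule.of _ _ ∘ₗ θ.range.val.toLinearMap, fun a => InducedModule.of_apply _ _ _⟩
  -- After composition with `Θ`, the map `a ↦ a ⊗ 1` becomes `θ(x) ↦ θ(x) 1_K`, whose bijectivity is
  -- `hβ`.
  have hΘψ : ∀ a : θ.range, Θ (ψ a) = (a : IwahoriHecke k n F ϖ) • sphericalVector k n ϖ :=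
    fun a => (congrArg Θ (hψ a)).trans (hΘ _)
  have hbij : Function.Bijective ψ := by
    constructor
    · rintro ⟨_, x, rfl⟩ ⟨_, y, rfl⟩ h
      have h1 := congrArg Θ h
      rw [hΘψ, hΘψ] at h1
      rw [hβ.1 h1]
    · intro y
      obtain ⟨x, hx⟩ := hβ.2 (Θ y)
      exact ⟨θ.rangeRestrict x, Θ.injective ((hΘψ _).trans hx)⟩
  refine ⟨LinearEquiv.ofBijective ψ hbij, hψ, fun h a => ?_⟩
  have e : ψ ((LinearEquiv.ofBijective ψ hbij).symm (h • ψ a)) = h • ψ a :=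
    (LinearEquiv.ofBijective ψ hbij).apply_symm_apply _
  exact (hΘψ _).symm.trans ((congrArg Θ e).trans
    ((map_smul Θ h (ψ a)).trans (congrArg (h • ·) (hΘψ a))))

end Main

end

section

open Matrix

/-! ### The symmetric group acting on Laurent polynomials. -/

section WeightPerm

variable (k : Type*) [Field k] {n : ℕ}

/-- The action of a permutation on `k[Λ]`. -/
def weightPerm (σ : Equiv.Perm (Fin n)) :
    AddMonoidAlgebra k (Fin n → ℤ) ≃ₐ[k] AddMonoidAlgebra k (Fin n → ℤ) :=
  AddMonoidAlgebra.domCongr k k (LinearEquiv.funCongrLeft ℤ ℤ σ⁻¹).toAddEquiv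

theorem weightPerm_single (σ : Equiv.Perm (Fin n)) (μ : Fin n → ℤ) (c : k) :
    weightPerm k σ (AddMonoidAlgebra.single μ c) =
      AddMonoidAlgebra.single (μ ∘ (σ⁻¹ : Equiv.Perm (Fin n))) c :=
  AddMonoidAlgebra.domCongr_single _ _ _

theorem weightPerm_one (x : AddMonoidAlgebra k (Fin n → ℤ)) :
    weightPerm k (1 : Equiv.Perm (Fin n)) x = x := by
  apply AddMonoidAlgebra.ext
  ext μ
  exact AddMonoidAlgebra.coeff_domCongr _ _ _

theorem weightPerm_mul (σ τ : Equiv.Perm (Fin n)) (x : AddMonoidAlgebra k (Fin n → ℤ)) :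
    weightPerm k (σ * τ) x = weightPerm k σ (weightPerm k τ x) := by
  apply AddMonoidAlgebra.ext
  ext μ
  simp only [weightPerm, AddMonoidAlgebra.coeff_domCongr]
  rfl

/-- The variable `x_i` of `k[Λ]`. -/
def weightVar (i : Fin n) : AddMonoidAlgebra k (Fin n → ℤ) :=
  AddMonoidAlgebra.single (Pi.single i 1) 1

theorem weightPerm_var (σ : Equiv.Perm (Fin n)) (i : Fin n) :
    weightPerm k σ (weightVar k i) = weightVar k (σ i) := by
  rw [weightVar, weightPerm_single, weightVar]
  congr 1
  funext j
  rw [Function.comp_apply, Pi.single_apply, Pi.single_apply]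
  congr 1
  rw [Equiv.Perm.inv_eq_iff_eq]

theorem weightVar_pow (i : Fin n) (m : ℕ) :
    weightVar k i ^ m = AddMonoidAlgebra.single (Pi.single i (m : ℤ)) 1 := by
  rw [weightVar, AddMonoidAlgebra.single_pow, one_pow]
  congr 1
  rw [← Pi.single_smul]
  simp

variable (n) in
/-- The subalgebra of symmetric Laurent polynomials. -/
def symmetricAlg : Subalgebra k (AddMonoidAlgebra k (Fin n → ℤ)) where
  carrier := {x | ∀ σ, weightPerm k σ x = x}
  mul_mem' hx hy σ := by rw [map_mul, hx, hy]
  add_mem' hx hy σ := by rw [map_add, hx, hy]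
  algebraMap_mem' c σ := AlgEquiv.commutes _ c

theorem mem_symmetricAlg_of_adjacent {x : AddMonoidAlgebra k (Fin n → ℤ)}
    (h : ∀ a b : Fin n, (b : ℕ) = a + 1 → weightPerm k (Equiv.swap a b) x = x) :
    x ∈ symmetricAlg k n :=
  perm_induction_adjacent (P := fun σ => weightPerm k σ x = x) (weightPerm_one k x)
    (fun σ τ hσ hτ => by rw [weightPerm_mul, hτ, hσ]) h

end WeightPerm

/-! ### The Bernstein relation. -/

section BernsteinRelation

variable {k : Type*} [Field k] {n : ℕ} {O F : Type*} [CommRing O] [Field F] [Algebra O F]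
  {t : Fˣ} {ϖ : O} [IsDomain O] [IsDiscreteValuationRing O] [IsFractionRing O F]
  [Finite (O ⧸ Ideal.span {ϖ})] {s : k}
  {θ : AddMonoidAlgebra k (Fin n → ℤ) →ₐ[k] IwahoriHecke k n F ϖ}

theorem comp_swap_eq {a b : Fin n} {μ : Fin n → ℤ} (h : μ a = μ b) :
    μ ∘ Equiv.swap a b = μ := by
  funext i
  rcases swap_apply_cases (a := a) (b := b) i with h1 | h1 | h1
  · rw [Function.comp_apply, h1.2, h1.1, h]
  · rw [Function.comp_apply, h1.2, h1.1, h]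
  · rw [Function.comp_apply, h1.2.2]

/-- This writes a weight on the wall of `s` as a difference of two dominant weights on the same
wall. -/
theorem exists_dominant_wall (a b : Fin n) (hab : (b : ℕ) = a + 1) {ν : Fin n → ℤ}
    (hν : ν a = ν b) : ∃ β : Fin n → ℤ, Antitone β ∧ β a = β b ∧ Antitone (β + ν) := by
  obtain ⟨N, hN⟩ := (eventually_sub_le ν).exists
  have key : ∀ i j : Fin n, i < j → (i = a ∧ j = b) ∨
      ((i : ℤ) + (if i ≤ a then 1 else 0)) + 1 ≤ (j : ℤ) + (if j ≤ a then 1 else 0) := by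
    intro i j hij
    have h1 : (i : ℕ) < j := hij
    simp only [Fin.le_def, Fin.ext_iff]
    split_ifs <;> omega
  have hanti : ∀ i j : Fin n, i < j → (i = a ∧ j = b) ∨
      (N : ℤ) ≤ -((N : ℤ) * (i + if i ≤ a then 1 else 0)) -
        -((N : ℤ) * (j + if j ≤ a then 1 else 0)) := fun i j hij => by
    refine (key i j hij).imp id fun h => ?_
    have := mul_le_mul_of_nonneg_left h (Int.natCast_nonneg N)
    linarith
  have hwall : -((N : ℤ) * ((a : ℤ) + if a ≤ a then 1 else 0)) =
      -((N : ℤ) * ((b : ℤ) + if b ≤ a then 1 else 0)) := by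
    have : ¬ b ≤ a := by rw [Fin.le_def]; omega
    rw [if_pos le_rfl, if_neg this, hab]
    push_cast
    ring
  -- A staircase of step `N` with one flat step: the shift by one up to `a` makes the values at `a`
  -- and `a + 1` equal, and all other gaps are at least `N`.
  refine ⟨fun i => -((N : ℤ) * (i + if i ≤ a then 1 else 0)), fun i j hij => ?_, hwall,
    fun i j hij => ?_⟩
  · rcases hij.lt_or_eq with h | rfl
    · rcases hanti i j h with ⟨rfl, rfl⟩ | h1
      · exact hwall.ge
      · have := Int.natCast_nonneg N
        simp only
        omega
    · exact le_rfl
  · rcases hij.lt_or_eq with h | rfl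
    · rw [Pi.add_apply, Pi.add_apply]
      rcases hanti i j h with ⟨rfl, rfl⟩ | h1
      · rw [hν]
        exact add_le_add hwall.ge le_rfl
      · have := hN j i
        omega
    · exact le_rfl

/-- On the wall `s` commutes with `t^μ`, and lengths add on both sides, so both products are the
indicator of the same double coset. -/
theorem commute_swap_dominant (hϖ : Irreducible ϖ) (ht : (t : F) = algebraMap O F ϖ) {a b : Fin n}
    (hab : (b : ℕ) = a + 1) (hθ : IsBernstein t s θ) {μ : Fin n → ℤ} (hμ : Antitone μ)
    (hw : μ a = μ b) : Commute (heckeMonomial k ϖ t (Equiv.swap a b) 0)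
      (θ (AddMonoidAlgebra.single μ 1)) := by
  have hlt : a < b := by rw [Fin.lt_def]; omega
  have h1 := heckeMonomial_swap_mul k hϖ ht hab 1 μ (by
    simp [iwLevel_of_lt hlt, hw])
  have h2 := heckeMonomial_mul_swap k hϖ ht hab 1 μ (by
    simp [iwLevel_of_lt hlt, hw])
  rw [mul_one] at h1
  rw [one_mul, comp_swap_eq hw] at h2
  rw [hθ μ hμ, diagPow_eq_monomialGL]
  exact Commute.smul_right (h1.trans h2.symm) _

theorem commute_swap_single (hϖ : Irreducible ϖ) (ht : (t : F) = algebraMap O F ϖ) {a b : Fin n}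
    (hab : (b : ℕ) = a + 1) (hθ : IsBernstein t s θ) {μ : Fin n → ℤ}
    (hw : μ a = μ b) : Commute (heckeMonomial k ϖ t (Equiv.swap a b) 0)
      (θ (AddMonoidAlgebra.single μ 1)) := by
  obtain ⟨β, hβ, hβw, hβμ⟩ := exists_dominant_wall a b hab hw
  have h1 := commute_swap_dominant hϖ ht hab hθ hβ hβw
  have h2 := commute_swap_dominant hϖ ht hab hθ hβμ (by
    rw [Pi.add_apply, Pi.add_apply, hβw, hw])
  have e1 : θ (AddMonoidAlgebra.single (-β) 1) * θ (AddMonoidAlgebra.single β 1) = 1 := by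
    rw [← map_mul, AddMonoidAlgebra.single_mul_single, neg_add_cancel, mul_one]
    exact map_one θ
  have e2 : θ (AddMonoidAlgebra.single β 1) * θ (AddMonoidAlgebra.single (-β) 1) = 1 := by
    rw [← map_mul, AddMonoidAlgebra.single_mul_single, add_neg_cancel, mul_one]
    exact map_one θ
  have h3 : Commute (heckeMonomial k ϖ t (Equiv.swap a b) 0)
      (θ (AddMonoidAlgebra.single (-β) 1)) :=
    Commute.units_inv_right (u := ⟨_, _, e2, e1⟩) h1
  have h4 := h3.mul_right h2
  rwa [← map_mul, AddMonoidAlgebra.single_mul_single, neg_add_cancel_left, mul_one] at h4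

theorem twoRho_single (i : Fin n) : twoRho (Pi.single i (1 : ℤ)) = n - 1 - 2 * i := by
  have h : ∀ j ∈ Finset.univ, ∑ l ∈ Finset.Ioi j, (Pi.single i (1 : ℤ) : Fin n → ℤ) l =
      if j < i then 1 else 0 := fun j _ => by
    simp only [Pi.single_apply]
    rw [Finset.sum_ite_eq']
    simp
  rw [twoRho]
  simp only [Finset.sum_sub_distrib]
  rw [Finset.sum_congr rfl h, Finset.sum_eq_single i]
  · rw [Finset.sum_const, Pi.single_eq_same, Fin.card_Ioi, ← Finset.sum_filter, Finset.sum_const]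
    have e : (Finset.univ.filter fun j => j < i) = Finset.Iio i := by ext; simp
    rw [e, Fin.card_Iio]
    simp
    omega
  · intro j _ hj
    rw [Finset.sum_const, Pi.single_eq_of_ne hj, smul_zero]
  · simp

/-- Let `μ` have the value `1` up to `a` and `0` afterwards. Length additivity gives `T_s [I s t^μ
I] = [I t^μ I]` and `[I t^μ I] [I s t^μ I] = [I t^λ I] T_s` with `λ = μ + sμ`. Cancelling `θ(μ)`
yields `T_s θ(sμ) T_s = q θ(μ)`. The common part `κ` of `μ` and `sμ` lies on the wall, so its image
commutes with `T_s` and cancels. -/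
theorem swap_mul_var_mul_swap (hϖ : Irreducible ϖ) (ht : (t : F) = algebraMap O F ϖ) {a b : Fin n}
    (hab : (b : ℕ) = a + 1) (hs0 : s ≠ 0)
    (hs : s ^ 2 = (Nat.card (O ⧸ Ideal.span {ϖ}) : k)) (hθ : IsBernstein t s θ) :
    heckeMonomial k ϖ t (Equiv.swap a b) 0 * θ (weightVar k b) *
      heckeMonomial k ϖ t (Equiv.swap a b) 0 =
      (Nat.card (O ⧸ Ideal.span {ϖ}) : k) • θ (weightVar k a) := by
  have hlt : a < b := by rw [Fin.lt_def]; omega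
  let μ : Fin n → ℤ := fun i => if i ≤ a then 1 else 0
  have hμa : μ a = 1 := if_pos le_rfl
  have hμb : μ b = 0 := if_neg (not_le_of_gt hlt)
  have hμ : Antitone μ := fun i j hij => by
    simp only [μ]
    split_ifs with h1 h2
    · exact le_rfl
    · exact absurd (hij.trans h1) h2
    · exact zero_le_one
    · exact le_rfl
  let κ : Fin n → ℤ := μ - Pi.single a 1
  have hκa : κ a = 0 := by simp [κ, hμa]
  have hκb : κ b = 0 := by simp [κ, hμb, hlt.ne']
  have hκ : κ a = κ b := hκa.trans hκb.symm
  have hμκ : μ = κ + Pi.single a 1 := by simp [κ]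
  have hsμ : μ ∘ Equiv.swap a b = κ + Pi.single b 1 := by
    funext i
    rw [hμκ, Pi.add_apply]
    rcases swap_apply_cases (a := a) (b := b) i with h1 | h1 | h1
    · rw [Function.comp_apply, h1.2, h1.1]; simp [hlt.ne', hlt.ne, hκ]
    · rw [Function.comp_apply, h1.2, h1.1]; simp [hκ]
    · rw [Function.comp_apply, h1.2.2]; simp [h1.1, h1.2.1]
  let lam : Fin n → ℤ := μ ∘ Equiv.swap a b + μ
  have hlam : lam a = lam b := by simp [lam, add_comm]
  have hlamd : Antitone lam := by
    have : ∀ i, lam i = if i < a then 2 else if i ≤ b then 1 else 0 := fun i => by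
      simp only [lam, Pi.add_apply, Function.comp_apply]
      rcases swap_apply_cases (a := a) (b := b) i with h1 | h1 | h1
      · rw [h1.2, h1.1, hμa, hμb, if_neg (lt_irrefl _), if_pos hlt.le]; rfl
      · rw [h1.2, h1.1, hμa, hμb, if_neg hlt.not_gt, if_pos le_rfl]; rfl
      · rw [h1.2.2]
        simp only [μ, Fin.le_def, Fin.lt_def]
        have h2 : (i : ℕ) ≠ a := fun h => h1.1 (Fin.ext h)
        have h3 : (i : ℕ) ≠ b := fun h => h1.2.1 (Fin.ext h)
        split_ifs <;> omega
    intro i j hij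
    rw [this, this]
    simp only [Fin.le_def, Fin.lt_def]
    have : (i : ℕ) ≤ j := hij
    split_ifs <;> omega
  have h1 := heckeMonomial_swap_mul k hϖ ht hab (Equiv.swap a b) μ (by
    rw [Equiv.swap_inv, Equiv.swap_apply_left, Equiv.swap_apply_right, iwLevel_of_gt hlt, hμa, hμb]
    norm_num)
  rw [Equiv.swap_mul_self] at h1
  have h2 := heckeMonomial_dominant_mul k hϖ ht (Equiv.swap a b) hμ (μ := μ) (fun i j hij => by
    rcases le_or_gt i j with h | h
    · have h3 := hμ h
      have h4 := iwLevel_nonneg i j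
      omega
    · rw [iwLevel_of_gt h]
      have h3 : μ j ≤ 1 := by simp only [μ]; split_ifs <;> norm_num
      have h4 : 0 ≤ μ i := by simp only [μ]; split_ifs <;> norm_num
      omega)
  have h3 := heckeMonomial_mul_swap k hϖ ht hab 1 lam (by
    simp [iwLevel_of_lt hlt, hlam])
  rw [one_mul, comp_swap_eq hlam] at h3
  have h4 := h2.trans h3.symm
  have hA := hθ μ hμ
  have hL := hθ lam hlamd
  rw [diagPow_eq_monomialGL] at hA hL
  have hsum : θ (AddMonoidAlgebra.single μ 1) * θ (AddMonoidAlgebra.single (κ + Pi.single b 1) 1) =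
      θ (AddMonoidAlgebra.single lam 1) := by
    rw [← map_mul, AddMonoidAlgebra.single_mul_single, mul_one, ← hsμ, add_comm]
  -- Here `lam = 2μ - (e_a - e_b)`, and `e_a - e_b` pairs to `2` with `2ρ`. This defect produces the
  -- factor `s ^ 2 = q`.
  have hrho : twoRho lam = twoRho μ + twoRho μ - 2 := by
    have e : lam + Pi.single a 1 = μ + μ + Pi.single b 1 := by
      have : lam = κ + Pi.single b 1 + μ := by simp only [lam, hsμ]
      rw [this, hμκ]
      abel
    have := congrArg twoRho e
    rw [twoRho_add lam, twoRho_add (μ + μ), twoRho_add μ, twoRho_single, twoRho_single, hab] at this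
    push_cast at this
    linarith
  generalize hT : heckeMonomial k ϖ t (Equiv.swap a b) 0 = T at *
  have h5 : T * (θ (AddMonoidAlgebra.single (κ + Pi.single b 1) 1) * T) =
      (Nat.card (O ⧸ Ideal.span {ϖ}) : k) • θ (AddMonoidAlgebra.single μ 1) := by
    have hunit : IsUnit (θ (AddMonoidAlgebra.single μ 1)) := by
      refine IsUnit.map θ ⟨⟨AddMonoidAlgebra.single μ 1, AddMonoidAlgebra.single (-μ) 1, ?_, ?_⟩,
        rfl⟩
      · rw [AddMonoidAlgebra.single_mul_single, add_neg_cancel, mul_one]; rfl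
      · rw [AddMonoidAlgebra.single_mul_single, neg_add_cancel, mul_one]; rfl
    have h6 : θ (AddMonoidAlgebra.single (κ + Pi.single b 1) 1) * T =
        (s ^ 2 * s ^ (-twoRho μ)) • heckeMonomial k ϖ t (Equiv.swap a b) μ := by
      apply hunit.mul_left_cancel
      rw [← mul_assoc, hsum, hL, smul_mul_assoc, ← h4, hA, mul_smul_comm, smul_mul_assoc,
        smul_smul, hrho]
      congr 1
      rw [← zpow_natCast s 2, ← zpow_add₀ hs0, ← zpow_add₀ hs0]
      congr 1
      push_cast
      ring
    rw [h6, mul_smul_comm, h1, hA, smul_smul, hs]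
  have hκT : Commute T (θ (AddMonoidAlgebra.single κ 1)) := by
    rw [← hT]
    exact commute_swap_single hϖ ht hab hθ hκ
  have e : ∀ i, θ (AddMonoidAlgebra.single (κ + Pi.single i 1) 1) =
      θ (AddMonoidAlgebra.single κ 1) * θ (weightVar k i) := fun i => by
    rw [weightVar, ← map_mul, AddMonoidAlgebra.single_mul_single, mul_one]
  rw [e, hμκ, e, ← mul_assoc, ← mul_assoc, hκT.eq, mul_assoc, mul_assoc, ← mul_smul_comm] at h5
  have hunit : IsUnit (θ (AddMonoidAlgebra.single κ 1)) := by
    refine IsUnit.map θ ⟨⟨AddMonoidAlgebra.single κ 1, AddMonoidAlgebra.single (-κ) 1, ?_, ?_⟩,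
      rfl⟩
    · rw [AddMonoidAlgebra.single_mul_single, add_neg_cancel, mul_one]; rfl
    · rw [AddMonoidAlgebra.single_mul_single, neg_add_cancel, mul_one]; rfl
  rw [mul_assoc]
  exact hunit.mul_left_cancel h5

/-- The Bernstein relation for a simple reflection. -/
theorem swap_mul_eq (hϖ : Irreducible ϖ) (ht : (t : F) = algebraMap O F ϖ) {a b : Fin n}
    (hab : (b : ℕ) = a + 1) (hs0 : s ≠ 0)
    (hs : s ^ 2 = (Nat.card (O ⧸ Ideal.span {ϖ}) : k)) (hθ : IsBernstein t s θ)
    (x : AddMonoidAlgebra k (Fin n → ℤ)) :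
    ∃ y, (weightVar k a - weightVar k b) * y =
        weightVar k a * (x - weightPerm k (Equiv.swap a b) x) ∧
      heckeMonomial k ϖ t (Equiv.swap a b) 0 * θ x =
        θ (weightPerm k (Equiv.swap a b) x) * heckeMonomial k ϖ t (Equiv.swap a b) 0 +
          ((Nat.card (O ⧸ Ideal.span {ϖ}) : k) - 1) • θ y := by
  have hq0 : (Nat.card (O ⧸ Ideal.span {ϖ}) : k) ≠ 0 := by rw [← hs]; exact pow_ne_zero _ hs0
  have hsq := heckeMonomial_swap_sq (F := F) k hϖ ht hab
  have hTB := swap_mul_var_mul_swap hϖ ht hab hs0 hs hθ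
  have hcomm : ∀ {μ : Fin n → ℤ}, μ a = μ b → Commute (heckeMonomial k ϖ t (Equiv.swap a b) 0)
      (θ (AddMonoidAlgebra.single μ 1)) := fun h => commute_swap_single hϖ ht hab hθ h
  obtain ⟨u, hu⟩ := isUnit_heckeMonomial_swap (F := F) k hϖ ht hab (isUnit_iff_ne_zero.2 hq0)
  generalize heckeMonomial k ϖ t (Equiv.swap a b) 0 = T at *
  generalize (Nat.card (O ⧸ Ideal.span {ϖ}) : k) = q at *
  have hT1 : ∀ z : IwahoriHecke k n F ϖ, z * T * (T - (q - 1) • 1) = q • z := fun z => by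
    rw [mul_assoc, mul_sub, hsq, mul_smul_comm, mul_one, add_sub_cancel_left, mul_smul_comm,
      mul_one]
  have hT2 : ∀ z : IwahoriHecke k n F ϖ, (T - (q - 1) • 1) * (T * z) = q • z := fun z => by
    rw [← mul_assoc, sub_mul, hsq, smul_mul_assoc, one_mul, add_sub_cancel_left, smul_mul_assoc,
      one_mul]
  -- One factor `T` is removed from `T θ(x_b) T = q θ(x_a)` by means of `T (T - (q - 1)) = q`, on
  -- the right here and on the left for `hA`.
  have hB : T * θ (weightVar k b) = θ (weightVar k a) * T - (q - 1) • θ (weightVar k a) := by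
    have h := hT1 (T * θ (weightVar k b))
    rw [hTB, smul_mul_assoc, mul_sub, mul_smul_comm, mul_one] at h
    exact (smul_right_injective _ hq0 h).symm
  have hA : T * θ (weightVar k a) = θ (weightVar k b) * T + (q - 1) • θ (weightVar k a) := by
    have h := hT2 (θ (weightVar k b) * T)
    rw [← mul_assoc T, hTB, mul_smul_comm, sub_mul, smul_mul_assoc, one_mul] at h
    rw [← smul_right_injective _ hq0 h, sub_add_cancel]
  -- The correction term `y = x_a (x - s x) / (x_a - x_b)` obeys a twisted Leibniz rule, so the
  -- relation passes to products. It remains to check `x_a`, `x_b` and the monomials on the wall.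
  have hmul : ∀ x x', (∃ y, (weightVar k a - weightVar k b) * y =
        weightVar k a * (x - weightPerm k (Equiv.swap a b) x) ∧
      T * θ x = θ (weightPerm k (Equiv.swap a b) x) * T + (q - 1) • θ y) →
      (∃ y, (weightVar k a - weightVar k b) * y =
        weightVar k a * (x' - weightPerm k (Equiv.swap a b) x') ∧
      T * θ x' = θ (weightPerm k (Equiv.swap a b) x') * T + (q - 1) • θ y) →
      (∃ y, (weightVar k a - weightVar k b) * y =
        weightVar k a * (x * x' - weightPerm k (Equiv.swap a b) (x * x')) ∧
      T * θ (x * x') = θ (weightPerm k (Equiv.swap a b) (x * x')) * T + (q - 1) • θ y) := by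
    rintro x x' ⟨y, hy, h⟩ ⟨y', hy', h'⟩
    refine ⟨weightPerm k (Equiv.swap a b) x * y' + y * x', ?_, ?_⟩
    · rw [map_mul]
      linear_combination weightPerm k (Equiv.swap a b) x * hy' + x' * hy
    · rw [map_mul, map_mul, ← mul_assoc, h, add_mul, mul_assoc, h', map_mul, map_add, map_mul,
        map_mul, mul_add, ← mul_assoc, mul_smul_comm, smul_mul_assoc, smul_add, add_assoc]
  have hinv : ∀ {μ : Fin n → ℤ}, μ a = μ b → ∃ y, (weightVar k a - weightVar k b) * y =
        weightVar k a * (AddMonoidAlgebra.single μ 1 -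
          weightPerm k (Equiv.swap a b) (AddMonoidAlgebra.single μ 1)) ∧
      T * θ (AddMonoidAlgebra.single μ 1) =
        θ (weightPerm k (Equiv.swap a b) (AddMonoidAlgebra.single μ 1)) * T + (q - 1) • θ y :=
    fun {μ} h => ⟨0, by
      rw [weightPerm_single, Equiv.swap_inv, comp_swap_eq h, sub_self, mul_zero, mul_zero], by
      rw [weightPerm_single, Equiv.swap_inv, comp_swap_eq h, map_zero, smul_zero, add_zero,
        (hcomm h).eq]⟩
  have hpow : ∀ i, (i = a ∨ i = b) → ∀ m : ℕ, ∃ y, (weightVar k a - weightVar k b) * y =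
        weightVar k a * (weightVar k i ^ m -
          weightPerm k (Equiv.swap a b) (weightVar k i ^ m)) ∧
      T * θ (weightVar k i ^ m) =
        θ (weightPerm k (Equiv.swap a b) (weightVar k i ^ m)) * T + (q - 1) • θ y := by
    intro i hi m
    induction m with
    | zero => exact hinv (μ := 0) rfl
    | succ m ih =>
      rw [pow_succ]
      refine hmul _ _ ih ?_
      rcases hi with rfl | rfl
      · refine ⟨weightVar k i, ?_, ?_⟩
        · rw [weightPerm_var, Equiv.swap_apply_left, mul_comm]
        · rw [weightPerm_var, Equiv.swap_apply_left, hA]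
      · refine ⟨-weightVar k a, ?_, ?_⟩
        · rw [weightPerm_var, Equiv.swap_apply_right]
          ring
        · rw [weightPerm_var, Equiv.swap_apply_right, hB, map_neg, smul_neg, sub_eq_add_neg]
  have hne : a ≠ b := fun h => by rw [h] at hab; omega
  induction x using AddMonoidAlgebra.induction_linear with
  | zero => exact ⟨0, by simp, by simp⟩
  | add x x' hx hx' =>
    obtain ⟨y, hy, h⟩ := hx
    obtain ⟨y', hy', h'⟩ := hx'
    refine ⟨y + y', ?_, ?_⟩
    · rw [map_add]
      linear_combination hy + hy'
    · rw [map_add, mul_add, h, h', map_add, map_add, map_add, add_mul, smul_add]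
      abel
  | single μ c =>
    have key : ∃ y, (weightVar k a - weightVar k b) * y =
        weightVar k a * (AddMonoidAlgebra.single μ 1 -
          weightPerm k (Equiv.swap a b) (AddMonoidAlgebra.single μ 1)) ∧
      T * θ (AddMonoidAlgebra.single μ 1) =
        θ (weightPerm k (Equiv.swap a b) (AddMonoidAlgebra.single μ 1)) * T + (q - 1) • θ y := by
      -- Taking for `i` the index of the larger coordinate makes the exponent nonnegative, so
      -- inverses of `x_a` and `x_b` need no separate treatment.
      have hex : ∃ i, (i = a ∨ i = b) ∧ ∃ m : ℕ, ∃ ν : Fin n → ℤ, ν a = ν b ∧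
          μ = ν + Pi.single i (m : ℤ) := by
        rcases le_total (μ b) (μ a) with h | h
        · refine ⟨a, Or.inl rfl, (μ a - μ b).toNat, μ - Pi.single a (μ a - μ b), ?_, ?_⟩
          · simp [hne.symm]
          · rw [Int.toNat_of_nonneg (sub_nonneg.2 h), sub_add_cancel]
        · refine ⟨b, Or.inr rfl, (μ b - μ a).toNat, μ - Pi.single b (μ b - μ a), ?_, ?_⟩
          · simp [hne]
          · rw [Int.toNat_of_nonneg (sub_nonneg.2 h), sub_add_cancel]
      obtain ⟨i, hi, m, ν, hν, rfl⟩ := hex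
      have e : (AddMonoidAlgebra.single (ν + Pi.single i (m : ℤ)) 1 :
          AddMonoidAlgebra k (Fin n → ℤ)) = AddMonoidAlgebra.single ν 1 * weightVar k i ^ m := by
        rw [weightVar_pow, AddMonoidAlgebra.single_mul_single, mul_one]
      rw [e]
      exact hmul _ _ (hinv hν) (hpow i hi m)
    obtain ⟨y, hy, h⟩ := key
    have e : (AddMonoidAlgebra.single μ c : AddMonoidAlgebra k (Fin n → ℤ)) =
        c • AddMonoidAlgebra.single μ 1 := by simp
    refine ⟨c • y, ?_, ?_⟩
    · rw [e, map_smul, mul_smul_comm, hy, ← smul_sub, mul_smul_comm]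
    · rw [e, map_smul, mul_smul_comm, h, smul_add, map_smul, map_smul, map_smul, smul_mul_assoc,
        smul_comm c]

end BernsteinRelation

/-! ### The image of the Satake homomorphism. -/

section SatakeImage

variable {k : Type*} [Field k] {n : ℕ} {O F : Type*} [CommRing O] [Field F] [Algebra O F]
  {t : Fˣ} {ϖ : O} [IsDomain O] [IsDiscreteValuationRing O] [IsFractionRing O F]
  [Finite (O ⧸ Ideal.span {ϖ})] {s : k}
  {θ : AddMonoidAlgebra k (Fin n → ℤ) →ₐ[k] IwahoriHecke k n F ϖ}

theorem swap_smul_of_fixed {V : Type*} [AddCommGroup V] [Module k V]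
    (hϖ : Irreducible ϖ) (ht : (t : F) = algebraMap O F ϖ)
    {a b : Fin n} (hab : (b : ℕ) = a + 1) (ρ : Representation k (GL (Fin n) F) V)
    (v : fixedVectors ρ (iwahori n F ϖ)) (hv : ∀ g ∈ maxCompact n O F, ρ g v = v) :
    (heckeMonomial k ϖ t (Equiv.swap a b) 0 : IwahoriHecke k n F ϖ) • v =
      (Nat.card (O ⧸ Ideal.span {ϖ}) : k) • v := by
  have horb := finite_orbit_monomialGL (n := n) hϖ ht (Equiv.swap a b) 0
  apply Subtype.ext
  rw [HeckeAlgebra.coe_doubleCoset_smul ρ v horb, ← card_orbit_swap hϖ ht hab,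
    Nat.card_eq_card_finite_toFinset horb, Finset.card_eq_sum_ones, Nat.cast_sum, Finset.sum_smul,
    Submodule.coe_sum]
  refine Finset.sum_congr rfl fun x hx => ?_
  obtain ⟨i, hi, rfl⟩ := mem_orbit_coset_iff.1 (horb.mem_toFinset.1 hx)
  rw [orbitMap_single, Nat.cast_one, one_smul, one_smul]
  exact hv _ (Subgroup.mul_mem _ (iwahori_le_maxCompact hi) (perm_mem_maxCompact _))

/-- The vector `(1 + T_s) v = (q + 1) v` is a sum over the cosets of the parahoric containing `s`,
hence is fixed by `s`. Division by `q + 1` gives the claim. -/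
theorem fixed_of_swap_smul {V : Type*} [AddCommGroup V] [Module k V]
    (hϖ : Irreducible ϖ) (ht : (t : F) = algebraMap O F ϖ)
    {a b : Fin n} (hab : (b : ℕ) = a + 1) (ρ : Representation k (GL (Fin n) F) V)
    (v : fixedVectors ρ (iwahori n F ϖ)) (hq1 : (Nat.card (O ⧸ Ideal.span {ϖ}) : k) + 1 ≠ 0)
    (hv : (heckeMonomial k ϖ t (Equiv.swap a b) 0 : IwahoriHecke k n F ϖ) • v =
      (Nat.card (O ⧸ Ideal.span {ϖ}) : k) • v) :
    ρ (monomialGL t (Equiv.swap a b) 0) v = v := by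
  obtain ⟨hfin, -, he⟩ := exists_heckeIndicator_parahoric (F := F) k hϖ ht hab
  have h1 : heckeIndicator k (iwahori_le_parahoric ht hab) hfin • v =
      ((Nat.card (O ⧸ Ideal.span {ϖ}) : k) + 1) • v := by
    rw [he, add_smul, one_smul, hv, add_smul, one_smul, add_comm]
  have h2 : ρ (monomialGL t (Equiv.swap a b) 0)
      (heckeIndicator k (iwahori_le_parahoric ht hab) hfin • v : fixedVectors ρ _) =
      (heckeIndicator k (iwahori_le_parahoric ht hab) hfin • v : fixedVectors ρ _) := by
    change ρ _ (orbitMap ρ v (subgroupIndicator k _ hfin)) =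
      orbitMap ρ v (subgroupIndicator k _ hfin)
    rw [← orbitMap_equivariant, mem_fixedVectors.1 (subgroupIndicator k _ hfin).2 _
      (swap_mem_parahoric ht hab)]
  rw [h1, Submodule.coe_smul, map_smul] at h2
  exact smul_right_injective _ hq1 h2

/-- `GL_n(O)` is generated by the Iwahori subgroup and the simple reflections. -/
theorem maxCompact_le_of_adjacent (hϖ : Irreducible ϖ) (ht : (t : F) = algebraMap O F ϖ)
    {S : Subgroup (GL (Fin n) F)} (hI : iwahori n F ϖ ≤ S)
    (hS : ∀ a b : Fin n, (b : ℕ) = a + 1 → monomialGL t (Equiv.swap a b) 0 ∈ S) :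
    maxCompact n O F ≤ S := fun g hg => by
  -- The triangularising matrix is taken in `S ∩ K`, so the triangular product stays in `K` and
  -- therefore lies in `I`.
  obtain ⟨κ, hκ, h⟩ := exists_mul_triangular hϖ ht (S := S ⊓ maxCompact n O F)
    (le_inf hI iwahori_le_maxCompact)
    (fun π => ⟨perm_mem_subgroup S hS π, perm_mem_maxCompact π⟩) g
  have h1 : g * κ ∈ iwahori n F ϖ :=
    (mem_iwahori_iff_lower ht).2 ⟨Subgroup.mul_mem _ hg hκ.2, fun i j hij => by
      rw [h i j hij]
      exact zero_mem _⟩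
  exact (Subgroup.mul_mem_cancel_right _ hκ.1).1 (hI h1)

theorem weightVar_sub_ne_zero {a b : Fin n} (hne : a ≠ b) (c d : k) (hc : c ≠ 0) :
    c • weightVar k a - d • weightVar k b ≠ 0 := fun h => by
  have h1 := congrArg (fun x => AddMonoidAlgebra.coeff x (Pi.single a 1)) h
  have h2 : (Pi.single b 1 : Fin n → ℤ) ≠ Pi.single a 1 := fun h2 => by
    have := congrFun h2 b
    rw [Pi.single_eq_same, Pi.single_eq_of_ne hne.symm] at this
    exact one_ne_zero this
  simp only [weightVar, sub_eq_add_neg, AddMonoidAlgebra.coeff_add, Finsupp.add_apply] at h1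
  rw [← neg_smul, AddMonoidAlgebra.coeff_smul, AddMonoidAlgebra.coeff_smul, Finsupp.smul_apply,
    Finsupp.smul_apply, AddMonoidAlgebra.coeff_single, AddMonoidAlgebra.coeff_single,
    Finsupp.single_eq_same, Finsupp.single_eq_of_ne h2.symm] at h1
  simp [hc] at h1

/-- As `T_s 1_K = q 1_K`, the Bernstein relation expresses the eigenvalue equation inside `k[Λ]`.
Multiplied by `x_a - x_b` it reads `(x - s x)(x_a - q x_b) = 0`, and `k[Λ]` is a domain. -/
theorem swap_smul_bernsteinMap_iff (hϖ : Irreducible ϖ) (ht : (t : F) = algebraMap O F ϖ)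
    {a b : Fin n} (hab : (b : ℕ) = a + 1) (hs0 : s ≠ 0)
    (hs : s ^ 2 = (Nat.card (O ⧸ Ideal.span {ϖ}) : k)) (hθ : IsBernstein t s θ)
    (x : AddMonoidAlgebra k (Fin n → ℤ)) :
    (heckeMonomial k ϖ t (Equiv.swap a b) 0 : IwahoriHecke k n F ϖ) • bernsteinMap θ x =
      (Nat.card (O ⧸ Ideal.span {ϖ}) : k) • bernsteinMap θ x ↔
    weightPerm k (Equiv.swap a b) x = x := by
  have hne : a ≠ b := fun h => by rw [h] at hab; omega
  obtain ⟨y, hy, hT⟩ := swap_mul_eq hϖ ht hab hs0 hs hθ x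
  have h1 : (heckeMonomial k ϖ t (Equiv.swap a b) 0 : IwahoriHecke k n F ϖ) • bernsteinMap θ x =
      bernsteinMap θ ((Nat.card (O ⧸ Ideal.span {ϖ}) : k) • weightPerm k (Equiv.swap a b) x +
        ((Nat.card (O ⧸ Ideal.span {ϖ}) : k) - 1) • y) := by
    rw [bernsteinMap_apply, ← mul_smul, hT, add_smul, mul_smul,
      swap_smul_of_fixed hϖ ht hab _ (sphericalVector k n ϖ) fun g hg => ?_, map_add, map_smul,
      map_smul, smul_assoc, smul_comm (θ _) (_ : k), bernsteinMap_apply, bernsteinMap_apply]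
    rw [coe_unitCoset, cosetRep_single]
    congr 1
    rw [smul_mk_coset, mul_one, eq_comm, QuotientGroup.eq]
    simpa using hg
  rw [h1, ← map_smul (bernsteinMap θ), (bernsteinMap_bijective hϖ ht hs0 hs hθ).1.eq_iff]
  generalize (Nat.card (O ⧸ Ideal.span {ϖ}) : k) = q at *
  constructor
  · intro h
    have h2 : (x - weightPerm k (Equiv.swap a b) x) *
        ((1 : k) • weightVar k a - q • weightVar k b) = 0 := by
      have h3 : (weightVar k a - weightVar k b) * (q • weightPerm k (Equiv.swap a b) x +
          (q - 1) • y) = (weightVar k a - weightVar k b) * (q • x) := by rw [h]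
      rw [mul_add, mul_smul_comm _ (weightVar k a - weightVar k b) y, hy] at h3
      simp only [Algebra.smul_def, map_sub, map_one] at h3 ⊢
      linear_combination -h3
    rcases mul_eq_zero.1 h2 with h3 | h3
    · exact (sub_eq_zero.1 h3).symm
    · exact absurd h3 (weightVar_sub_ne_zero hne 1 q one_ne_zero)
  · intro h
    rw [h, sub_self, mul_zero] at hy
    have h3 : weightVar k a - weightVar k b ≠ 0 := by
      have := weightVar_sub_ne_zero (k := k) hne 1 1 one_ne_zero
      rwa [one_smul, one_smul] at this
    rw [h, (mul_eq_zero.1 hy).resolve_left h3, smul_zero, add_zero]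

/-- The image of the Satake homomorphism is the algebra of symmetric Laurent polynomials. -/
theorem range_satake (hϖ : Irreducible ϖ) (ht : (t : F) = algebraMap O F ϖ)
    (hs0 : s ≠ 0) (hs : s ^ 2 = (Nat.card (O ⧸ Ideal.span {ϖ}) : k)) (hθ : IsBernstein t s θ)
    (hq1 : 2 ≤ n → (Nat.card (O ⧸ Ideal.span {ϖ}) : k) + 1 ≠ 0) :
    (satake hϖ ht hs0 hs hθ).range = symmetricAlg k n := by
  ext x
  constructor
  · rintro ⟨z, rfl⟩
    refine mem_symmetricAlg_of_adjacent k fun a b hab => ?_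
    rw [← swap_smul_bernsteinMap_iff hϖ ht hab hs0 hs hθ]
    change _ • bernsteinMap θ (satake hϖ ht hs0 hs hθ z) =
      _ • bernsteinMap θ (satake hϖ ht hs0 hs hθ z)
    rw [bernsteinMap_satake]
    exact swap_smul_of_fixed hϖ ht hab _ _ (mem_fixedVectors.1 z.2)
  · intro hx
    have hfix : ∀ g ∈ maxCompact n O F, cosetRep k (maxCompact n O F) g (bernsteinMap θ x) =
        (bernsteinMap θ x).val := by
      -- The stabiliser of the vector contains `I` and, by the eigenvalue criterion, the simple
      -- reflections, hence all of `K`.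
      let S : Subgroup (GL (Fin n) F) :=
        { carrier := {g | cosetRep k (maxCompact n O F) g (bernsteinMap θ x) =
            (bernsteinMap θ x).val}
          mul_mem' := fun {g h} hg hh => by
            change cosetRep k _ (g * h) _ = _
            rw [map_mul, Module.End.mul_apply, hh, hg]
          one_mem' := by
            change cosetRep k _ 1 _ = _
            rw [map_one]
            rfl
          inv_mem' := fun {g} hg => by
            change cosetRep k _ g⁻¹ _ = _
            conv_lhs => rw [← (hg : cosetRep k _ g _ = _)]
            rw [← Module.End.mul_apply, ← map_mul, inv_mul_cancel, map_one]
            rfl }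
      refine maxCompact_le_of_adjacent hϖ ht (S := S) (fun g hg =>
        mem_fixedVectors.1 (bernsteinMap θ x).2 g hg) fun a b hab => ?_
      exact fixed_of_swap_smul hϖ ht hab _ _ (hq1 (by omega))
        ((swap_smul_bernsteinMap_iff hϖ ht hab hs0 hs hθ x).2 (hx _))
    refine ⟨⟨(bernsteinMap θ x).val, mem_fixedVectors.2 hfix⟩,
      (bernsteinMap_bijective hϖ ht hs0 hs hθ).1 ?_⟩
    exact bernsteinMap_satake hϖ ht hs0 hs hθ _

end SatakeImage

end

open Polynomial

/-! ### Bases of subrings over subrings, by adjoining roots. -/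

section FreeBasis

variable {A : Type*} [CommRing A]

/-- `v` is a basis of `C` over `B`. -/
structure IsFreeBasis (B C : Subring A) {ι : Type} [Fintype ι] (v : ι → A) : Prop where
  mem_iff : ∀ c, c ∈ C ↔ ∃ r : ι → A, (∀ i, r i ∈ B) ∧ ∑ i, r i * v i = c
  indep : ∀ r : ι → A, (∀ i, r i ∈ B) → ∑ i, r i * v i = 0 → r = 0

theorem IsFreeBasis.trans {B C D : Subring A} {ι κ : Type} [Fintype ι] [Fintype κ] {v : ι → A}
    {w : κ → A} (h : IsFreeBasis B C v) (h' : IsFreeBasis C D w) :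
    IsFreeBasis B D fun p : ι × κ => v p.1 * w p.2 := by
  have key : ∀ r : ι × κ → A, ∑ p, r p * (v p.1 * w p.2) = ∑ j, (∑ i, r (i, j) * v i) * w j :=
    fun r => by
      rw [Fintype.sum_prod_type_right]
      refine Finset.sum_congr rfl fun j _ => ?_
      rw [Finset.sum_mul]
      exact Finset.sum_congr rfl fun i _ => (mul_assoc _ _ _).symm
  refine ⟨fun d => ?_, fun r hr h0 => ?_⟩
  · rw [h'.mem_iff]
    constructor
    · rintro ⟨c, hc, rfl⟩
      choose r hr hrc using fun j => (h.mem_iff _).1 (hc j)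
      refine ⟨fun p => r p.2 p.1, fun p => hr _ _, ?_⟩
      rw [key]
      exact Finset.sum_congr rfl fun j _ => by rw [← hrc j]
    · rintro ⟨r, hr, rfl⟩
      exact ⟨fun j => ∑ i, r (i, j) * v i, fun j => (h.mem_iff _).2 ⟨_, fun i => hr _, rfl⟩,
        (key r).symm⟩
  · rw [key] at h0
    have h1 := h'.indep _ (fun j => (h.mem_iff _).2 ⟨_, fun i => hr (i, j), rfl⟩) h0
    funext p
    exact congrFun (h.indep _ (fun i => hr (i, p.2)) (congrFun h1 p.2)) p.1

/-- The subring generated by `B` and `e`. -/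
def adjoinElem (B : Subring A) (e : A) : Subring A := (Polynomial.eval₂RingHom B.subtype e).range

theorem le_adjoinElem (B : Subring A) (e : A) : B ≤ adjoinElem B e := fun b hb =>
  ⟨Polynomial.C ⟨b, hb⟩, by simp⟩

theorem self_mem_adjoinElem (B : Subring A) (e : A) : e ∈ adjoinElem B e :=
  ⟨Polynomial.X, by simp⟩

/-- The powers of a root of a monic polynomial with enough conjugates form a basis. -/
theorem isFreeBasis_pow [IsDomain A] {B : Subring A} {e : A} {g : B[X]} (hg : g.Monic)
    (hge : Polynomial.eval₂ B.subtype e g = 0) (c : Fin g.natDegree → A)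
    (hc : Function.Injective c)
    (hconj : ∀ i, ∃ σ : A →+* A, (∀ b ∈ B, σ b = b) ∧ σ e = c i) :
    IsFreeBasis B (adjoinElem B e) fun i : Fin g.natDegree => e ^ (i : ℕ) := by
  refine ⟨fun x => ?_, fun r hr h0 => ?_⟩
  · constructor
    · rintro ⟨p, rfl⟩
      have h1 : Polynomial.eval₂ B.subtype e p = Polynomial.eval₂ B.subtype e (p %ₘ g) := by
        conv_lhs => rw [← Polynomial.modByMonic_add_div p g]
        rw [Polynomial.eval₂_add, Polynomial.eval₂_mul, hge, zero_mul, add_zero]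
      refine ⟨fun i => ((p %ₘ g).coeff i : A), fun i => ((p %ₘ g).coeff i).2, ?_⟩
      rw [Polynomial.coe_eval₂RingHom, h1]
      by_cases hg1 : g = 1
      · rw [hg1, Polynomial.modByMonic_one]
        simp
      · rw [Polynomial.eval₂_eq_sum_range' _ (Polynomial.natDegree_modByMonic_lt p hg hg1),
          Finset.sum_range]
        rfl
    · rintro ⟨r, hr, rfl⟩
      exact sum_mem fun i _ => mul_mem (le_adjoinElem B e (hr i))
        (pow_mem (self_mem_adjoinElem B e) _)
  · let P : A[X] := ∑ i : Fin g.natDegree, Polynomial.C (r i) * Polynomial.X ^ (i : ℕ)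
    -- The automorphisms in `hconj` fix the coefficients of `P` and move `e` to each `c i`. So `P`
    -- would have `natDegree g` distinct roots while its degree is smaller.
    have hP : P = 0 := by
      by_contra hne
      have hdeg : P.degree < g.natDegree := by
        rw [Polynomial.degree_lt_iff_coeff_zero]
        intro m hm
        simp only [P, Polynomial.finsetSum_coeff, Polynomial.coeff_C_mul, Polynomial.coeff_X_pow]
        refine Finset.sum_eq_zero fun i _ => ?_
        rw [if_neg (by have := i.2; omega), mul_zero]
      have hroot : ∀ i, P.IsRoot (c i) := fun i => by
        obtain ⟨σ, hσ, he⟩ := hconj i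
        have h1 := congrArg σ h0
        rw [map_sum, map_zero] at h1
        rw [Polynomial.IsRoot, ← h1]
        simp only [P, Polynomial.eval_finsetSum]
        refine Finset.sum_congr rfl fun j _ => ?_
        rw [map_mul, map_pow, hσ _ (hr j), he]
        simp
      have h2 := Polynomial.card_le_degree_of_subset_roots (p := P)
        (Z := Finset.univ.map ⟨c, hc⟩) fun x hx => by
          obtain ⟨i, -, rfl⟩ := Finset.mem_map.1 (Finset.mem_def.2 hx)
          exact (Polynomial.mem_roots hne).2 (hroot i)
      rw [Finset.card_map, Finset.card_univ, Fintype.card_fin] at h2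
      rw [Polynomial.degree_eq_natDegree hne] at hdeg
      have : P.natDegree < g.natDegree := by exact_mod_cast hdeg
      omega
    funext i
    have h1 := congrArg (fun p => Polynomial.coeff p i) hP
    simp only [P, Polynomial.finsetSum_coeff, Polynomial.coeff_C_mul, Polynomial.coeff_X_pow,
      Polynomial.coeff_zero] at h1
    rw [Finset.sum_eq_single i] at h1
    · simpa using h1
    · intro j _ hj
      rw [if_neg fun h => hj (Fin.ext h).symm, mul_zero]
    · simp

end FreeBasis

/-! ### Freeness of rank `n!` over the symmetric Laurent polynomials. -/

section Laurent

variable (k : Type*) [Field k] (n : ℕ)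

/-- The subring generated by the symmetric Laurent polynomials and the first `j` variables. -/
def artinRing : ℕ → Subring (AddMonoidAlgebra k (Fin n → ℤ))
  | 0 => (symmetricAlg k n).toSubring
  | j + 1 => if h : j < n then adjoinElem (artinRing j) (weightVar k ⟨j, h⟩) else artinRing j

theorem artinRing_succ {j : ℕ} (h : j < n) :
    artinRing k n (j + 1) = adjoinElem (artinRing k n j) (weightVar k ⟨j, h⟩) := by
  rw [artinRing, dif_pos h]

variable {k n}

theorem artinRing_mono {i j : ℕ} (hij : i ≤ j) : artinRing k n i ≤ artinRing k n j := by
  induction j, hij using Nat.le_induction with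
  | base => exact le_rfl
  | succ j _ ih =>
    refine ih.trans ?_
    rw [artinRing]
    split_ifs
    · exact le_adjoinElem _ _
    · exact le_rfl

theorem weightVar_mem_artinRing (i : Fin n) {j : ℕ} (h : (i : ℕ) < j) :
    weightVar k i ∈ artinRing k n j := by
  refine artinRing_mono (Nat.succ_le_of_lt h) ?_
  rw [artinRing_succ k n i.2]
  exact self_mem_adjoinElem _ _

/-- This supplies the automorphisms that `isFreeBasis_pow` requires at stage `j`. -/
theorem weightPerm_artinRing {σ : Equiv.Perm (Fin n)} {j : ℕ}
    (hσ : ∀ i : Fin n, (i : ℕ) < j → σ i = i) {x : AddMonoidAlgebra k (Fin n → ℤ)}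
    (hx : x ∈ artinRing k n j) : weightPerm k σ x = x := by
  induction j generalizing x with
  | zero => exact hx σ
  | succ j ih =>
    rw [artinRing] at hx
    split_ifs at hx with h
    · obtain ⟨p, rfl⟩ := hx
      rw [Polynomial.coe_eval₂RingHom, Polynomial.eval₂_eq_sum_range, map_sum]
      refine Finset.sum_congr rfl fun m _ => ?_
      rw [map_mul, map_pow, weightPerm_var, hσ _ (Nat.lt_succ_self j)]
      congr 1
      exact ih (fun i hi => hσ i (hi.trans (Nat.lt_succ_self j))) (p.coeff m).2
    · exact ih (fun i hi => hσ i (hi.trans (Nat.lt_succ_self j))) hx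

variable (k) in
theorem weightVar_injective : Function.Injective (weightVar k : Fin n → _) := fun a b h => by
  by_contra hne
  refine weightVar_sub_ne_zero (k := k) hne 1 1 one_ne_zero ?_
  rw [h, sub_self]

/-- The product over all `i` has symmetric coefficients. At each stage the newly adjoined variable
is a root, and dividing by its monic linear factor stays within the enlarged coefficient ring. -/
theorem exists_artin_polynomial {j : ℕ} (hj : j ≤ n) :
    ∃ g : (artinRing k n j)[X], g.map (artinRing k n j).subtype =
      ∏ i ∈ Finset.univ.filter (fun i : Fin n => j ≤ i),
        (Polynomial.X - Polynomial.C (weightVar k i)) := by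
  induction j with
  | zero =>
    have hcoeff : ∀ m, (∏ i : Fin n, (Polynomial.X - Polynomial.C (weightVar k i))).coeff m ∈
        artinRing k n 0 := fun m σ => by
      have : (∏ i : Fin n, (Polynomial.X - Polynomial.C (weightVar k i))).map
          (weightPerm k σ : _ →+* _) = ∏ i : Fin n, (Polynomial.X - Polynomial.C (weightVar k i)) := by
        rw [Polynomial.map_prod]
        conv_rhs => rw [← Equiv.prod_comp σ]
        refine Finset.prod_congr rfl fun i _ => ?_
        rw [Polynomial.map_sub, Polynomial.map_X, Polynomial.map_C]
        congr 2
        exact weightPerm_var k σ i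
      conv_rhs => rw [← this]
      rw [Polynomial.coeff_map]
      rfl
    have hc : ((∏ i : Fin n, (Polynomial.X - Polynomial.C (weightVar k i))).coeffs :
        Set (AddMonoidAlgebra k (Fin n → ℤ))) ⊆ artinRing k n 0 := fun c hc => by
      obtain ⟨m, -, rfl⟩ := Polynomial.mem_coeffs_iff.1 (Finset.mem_coe.1 hc)
      exact hcoeff m
    refine ⟨Polynomial.toSubring _ (artinRing k n 0) hc, ?_⟩
    rw [Polynomial.map_toSubring]
    simp
  | succ j ih =>
    obtain ⟨g, hg⟩ := ih (by omega)
    have hjn : j < n := hj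
    have hle : artinRing k n j ≤ artinRing k n (j + 1) := artinRing_mono (Nat.le_succ j)
    let e : artinRing k n (j + 1) :=
      ⟨weightVar k ⟨j, hjn⟩, weightVar_mem_artinRing _ (Nat.lt_succ_self j)⟩
    let g' := g.map (Subring.inclusion hle)
    have hg' : g'.map (artinRing k n (j + 1)).subtype =
        (Polynomial.X - Polynomial.C (weightVar k ⟨j, hjn⟩)) *
        ∏ i ∈ Finset.univ.filter (fun i : Fin n => j + 1 ≤ i),
          (Polynomial.X - Polynomial.C (weightVar k i)) := by
      rw [Polynomial.map_map]
      have e1 : (artinRing k n (j + 1)).subtype.comp (Subring.inclusion hle) =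
          (artinRing k n j).subtype := rfl
      rw [e1, hg, ← Finset.prod_insert (f := fun i : Fin n =>
        (Polynomial.X - Polynomial.C (weightVar k i)))]
      · refine Finset.prod_congr ?_ fun _ _ => rfl
        ext i
        simp only [Finset.mem_filter, Finset.mem_univ, true_and, Finset.mem_insert, Fin.ext_iff]
        omega
      · simp
    have hroot : g'.IsRoot e := by
      apply Subtype.val_injective
      have h1 := Polynomial.eval_map_apply (f := (artinRing k n (j + 1)).subtype) (p := g') e
      have h2 : (artinRing k n (j + 1)).subtype e = weightVar k ⟨j, hjn⟩ := rfl
      rw [h2, hg', Polynomial.eval_mul, Polynomial.eval_sub, Polynomial.eval_X, Polynomial.eval_C,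
        sub_self, zero_mul] at h1
      exact h1.symm
    refine ⟨g' /ₘ (Polynomial.X - Polynomial.C e), ?_⟩
    have h3 := congrArg (Polynomial.map (artinRing k n (j + 1)).subtype)
      (Polynomial.mul_divByMonic_eq_iff_isRoot.2 hroot)
    rw [hg', Polynomial.map_mul, Polynomial.map_sub, Polynomial.map_X, Polynomial.map_C] at h3
    exact mul_left_cancel₀ (Polynomial.X_sub_C_ne_zero _) h3

/-- Stage `j` adjoins a root of a monic polynomial of degree `n - j`, so the ranks multiply to a
falling factorial. No hypothesis on the characteristic enters. -/
theorem exists_isFreeBasis_artinRing {j : ℕ} (hj : j ≤ n) :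
    ∃ (ι : Type) (_ : Fintype ι) (v : ι → AddMonoidAlgebra k (Fin n → ℤ)),
      Fintype.card ι = n.descFactorial j ∧ IsFreeBasis (artinRing k n 0) (artinRing k n j) v := by
  induction j with
  | zero =>
    refine ⟨Unit, inferInstance, fun _ => 1, by simp, fun c => ⟨fun hc => ⟨fun _ => c, fun _ => hc,
      by simp⟩, ?_⟩, fun r _ h => ?_⟩
    · rintro ⟨r, hr, rfl⟩
      simpa using hr ()
    · funext i
      simpa using h
  | succ j ih =>
    have hjn : j < n := hj
    obtain ⟨ι, _, v, hcard, hv⟩ := ih (by omega)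
    obtain ⟨g, hg⟩ := exists_artin_polynomial (k := k) (n := n) (j := j) (by omega)
    have hinj : Function.Injective (artinRing k n j).subtype := Subtype.val_injective
    have hmonic : g.Monic := by
      apply Polynomial.monic_of_injective hinj
      rw [hg]
      exact Polynomial.monic_prod_of_monic _ _ fun i _ => Polynomial.monic_X_sub_C _
    have hdeg : g.natDegree = n - j := by
      rw [← Polynomial.natDegree_map_eq_of_injective hinj, hg,
        Polynomial.natDegree_prod_of_monic _ _ fun i _ => Polynomial.monic_X_sub_C _]
      simp only [Polynomial.natDegree_X_sub_C, Finset.sum_const, smul_eq_mul, mul_one]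
      have e : (Finset.univ.filter fun i : Fin n => j ≤ i) = Finset.Ici ⟨j, hjn⟩ := by
        ext i
        simp [Fin.le_def]
      rw [e, Fin.card_Ici]
    have hroot : Polynomial.eval₂ (artinRing k n j).subtype (weightVar k ⟨j, hjn⟩) g = 0 := by
      rw [← Polynomial.eval_map, hg, Polynomial.eval_prod]
      exact Finset.prod_eq_zero (i := ⟨j, hjn⟩) (by simp) (by simp)
    -- The conjugates of `x_j` are `x_j, …, x_{n-1}`, reached by transpositions that fix the earlier
    -- variables.
    have hw := isFreeBasis_pow hmonic hroot
      (fun i => weightVar k ⟨j + i, by have := i.2; omega⟩)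
      (fun a b h => by
        have := weightVar_injective k h
        simp only [Fin.mk.injEq] at this
        exact Fin.ext (by omega))
      (fun i => ⟨(weightPerm k (Equiv.swap ⟨j, hjn⟩ ⟨j + i, by have := i.2; omega⟩) : _ →+* _),
        fun b hb => weightPerm_artinRing (fun l hl => Equiv.swap_apply_of_ne_of_ne
          (fun h => by rw [h] at hl; exact lt_irrefl _ hl)
          (fun h => by
            rw [h] at hl
            have : j + (i : ℕ) < j := hl
            omega)) hb, by
        refine (weightPerm_var k _ _).trans ?_
        rw [Equiv.swap_apply_left]⟩)
    rw [← artinRing_succ] at hw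
    refine ⟨ι × Fin g.natDegree, inferInstance, _, ?_, hv.trans hw⟩
    rw [Fintype.card_prod, hcard, Fintype.card_fin, hdeg, Nat.descFactorial_succ, mul_comm]

/-- Every monomial becomes one with nonnegative exponents after multiplication by a power of the
product of all variables, and that product is symmetric and invertible. -/
theorem artinRing_eq_top : artinRing k n n = ⊤ := by
  rw [eq_top_iff]
  rintro x -
  have hconst : ∀ m : ℤ, (AddMonoidAlgebra.single (fun _ => m) 1 :
      AddMonoidAlgebra k (Fin n → ℤ)) ∈ artinRing k n n := fun m =>
    artinRing_mono (Nat.zero_le n) fun σ => by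
      rw [weightPerm_single]
      rfl
  have hpos : ∀ μ : Fin n → ℕ, (AddMonoidAlgebra.single (fun i => (μ i : ℤ)) 1 :
      AddMonoidAlgebra k (Fin n → ℤ)) ∈ artinRing k n n := fun μ => by
    have e : (AddMonoidAlgebra.single (fun i => (μ i : ℤ)) 1 :
        AddMonoidAlgebra k (Fin n → ℤ)) = ∏ i, weightVar k i ^ μ i := by
      have h : ∀ S : Finset (Fin n), ∏ i ∈ S, weightVar k i ^ μ i =
          AddMonoidAlgebra.single (∑ i ∈ S, Pi.single i (μ i : ℤ)) 1 := fun S => by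
        induction S using Finset.induction_on with
        | empty => rfl
        | insert i S hi ih =>
          rw [Finset.prod_insert hi, Finset.sum_insert hi, ih, weightVar_pow,
            AddMonoidAlgebra.single_mul_single, mul_one]
      rw [h, Finset.univ_sum_single]
    rw [e]
    exact prod_mem fun i _ => pow_mem (weightVar_mem_artinRing i i.2) _
  induction x using AddMonoidAlgebra.induction_linear with
  | zero => exact zero_mem _
  | add x y hx hy => exact add_mem hx hy
  | single μ c =>
    obtain ⟨N, hN⟩ : ∃ N : ℕ, ∀ i, -μ i ≤ N :=
      ⟨∑ i, (-μ i).toNat, fun i => (Int.self_le_toNat _).trans (by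
        exact_mod_cast Finset.single_le_sum (f := fun i => (-μ i).toNat)
          (fun _ _ => Nat.zero_le _) (Finset.mem_univ i))⟩
    have e : (AddMonoidAlgebra.single μ c : AddMonoidAlgebra k (Fin n → ℤ)) =
        algebraMap k _ c * (AddMonoidAlgebra.single (fun i => ((μ i + N).toNat : ℤ)) 1 *
          AddMonoidAlgebra.single (fun _ => -(N : ℤ)) 1) := by
      rw [AddMonoidAlgebra.single_mul_single, mul_one, ← Algebra.smul_def,
        AddMonoidAlgebra.smul_single, smul_eq_mul, mul_one]
      congr 1
      funext i
      have := hN i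
      rw [Pi.add_apply, Int.toNat_of_nonneg (by omega)]
      ring
    rw [e]
    exact mul_mem (artinRing_mono (Nat.zero_le n) ((symmetricAlg k n).algebraMap_mem c))
      (mul_mem (hpos _) (hconst _))

/-- The Laurent polynomial ring is free of rank `n!` over the symmetric Laurent polynomials. -/
theorem exists_isFreeBasis_symmetric :
    ∃ (ι : Type) (_ : Fintype ι) (v : ι → AddMonoidAlgebra k (Fin n → ℤ)),
      Fintype.card ι = n.factorial ∧ IsFreeBasis (symmetricAlg k n).toSubring ⊤ v := by
  obtain ⟨ι, _, v, hcard, hv⟩ := exists_isFreeBasis_artinRing (k := k) (le_refl n)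
  rw [artinRing_eq_top] at hv
  exact ⟨ι, _, v, by rw [hcard, Nat.descFactorial_self], hv⟩

end Laurent

/-! ### Dimension of a specialised free module. -/

section Rank

variable {k : Type*} [Field k] {A B : Type*} [Ring A] [Ring B] [Algebra k A] [Algebra k B]

/-- Uniqueness of coordinates makes them linear and compatible with the right action of `B`.
Applying `χ` to them identifies the tensor product with `ι → k`. -/
theorem finrank_inducedModule {f : B →ₐ[k] A} (χ : B →ₐ[k] k) {ι : Type} [Fintype ι]
    {v : ι → A} (hspan : ∀ a, ∃ r : ι → B, ∑ i, v i * f (r i) = a)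
    (hind : ∀ r : ι → B, ∑ i, v i * f (r i) = 0 → r = 0) :
    Module.finrank k (InducedModule f χ) = Fintype.card ι := by
  classical
  choose r hr using hspan
  have huniq : ∀ r' a, ∑ i, v i * f (r' i) = a → r' = r a := fun r' a h => by
    rw [← sub_eq_zero]
    apply hind
    simp only [Pi.sub_apply, map_sub, mul_sub, Finset.sum_sub_distrib]
    rw [h, hr, sub_self]
  let T : A →ₗ[k] (ι → k) :=
    { toFun := fun a i => χ (r a i)
      map_add' := fun a b => by
        have := huniq (r a + r b) (a + b) (by
          simp only [Pi.add_apply, map_add, mul_add, Finset.sum_add_distrib, hr])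
        funext i
        rw [← this, Pi.add_apply, map_add, Pi.add_apply]
      map_smul' := fun c a => by
        have := huniq (c • r a) (c • a) (by
          simp only [Pi.smul_apply, map_smul, mul_smul_comm, ← Finset.smul_sum, hr])
        funext i
        rw [← this, Pi.smul_apply, map_smul, RingHom.id_apply, Pi.smul_apply] }
  have hT : ∀ b a, T (rightMul f (MulOpposite.op b) a) = χ b • T a := fun b a => by
    have := huniq (fun i => r a i * b) (a * f b) (by
      simp only [map_mul, ← mul_assoc, ← Finset.sum_mul, hr])
    funext i
    change χ (r (a * f b) i) = χ b * χ (r a i)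
    rw [← this, map_mul, mul_comm]
  let U : InducedModule f χ →ₗ[k] (ι → k) := TensorChar.lift T hT
  have hU : ∀ a, U (InducedModule.of f χ a) = T a := fun a => by
    rw [InducedModule.of_apply]
    exact (TensorChar.lift_mkQ T hT a 1).trans (one_smul _ _)
  have hsum : ∀ a, InducedModule.of f χ a = ∑ i, χ (r a i) • InducedModule.of f χ (v i) := fun a => by
    conv_lhs => rw [← hr a]
    rw [map_sum]
    exact Finset.sum_congr rfl fun i _ => TensorChar.of_act (rightMul f) χ (r a i) (v i)
  have hbij : Function.Bijective U := by
    constructor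
    · refine (injective_iff_map_eq_zero _).2 fun x hx => ?_
      obtain ⟨a, rfl⟩ := InducedModule.exists_tmul x
      rw [← InducedModule.of_apply] at hx ⊢
      rw [hU] at hx
      rw [hsum]
      refine Finset.sum_eq_zero fun i _ => ?_
      have : χ (r a i) = 0 := congrFun hx i
      rw [this, zero_smul]
    · intro c
      refine ⟨InducedModule.of f χ (∑ i, v i * f (algebraMap k B (c i))), ?_⟩
      rw [hU]
      funext i
      change χ (r _ i) = c i
      rw [← huniq (fun i => algebraMap k B (c i)) _ rfl, AlgHom.commutes]
      rfl
  rw [(LinearEquiv.ofBijective U hbij).finrank_eq, Module.finrank_fintype_fun_eq_card]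

end Rank

section

/-! ### Orders of finite groups and the quasi-banal hypothesis. -/

section Count

open Matrix

variable {n : ℕ}

/-- An upper triangular invertible matrix amounts to its diagonal and its entries above it. -/
def borelEquiv (κ : Type*) [Field κ] :
    borel n κ ≃ (Fin n → κˣ) × ({x : Fin n × Fin n // x.1 < x.2} → κ) where
  toFun g := (fun i => Units.mk0 ((g : GL (Fin n) κ) i i) fun h => by
      have h1 : ((g : GL (Fin n) κ) : Matrix (Fin n) (Fin n) κ).det = 0 := by
        rw [det_of_isUpperTriangular g.2]
        exact Finset.prod_eq_zero (Finset.mem_univ i) h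
      exact (isUnits_det_units (g : GL (Fin n) κ)).ne_zero h1,
    fun x => (g : GL (Fin n) κ) x.1.1 x.1.2)
  invFun d := by
    let A : Matrix (Fin n) (Fin n) κ := Matrix.of fun i j =>
      if i = j then (d.1 i : κ) else if h : i < j then d.2 ⟨(i, j), h⟩ else 0
    have hA : A.BlockTriangular id := fun i j (h : j < i) => by
      simp [A, h.ne', h.not_gt]
    have hd : A.det ≠ 0 := by
      rw [det_of_isUpperTriangular hA]
      exact Finset.prod_ne_zero_iff.2 fun i _ => by simp [A]
    exact ⟨GeneralLinearGroup.mkOfDetNeZero A hd, hA⟩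
  left_inv g := by
    refine Subtype.ext (Units.ext (Matrix.ext fun i j => ?_))
    change (if i = j then (g : GL (Fin n) κ) i i else
      if h : i < j then (g : GL (Fin n) κ) i j else 0) = (g : GL (Fin n) κ) i j
    split_ifs with h h'
    · rw [h]
    · rfl
    · exact (g.2 (lt_of_le_of_ne (not_lt.1 h') (Ne.symm h))).symm
  right_inv d := by
    refine Prod.ext (funext fun i => Units.ext ?_) (funext fun x => ?_)
    · exact if_pos rfl
    · change (if x.1.1 = x.1.2 then _ else _) = _
      rw [if_neg x.2.ne]
      exact dif_pos x.2

theorem card_borel (κ : Type*) [Field κ] [Finite κ] :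
    Nat.card (borel n κ) = (Nat.card κ - 1) ^ n *
      Nat.card κ ^ Nat.card {x : Fin n × Fin n // x.1 < x.2} := by
  rw [Nat.card_congr (borelEquiv κ), Nat.card_prod, Nat.card_fun, Nat.card_fun, Nat.card_units,
    Nat.card_fin]

/-- Each factor `q^{n-i} - 1` is split as `q - 1` times a geometric sum. The power `(q - 1)^n` is
then visible and can be cancelled against the order of the Borel subgroup. -/
theorem card_GL_eq (κ : Type*) [Field κ] [Finite κ] :
    Nat.card (GL (Fin n) κ) = (Nat.card κ - 1) ^ n * (Nat.card κ ^ (∑ i : Fin n, (i : ℕ)) *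
      ∏ i : Fin n, ∑ j ∈ Finset.range (n - i), Nat.card κ ^ j) := by
  have := Fintype.ofFinite κ
  have h1 : 1 ≤ Nat.card κ := Nat.card_pos
  have h3 : (Nat.card κ - 1) ^ n = ∏ _i : Fin n, (Nat.card κ - 1) := by simp
  rw [card_GL_field, ← Nat.card_eq_fintype_card, ← Finset.prod_pow_eq_pow_sum,
    ← Finset.prod_mul_distrib, h3, ← Finset.prod_mul_distrib]
  refine Finset.prod_congr rfl fun i _ => ?_
  have h2 : (∑ j ∈ Finset.range (n - i), Nat.card κ ^ j) * (Nat.card κ - 1) =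
      Nat.card κ ^ (n - i) - 1 := by
    exact geom_sum_mul_of_one_le h1 _
  rw [mul_left_comm, mul_comm (Nat.card κ - 1), h2, Nat.mul_sub, mul_one, ← pow_add,
    Nat.add_sub_cancel' i.2.le]

/-- The index of the Borel subgroup is prime to `ℓ` when `ℓ` is quasi-banal. -/
theorem index_borel_ne_zero (κ : Type*) [Field κ] [Finite κ] {ℓ : ℕ} [Fact ℓ.Prime]
    (k : Type*) [Field k] [CharP k ℓ] (hℓ : IsQuasiBanal ℓ n κ) :
    ((borel n κ).index : k) ≠ 0 := by
  have hℓ' : ℓ.Prime := Fact.out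
  have hm : Nat.card (borel n κ) * (borel n κ).index = Nat.card (GL (Fin n) κ) :=
    Subgroup.card_mul_index _
  rcases hℓ with h | ⟨h, h'⟩
  · rw [Ne, CharP.cast_eq_zero_iff k ℓ]
    exact fun h' => h (h'.trans (Dvd.intro_left _ hm))
  · have hq : (Nat.card κ : k) = 1 := by
      exact_mod_cast (CharP.natCast_eq_natCast k ℓ).2 h'
    rw [card_borel, card_GL_eq, mul_assoc] at hm
    have h1 : Nat.card κ - 1 ≠ 0 := by
      have : 1 < Nat.card κ := Finite.one_lt_card
      omega
    -- The cancellation has to take place in the natural numbers, because `q - 1` is zero in `k`.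
    -- Afterwards `q` becomes `1` and the index becomes `∏ (n - i)`, whose factors are positive and
    -- at most `n < ℓ`.
    have h2 := Nat.eq_of_mul_eq_mul_left (pow_pos (Nat.pos_of_ne_zero h1) n) hm
    have h3 := congrArg (Nat.cast : ℕ → k) h2
    push_cast at h3
    simp only [hq, one_pow, one_mul, Finset.sum_const, Finset.card_range, nsmul_eq_mul,
      mul_one] at h3
    rw [h3]
    refine Finset.prod_ne_zero_iff.2 fun i _ => ?_
    rw [Ne, CharP.cast_eq_zero_iff k ℓ]
    intro hd
    have := Nat.le_of_dvd (by have := i.2; omega) hd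
    omega

/-- In the banal case, `1 + q` is the geometric sum of length two in the order of `GL_n`, present
because `n ≥ 2`. In the other case `q + 1 = 2` in `k`, and `ℓ > n ≥ 2`. -/
theorem card_add_one_ne_zero (κ : Type*) [Field κ] [Finite κ] {ℓ : ℕ} [Fact ℓ.Prime]
    (k : Type*) [Field k] [CharP k ℓ] (hℓ : IsQuasiBanal ℓ n κ) (hn : 2 ≤ n) :
    (Nat.card κ : k) + 1 ≠ 0 := by
  rcases hℓ with h | ⟨h, h'⟩
  · intro h0
    have h1 : ℓ ∣ Nat.card κ + 1 := (CharP.cast_eq_zero_iff k ℓ _).1 (by exact_mod_cast h0)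
    refine h (h1.trans ?_)
    rw [card_GL_eq]
    refine Dvd.dvd.mul_left (Dvd.dvd.mul_left (?_ : Nat.card κ + 1 ∣ _) _) _
    refine Dvd.dvd.trans ?_ (Finset.dvd_prod_of_mem _ (Finset.mem_univ ⟨n - 2, by omega⟩))
    rw [show n - (⟨n - 2, by omega⟩ : Fin n) = 2 by simp; omega, Finset.sum_range_succ,
      Finset.sum_range_one, pow_zero, pow_one, add_comm]
  · have hq : (Nat.card κ : k) = 1 := by
      exact_mod_cast (CharP.natCast_eq_natCast k ℓ).2 h'
    rw [hq, one_add_one_eq_two]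
    intro h0
    have h1 : ℓ ∣ 2 := (CharP.cast_eq_zero_iff k ℓ _).1 (by exact_mod_cast h0)
    have := Nat.le_of_dvd two_pos h1
    omega

variable {O F : Type*} [CommRing O] [IsDomain O] [IsDiscreteValuationRing O] [Field F]
  [Algebra O F] [IsFractionRing O F] {ϖ : O} {t : Fˣ}

/-- As `O` is local, any entrywise lift of an invertible matrix has a unit as determinant. -/
theorem map_mk_surjective (hϖ : Irreducible ϖ) : Function.Surjective
    (GeneralLinearGroup.map (n := Fin n) (Ideal.Quotient.mk (Ideal.span {ϖ}))) := fun g => by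
  choose f hf using fun i j => Ideal.Quotient.mk_surjective (I := Ideal.span {ϖ}) (g i j)
  have hd : IsUnit (Matrix.of f).det := by
    by_contra h
    have h1 : (Matrix.of f).det ∈ Ideal.span {ϖ} := by
      rw [← hϖ.maximalIdeal_eq]
      exact (IsLocalRing.mem_maximalIdeal _).2 h
    have h2 := Ideal.Quotient.eq_zero_iff_mem.2 h1
    rw [RingHom.map_det] at h2
    have h3 : (Ideal.Quotient.mk (Ideal.span {ϖ})).mapMatrix (Matrix.of f) = g :=
      Matrix.ext hf
    rw [h3] at h2
    have := isUnits_det_units g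
    rw [h2] at this
    have hne : Ideal.span {ϖ} ≠ ⊤ := by
      rw [← hϖ.maximalIdeal_eq]
      exact (IsLocalRing.maximalIdeal.isMaximal O).ne_top
    have := Ideal.Quotient.nontrivial_iff.2 hne
    exact not_isUnit_zero ‹_›
  refine ⟨GeneralLinearGroup.mk'' _ hd, Units.ext (Matrix.ext hf)⟩

/-- The Iwahori subgroup is the preimage of the Borel subgroup under the surjective reduction map,
so the index can be computed over the residue field. -/
theorem ncard_image_maxCompact_iwahori [Finite (O ⧸ Ideal.span {ϖ})] (hϖ : Irreducible ϖ)
    (ht : (t : F) = algebraMap O F ϖ) :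
    (finite_image_maxCompact_iwahori (n := n) hϖ ht).toFinset.card =
      (borel n (O ⧸ Ideal.span {ϖ})).index := by
  rw [← Set.ncard_eq_toFinset_card _ (finite_image_maxCompact_iwahori (n := n) hϖ ht),
    ← Nat.card_coe_set_eq, ← Subgroup.index_comap_of_surjective _ (map_mk_surjective hϖ)]
  have hinj : Function.Injective (GeneralLinearGroup.map (n := Fin n) (algebraMap O F)) :=
    fun a b h => Units.ext (Matrix.ext fun i j => IsFractionRing.injective O F
      (congrArg (fun g : GL (Fin n) F => g i j) h))
  have hmem : ∀ a b : GL (Fin n) O,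
      (GeneralLinearGroup.map (algebraMap O F) a : GL (Fin n) F ⧸ iwahori n F ϖ) =
        GeneralLinearGroup.map (algebraMap O F) b ↔
      a⁻¹ * b ∈ (borel n (O ⧸ Ideal.span {ϖ})).comap
        (GeneralLinearGroup.map (n := Fin n) (Ideal.Quotient.mk (Ideal.span {ϖ}))) :=
    fun a b => by
      rw [QuotientGroup.eq, ← map_inv, ← map_mul]
      exact Subgroup.mem_map_iff_mem hinj
  refine (Nat.card_congr (Equiv.ofBijective (Quotient.lift (fun a =>
    ⟨(GeneralLinearGroup.map (algebraMap O F) a : GL (Fin n) F ⧸ iwahori n F ϖ),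
      _, ⟨a, rfl⟩, rfl⟩) fun a b h => Subtype.ext ((hmem a b).2 (QuotientGroup.leftRel_apply.1 h)))
    ⟨?_, ?_⟩)).symm
  · intro x y
    induction x using QuotientGroup.induction_on with
    | H a =>
      induction y using QuotientGroup.induction_on with
      | H b => exact fun h => QuotientGroup.eq.2 ((hmem a b).1 (Subtype.ext_iff.1 h))
  · rintro ⟨_, _, ⟨a, rfl⟩, rfl⟩
    exact ⟨QuotientGroup.mk a, rfl⟩

end Count

end

/-! ### The ring of integers of a finite extension of `ℚ_p`. -/

section Local

variable {p : ℕ} [Fact p.Prime] {F : Type*} [Field F] [Algebra ℚ_[p] F] [FiniteDimensional ℚ_[p] F]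
  [Algebra ℤ_[p] F] [IsScalarTower ℤ_[p] ℚ_[p] F]

variable (p) in
/-- An element of a finite extension of `ℚ_p` of spectral norm at most one is integral. -/
theorem isIntegral_of_spectralNorm_le_one {x : F} (hx : spectralNorm ℚ_[p] F x ≤ 1) :
    IsIntegral ℤ_[p] x := by
  have hx' : IsIntegral ℚ_[p] x := IsIntegral.of_finite _ _
  have h := (spectralValue_le_one_iff (minpoly.monic hx')).1 hx
  have hl : minpoly ℚ_[p] x ∈ Polynomial.lifts (algebraMap ℤ_[p] ℚ_[p]) :=
    (Polynomial.lifts_iff_coeff_lifts _).2 fun m => ⟨⟨_, h m⟩, rfl⟩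
  obtain ⟨P, hP, -, hmon⟩ := Polynomial.lifts_and_degree_eq_and_monic hl (minpoly.monic hx')
  refine ⟨P, hmon, ?_⟩
  rw [IsScalarTower.algebraMap_eq ℤ_[p] ℚ_[p] F, ← Polynomial.eval₂_map, hP]
  exact minpoly.aeval ℚ_[p] x

variable (p F) in
-- The spectral norm is multiplicative, so `x` or `x⁻¹` has norm at most one. Hence the integral
-- closure is a valuation ring.
theorem isIntegral_or_isIntegral_inv (x : F) : IsIntegral ℤ_[p] x ∨ IsIntegral ℤ_[p] x⁻¹ := by
  rcases eq_or_ne x 0 with rfl | hx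
  · exact Or.inl isIntegral_zero
  have h : spectralNorm ℚ_[p] F x * spectralNorm ℚ_[p] F x⁻¹ = 1 := by
    have h1 := map_mul (spectralMulAlgNorm ℚ_[p] F) x x⁻¹
    rw [mul_inv_cancel₀ hx] at h1
    rw [← spectralMulAlgNorm_def, ← spectralMulAlgNorm_def, ← h1, spectralMulAlgNorm_def,
      spectralNorm_one]
  rcases le_total (spectralNorm ℚ_[p] F x) 1 with h1 | h1
  · exact Or.inl (isIntegral_of_spectralNorm_le_one p h1)
  · refine Or.inr (isIntegral_of_spectralNorm_le_one p ?_)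
    rw [← h]
    exact le_mul_of_one_le_left (spectralNorm_nonneg _) h1

instance : IsFractionRing (integralClosure ℤ_[p] F) F :=
  IsIntegralClosure.isFractionRing_of_finite_extension ℤ_[p] ℚ_[p] F _

instance : Module.Finite ℤ_[p] (integralClosure ℤ_[p] F) :=
  IsIntegralClosure.finite ℤ_[p] ℚ_[p] F _

instance : ValuationRing (integralClosure ℤ_[p] F) := by
  refine (ValuationRing.iff_isInteger_or_isInteger (integralClosure ℤ_[p] F) F).2 fun x => ?_
  rcases isIntegral_or_isIntegral_inv p F x with h | h
  · exact Or.inl ⟨⟨x, h⟩, rfl⟩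
  · exact Or.inr ⟨⟨_, h⟩, rfl⟩

/-- A noetherian valuation ring that is not a field is discrete. The irreducible element excludes a
field. -/
theorem isDiscreteValuationRing_integralClosure {ϖ : integralClosure ℤ_[p] F}
    (hϖ : Irreducible ϖ) : IsDiscreteValuationRing (integralClosure ℤ_[p] F) := by
  have hnf : ¬ IsField (integralClosure ℤ_[p] F) := fun h => by
    obtain ⟨y, hy⟩ := h.mul_inv_cancel hϖ.ne_zero
    exact hϖ.not_isUnit (IsUnit.of_mul_eq_one _ hy)
  have : IsNoetherianRing (integralClosure ℤ_[p] F) := IsNoetherianRing.of_finite ℤ_[p] _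
  have h : IsDiscreteValuationRing (integralClosure ℤ_[p] F) ↔
      ValuationRing (integralClosure ℤ_[p] F) :=
    (IsDiscreteValuationRing.TFAE (integralClosure ℤ_[p] F) hnf).out 0 1
  exact h.2 inferInstance

/-- Otherwise `p` would be a unit, so `1/p` would be integral over `ℤ_p`, which is integrally
closed. -/
theorem natCast_mem_span {ϖ : integralClosure ℤ_[p] F} (hϖ : Irreducible ϖ) :
    (p : integralClosure ℤ_[p] F) ∈ Ideal.span {ϖ} := by
  have := isDiscreteValuationRing_integralClosure hϖ
  rw [← hϖ.maximalIdeal_eq, IsLocalRing.mem_maximalIdeal]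
  intro h
  obtain ⟨y, hy⟩ := h.exists_right_inv
  have hp : (p : ℚ_[p]) ≠ 0 := by exact_mod_cast (Fact.out : p.Prime).ne_zero
  have h1 : algebraMap ℚ_[p] F (p : ℚ_[p])⁻¹ = y := by
    have h2 : (p : F) * (y : F) = 1 := by exact_mod_cast congrArg Subtype.val hy
    rw [map_inv₀, map_natCast]
    exact inv_eq_of_mul_eq_one_right h2
  have h2 : IsIntegral ℤ_[p] (p : ℚ_[p])⁻¹ := by
    rw [← isIntegral_algebraMap_iff (FaithfulSMul.algebraMap_injective ℚ_[p] F), h1]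
    exact y.2
  obtain ⟨z, hz⟩ := IsIntegrallyClosed.isIntegral_iff.1 h2
  refine PadicInt.p_nonunit (p := p) (IsUnit.of_mul_eq_one z (Subtype.ext ?_))
  have h3 : (z : ℚ_[p]) = (p : ℚ_[p])⁻¹ := hz
  rw [PadicInt.coe_mul, PadicInt.coe_natCast, h3, mul_inv_cancel₀ hp, PadicInt.coe_one]

/-- The ring of integers is finite over `ℤ_p` and `p` lies in `(ϖ)`, so this is a quotient of a
finite module over `ℤ/p`. -/
theorem finite_quotient_uniformizer {ϖ : integralClosure ℤ_[p] F} (hϖ : Irreducible ϖ) :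
    Finite (integralClosure ℤ_[p] F ⧸ Ideal.span {ϖ}) := by
  have h1 : Finite (ℤ_[p] ⧸ Ideal.span {(p : ℤ_[p])}) := by
    rw [← PadicInt.maximalIdeal_eq_span_p]
    exact Finite.of_equiv _ (PadicInt.residueField (p := p)).symm.toEquiv
  have h2 := Submodule.finite_quotient_smul (M := integralClosure ℤ_[p] F)
    (Ideal.span {(p : ℤ_[p])}) (N := ⊤) Module.Finite.fg_top
  have h3 : Ideal.span {(p : ℤ_[p])} • (⊤ : Submodule ℤ_[p] (integralClosure ℤ_[p] F)) ≤
      (Ideal.span {ϖ}).restrictScalars ℤ_[p] := by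
    refine Submodule.smul_le.2 fun a ha x _ => ?_
    obtain ⟨b, rfl⟩ := Ideal.mem_span_singleton'.1 ha
    rw [mul_smul, Nat.cast_smul_eq_nsmul, nsmul_eq_mul]
    exact Submodule.smul_mem _ b (Ideal.mul_mem_right _ _ (natCast_mem_span hϖ))
  exact Finite.of_surjective _ (Submodule.factor_surjective h3)

/-- If `ℓ` divided the order, Cauchy's theorem would give an element of additive order `ℓ`, although
the residue ring is killed by `p`. -/
theorem natCard_quotient_ne_zero {ϖ : integralClosure ℤ_[p] F} (hϖ : Irreducible ϖ) {ℓ : ℕ}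
    [hℓ : Fact ℓ.Prime] (hℓp : ℓ ≠ p) (k : Type*) [Field k] [CharP k ℓ] :
    (Nat.card (integralClosure ℤ_[p] F ⧸ Ideal.span {ϖ}) : k) ≠ 0 := by
  have := finite_quotient_uniformizer hϖ
  rw [Ne, CharP.cast_eq_zero_iff k ℓ]
  intro h
  obtain ⟨x, hx⟩ := exists_prime_addOrderOf_dvd_card' ℓ h
  have h1 : p • x = 0 := by
    rw [nsmul_eq_mul, ← map_natCast (Ideal.Quotient.mk (Ideal.span {ϖ})),
      Ideal.Quotient.eq_zero_iff_mem.2 (natCast_mem_span hϖ), zero_mul]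
  have h2 := addOrderOf_dvd_of_nsmul_eq_zero h1
  rw [hx] at h2
  exact hℓp ((Nat.prime_dvd_prime_iff_eq hℓ.out Fact.out).1 h2)

theorem coe_uniformizerUnit {ϖ : integralClosure ℤ_[p] F} (hϖ : Irreducible ϖ) :
    (uniformizerUnit hϖ : F) = algebraMap (integralClosure ℤ_[p] F) F ϖ := rfl

end Local

end UnramifiedModule

end

namespace UnramifiedModule

/-! ### Assembly of the theorem. -/

section Conclusion

variable {k : Type*} [Field k] {n : ℕ} {O F : Type*} [CommRing O] [IsDomain O]
  [IsDiscreteValuationRing O] [Field F] [Algebra O F] [IsFractionRing O F] {ϖ : O}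
  [Finite (O ⧸ Ideal.span {ϖ})] {t : Fˣ} {s : k}
  {θ : AddMonoidAlgebra k (Fin n → ℤ) →ₐ[k] IwahoriHecke k n F ϖ}

/-- `A ⊗_{Z, χ} k` has dimension `n!`. -/
theorem finrank_inducedModule_satake (hϖ : Irreducible ϖ) (ht : (t : F) = algebraMap O F ϖ)
    (hs0 : s ≠ 0) (hs : s ^ 2 = (Nat.card (O ⧸ Ideal.span {ϖ}) : k)) (hθ : IsBernstein t s θ)
    (hq1 : 2 ≤ n → (Nat.card (O ⧸ Ideal.span {ϖ}) : k) + 1 ≠ 0)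
    (χ : SphericalHecke k n O F →ₐ[k] k) :
    Module.finrank k (InducedModule (θ.rangeRestrict.comp (satake hϖ ht hs0 hs hθ)) χ) =
      n.factorial := by
  obtain ⟨ι, _, v, hcard, hv⟩ := exists_isFreeBasis_symmetric (k := k) (n := n)
  have hrange := range_satake hϖ ht hs0 hs hθ hq1
  have hθi := injective_of_isBernstein hϖ ht hs0 hs hθ
  have hsum : ∀ r : ι → SphericalHecke k n O F,
      ∑ i, θ.rangeRestrict (v i) * θ.rangeRestrict.comp (satake hϖ ht hs0 hs hθ) (r i) =
        θ.rangeRestrict (∑ i, satake hϖ ht hs0 hs hθ (r i) * v i) := fun r => by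
    rw [map_sum]
    refine Finset.sum_congr rfl fun i _ => ?_
    rw [mul_comm (satake hϖ ht hs0 hs hθ (r i)), map_mul]
    rfl
  rw [← hcard]
  refine finrank_inducedModule χ (v := fun i => θ.rangeRestrict (v i)) (fun a => ?_) fun r hr => ?_
  · obtain ⟨x, rfl⟩ := θ.rangeRestrict_surjective a
    obtain ⟨r, hr, rfl⟩ := (hv.mem_iff x).1 (Subring.mem_top x)
    have hr' : ∀ i, ∃ z, satake hϖ ht hs0 hs hθ z = r i := fun i => by
      have : r i ∈ (satake hϖ ht hs0 hs hθ).range := hrange ▸ hr i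
      exact this
    choose z hz using hr'
    refine ⟨z, (hsum z).trans ?_⟩
    simp only [hz]
  · have h0 : ∑ i, satake hϖ ht hs0 hs hθ (r i) * v i = 0 := by
      apply hθi
      rw [map_zero]
      exact congrArg Subtype.val ((hsum r).symm.trans hr)
    have h1 := hv.indep _ (fun i => by
      have : satake hϖ ht hs0 hs hθ (r i) ∈ symmetricAlg k n := hrange ▸ ⟨r i, rfl⟩
      exact this) h0
    funext i
    refine (isSatakeEmbedding_satake hϖ ht hs0 hs hθ).1 ?_
    exact (congrFun h1 i).trans (map_zero _).symm

theorem exists_unramified_module_equiv (hϖ : Irreducible ϖ) (ht : (t : F) = algebraMap O F ϖ)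
    (hs0 : s ≠ 0) (hs : s ^ 2 = (Nat.card (O ⧸ Ideal.span {ϖ}) : k))
    (hcard : ((finite_image_maxCompact_iwahori (n := n) hϖ ht).toFinset.card : k) ≠ 0)
    (hq1 : 2 ≤ n → (Nat.card (O ⧸ Ideal.span {ϖ}) : k) + 1 ≠ 0) :
    Nonempty (fixedVectors (cosetRep k (maxCompact n O F)) (iwahori n F ϖ)
        ≃ₗ[IwahoriHecke k n F ϖ] InducedTrivial k n F ϖ) ∧
    ∃ (θ : AddMonoidAlgebra k (Fin n → ℤ) →ₐ[k] IwahoriHecke k n F ϖ)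
      (S : SphericalHecke k n O F →ₐ[k] AddMonoidAlgebra k (Fin n → ℤ)),
      IsBernsteinEmbedding t s θ ∧ IsSatakeEmbedding t s S ∧
      ∃ φ : θ.range ≃ₗ[k] InducedTrivial k n F ϖ,
        (∀ a : θ.range, φ a = InducedModule.tmul _ _ (a : IwahoriHecke k n F ϖ) 1) ∧
        ∀ χ : SphericalHecke k n O F →ₐ[k] k,
          Module.finrank k (InducedModule (θ.rangeRestrict.comp S) χ) = n.factorial ∧
          ∃ Ψ : InducedModule (θ.rangeRestrict.comp S) χ ≃ₗ[k]
              fixedVectors (universalModule (maxCompact n O F) χ) (iwahori n F ϖ),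
            ∀ (h : IwahoriHecke k n F ϖ) (a : θ.range) (c : k),
              h • Ψ (InducedModule.tmul _ _ a c) =
                Ψ (InducedModule.tmul _ _ (φ.symm (h • φ a)) c) := by
  have hq : (Nat.card (O ⧸ Ideal.span {ϖ}) : k) ≠ 0 := hs ▸ pow_ne_zero 2 hs0
  obtain ⟨Θ, hΘ⟩ := exists_induced_equiv_fixed hϖ ht hcard
  obtain ⟨θ, hθ⟩ := exists_isBernstein (n := n) hϖ ht hq hs0
  obtain ⟨φ, hφ, hφ'⟩ := exists_bernstein_equiv_induced Θ hΘ
    (bernsteinMap_bijective hϖ ht hs0 hs hθ)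
  refine ⟨⟨Θ.symm⟩, θ, satake hϖ ht hs0 hs hθ, ⟨injective_of_isBernstein hϖ ht hs0 hs hθ, hθ⟩,
    isSatakeEmbedding_satake hϖ ht hs0 hs hθ, φ, hφ, fun χ =>
      ⟨finrank_inducedModule_satake hϖ ht hs0 hs hθ hq1 χ,
        LinearEquiv.ofBijective _ (inducedToUniversal_bijective hϖ ht hs0 hs hθ χ),
        fun h a c => ?_⟩⟩
  -- Both sides are images of vectors of `k[G/K]^I`, so linearity reduces to `hφ'`: the action
  -- transported through `φ` satisfies `(h · a) 1_K = h (a 1_K)`.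
  refine (congrArg (h • ·) (inducedToUniversal_tmul hϖ ht hs0 hs hθ χ a c)).trans
    (Eq.trans ?_ (inducedToUniversal_tmul hϖ ht hs0 hs hθ χ _ c).symm)
  rw [hφ', map_smul _ h]
  exact Subtype.ext (HeckeAlgebra.orbitMap_smul _ c _ h.val)

end Conclusion

end UnramifiedModule

theorem mainTheorem12 (p : ℕ) [Fact p.Prime] (ℓ : ℕ) [Fact ℓ.Prime] (hℓp : ℓ ≠ p)
    (F : Type*) [Field F] [Algebra ℚ_[p] F] [FiniteDimensional ℚ_[p] F]
    [Algebra ℤ_[p] F] [IsScalarTower ℤ_[p] ℚ_[p] F]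
    (k : Type*) [Field k] [IsAlgClosed k] [CharP k ℓ]
    (n : ℕ)
    (ϖ : integralClosure ℤ_[p] F) (hϖ : Irreducible ϖ)
    (hℓ : IsQuasiBanal ℓ n (integralClosure ℤ_[p] F ⧸ Ideal.span {ϖ}))
    (s : k) (hs : s ^ 2 = (Nat.card (integralClosure ℤ_[p] F ⧸ Ideal.span {ϖ}) : k)) :
    -- the isomorphism `k[G/K]^I ≅ H(G,I)_k ⊗_{H_{W,k}} 1`
    Nonempty
      (fixedVectors (cosetRep k (maxCompact n (integralClosure ℤ_[p] F) F)) (iwahori n F ϖ)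
        ≃ₗ[IwahoriHecke k n F ϖ] InducedTrivial k n F ϖ) ∧
    -- the Bernstein embedding `θ`, with image `A_k`, and the Satake embedding `S` of `Z_k`
    ∃ (θ : AddMonoidAlgebra k (Fin n → ℤ) →ₐ[k] IwahoriHecke k n F ϖ)
      (S : SphericalHecke k n (integralClosure ℤ_[p] F) F →ₐ[k]
        AddMonoidAlgebra k (Fin n → ℤ)),
      IsBernsteinEmbedding (uniformizerUnit hϖ) s θ ∧
      IsSatakeEmbedding (uniformizerUnit hϖ) s S ∧
      -- `a ↦ a ⊗ 1` is an isomorphism `φ : A_k ≅ H(G,I)_k ⊗_{H_{W,k}} 1`,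
      -- through which `H(G,I)_k` acts on `A_k`
      ∃ φ : θ.range ≃ₗ[k] InducedTrivial k n F ϖ,
        (∀ a : θ.range, φ a = InducedModule.tmul _ _ (a : IwahoriHecke k n F ϖ) 1) ∧
        -- for every character `lam` of `Z_k`, `M_{lam,k}^I` is isomorphic as an
        -- `H(G,I)_k`-module to `A_k ⊗_{Z_k,lam} k`, which has dimension `n!`
        ∀ lam : SphericalHecke k n (integralClosure ℤ_[p] F) F →ₐ[k] k,
          Module.finrank k (InducedModule (θ.rangeRestrict.comp S) lam) = n.factorial ∧
          ∃ Ψ : InducedModule (θ.rangeRestrict.comp S) lam ≃ₗ[k]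
              fixedVectors (universalModule (maxCompact n (integralClosure ℤ_[p] F) F) lam)
                (iwahori n F ϖ),
            ∀ (h : IwahoriHecke k n F ϖ) (a : θ.range) (c : k),
              h • Ψ (InducedModule.tmul _ _ a c) =
                Ψ (InducedModule.tmul _ _ (φ.symm (h • φ a)) c) := by
  have := isDiscreteValuationRing_integralClosure hϖ
  have := finite_quotient_uniformizer hϖ
  have hmax : (Ideal.span {ϖ}).IsMaximal := by
    rw [← hϖ.maximalIdeal_eq]
    exact IsLocalRing.maximalIdeal.isMaximal _
  let := Ideal.Quotient.field (Ideal.span {ϖ})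
  have hq := natCard_quotient_ne_zero hϖ hℓp k
  have hs0 : s ≠ 0 := fun h => hq (by rw [← hs, h, zero_pow two_ne_zero])
  have ht := coe_uniformizerUnit hϖ
  refine exists_unramified_module_equiv hϖ ht hs0 hs ?_ ?_
  · rw [ncard_image_maxCompact_iwahori hϖ ht]
    exact index_borel_ne_zero _ k hℓ
  · exact card_add_one_ne_zero _ k hℓ
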